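/- **Setting.** Let $\Omega\subset\mathbb C^n$ be a smoothly bounded domain (a bounded, connected, non-empty open set with $C^\infty$ boundary $b\Omega$), and let $s,q\ge 0$ be integers. Write $z_j=x_j+ix_{j+n}$, $D_k=\partial/\partial x_k$ for $1\le k\le 2n$, and $\gamma_\alpha=|\alpha|!/\alpha!$ for a multi-index $\alpha\in\mathbb Z_{\ge0}^{2n}$. Let $C^\infty_{(0,q)}(\overline\Omega)$ be the space of forms $\phi=\sum_{|J|=q}\phi_J\,d\bar z^J$ ($J$ running over increasing $q$-tuples) whose coefficients are restrictions to $\overline\Omega$ of $C^\infty$ functions on $\mathbb C^n$, and put $$\langle\phi,\psi\rangle_s=\sum_{|J|=q}\ \sum_{|\alpha|\le s}\gamma_\alpha\int_\Omega D^\alpha\phi_J\,\overline{D^\alpha\psi_J}.$$ Let $W^s_{(0,q)}(\Omega)$ be the Hilbert space obtained as the closure (completion) of $C^\infty_{(0,q)}(\overline\Omega)$ with respect to $\langle\cdot,\cdot\rangle_s$. Let $$\bar\partial:W^s_{(0,q)}(\Omega)\to W^s_{(0,q+1)}(\Omega)$$ be the closed, densely defined operator which is the closure of $$\bar\partial\phi=\sum_{|K|=q+1}\sum_{k,J}\varepsilon^K_{kJ}\frac{\partial\phi_J}{\partial\bar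 z_k}\,d\bar z^K,\qquad \phi\in C^\infty_{(0,q)}(\overline\Omega),$$ where $\varepsilon^K_{kJ}$ is the sign of the permutation taking $(k,J)$ to $K$ if $\{k\}\cup J=K$ as sets (with $k\notin J$), and $0$ otherwise. Let $\bar\partial^*$ be the Hilbert space adjoint of this operator. Let $\varrho$ be the signed Euclidean distance to $b\Omega$ (negative in $\Omega$, positive outside $\overline\Omega$), which is $C^\infty$ near $b\Omega$. Let $N=\operatorname{grad}\varrho$, regarded as a first-order differential operator near $b\Omega$, and let $N^s$ be its $s$-fold composition. For a $(0,q+1)$-form $\psi=\sum_K\psi_K\,d\bar z^K$ and a $(0,1)$-form $\omega=\sum_k\omega_k\,d\bar z_k$ let $\psi\lrcorner\omega$ be the $(0,q)$-form with coefficients $$(\psi\lrcorner\omega)_I=\sum_{k,K}\varepsilon^K_{kI}\,\psi_K\,\overline{\omega_k},\qquad |I|=q.$$ **Proposition.** For every $\psi\in C^\infty_{(0,q+1)}(\overline\Omega)$, $$\psi\in\operatorname{dom}\bar\partial^*\iff N^s\bigl(\psi\lrcorner\bar\partial\varrho\bigr)_I=0\ \text{ on } b\Omega\ \text{ for every increasing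 } I \text{ with } |I|=q.$$ -/

import Mathlib

open MeasureTheory
open scoped ContDiff LinearPMap

noncomputable section

namespace DbarSobolev

/-! ### Functions on `ℂⁿ` and their derivatives -/

/-- `ℂⁿ` with its Euclidean norm. -/
abbrev Cn (n : ℕ) : Type := EuclideanSpace ℂ (Fin n)

/-- Indices of the `2n` real coordinates of `ℂⁿ`: `Sum.inl j` stands for `Re z_j` and
`Sum.inr j` for `Im z_j`. -/
abbrev RealIdx (n : ℕ) : Type := Fin n ⊕ Fin n

/-- The unit vector of `ℂⁿ` in the direction of a real coordinate. -/
def dirVec {n : ℕ} : RealIdx n → Cn n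
  | Sum.inl j => EuclideanSpace.single j 1
  | Sum.inr j => EuclideanSpace.single j Complex.I

/-- The partial derivative `D_i f` in the direction of a real coordinate. -/
def partialD {n : ℕ} (i : RealIdx n) (f : Cn n → ℂ) : Cn n → ℂ :=
  fun x => fderiv ℝ f x (dirVec i)

/-- `∂f/∂z̄_k = (1/2)(∂f/∂x_k + i ∂f/∂y_k)`. -/
def wirtingerBar {n : ℕ} (k : Fin n) (f : Cn n → ℂ) : Cn n → ℂ :=
  fun x => (1 / 2 : ℂ) * (partialD (Sum.inl k) f x + Complex.I * partialD (Sum.inr k) f x)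

/-- The space of complex-valued `C^∞` functions on `ℂⁿ`; the functions in `C^∞(Ω̄)` are the
restrictions of these to `Ω̄`. -/
def SmoothFn (n : ℕ) : Submodule ℂ (Cn n → ℂ) where
  carrier := {f | ContDiff ℝ ∞ f}
  add_mem' {f g} (hf : ContDiff ℝ ∞ f) (hg : ContDiff ℝ ∞ g) := hf.add hg
  zero_mem' := (contDiff_const : ContDiff ℝ ∞ fun _ : Cn n => (0 : ℂ))
  smul_mem' c {f} (hf : ContDiff ℝ ∞ f) := hf.const_smul c

theorem contDiff_coe {n : ℕ} (f : SmoothFn n) : ContDiff ℝ ∞ (f : Cn n → ℂ) := f.2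

theorem differentiableAt_coe {n : ℕ} (f : SmoothFn n) (x : Cn n) :
    DifferentiableAt ℝ (f : Cn n → ℂ) x :=
  (contDiff_coe f).differentiable (by simp) x

theorem contDiff_partialD {n : ℕ} (i : RealIdx n) {f : Cn n → ℂ} (hf : ContDiff ℝ ∞ f) :
    ContDiff ℝ ∞ (partialD i f) :=
  (hf.fderiv_right (m := ∞) (by simp)).clm_apply contDiff_const

/-- `D_i` as a linear operator on smooth functions. -/
def smoothD {n : ℕ} (i : RealIdx n) : Module.End ℂ (SmoothFn n) where
  toFun f := ⟨partialD i f, contDiff_partialD i f.2⟩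
  map_add' f g := by
    ext x
    simp [partialD, fderiv_add (differentiableAt_coe f x) (differentiableAt_coe g x)]
  map_smul' c f := by
    ext x
    simp [partialD, fderiv_const_smul (differentiableAt_coe f x) c]

/-- `∂/∂z̄_k` as a linear operator on smooth functions. -/
def smoothWirtingerBar {n : ℕ} (k : Fin n) : Module.End ℂ (SmoothFn n) :=
  (1 / 2 : ℂ) • (smoothD (Sum.inl k) + Complex.I • smoothD (Sum.inr k))

theorem smoothWirtingerBar_coe {n : ℕ} (k : Fin n) (f : SmoothFn n) :
    (smoothWirtingerBar k f : Cn n → ℂ) = wirtingerBar k f := by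
  ext x
  simp [smoothWirtingerBar, wirtingerBar, smoothD, mul_add]

/-- Multi-indices `α` in the `2n` real coordinates with `|α| ≤ s`. -/
abbrev MultiIdx (n s : ℕ) : Type := {α : RealIdx n → ℕ // ∑ i, α i ≤ s}

instance (n s : ℕ) : Finite (MultiIdx n s) := by
  have h : ({α : RealIdx n → ℕ | ∑ i, α i ≤ s}).Finite :=
    (Set.finite_Iic (fun _ : RealIdx n => s)).subset fun α hα i =>
      (Finset.single_le_sum (f := α) (fun _ _ => Nat.zero_le _) (Finset.mem_univ i)).trans hα
  exact h.to_subtype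

instance (n s : ℕ) : Fintype (MultiIdx n s) := Fintype.ofFinite _

/-- `D^α`, the product over the real coordinates of the powers `D_i ^ α_i` (on smooth functions the
order of the factors is immaterial). -/
def smoothDMulti {n : ℕ} (α : RealIdx n → ℕ) : Module.End ℂ (SmoothFn n) :=
  ((List.finRange n).map fun j => smoothD (Sum.inl j) ^ α (Sum.inl j)).prod *
    ((List.finRange n).map fun j => smoothD (Sum.inr j) ^ α (Sum.inr j)).prod

/-- `γ_α = |α|! / α!`. -/
def gammaCoeff {n : ℕ} (α : RealIdx n → ℕ) : ℕ := Nat.multinomial Finset.univ α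

/-! ### Domains -/

/-- A smoothly bounded domain in `ℂⁿ`: bounded, open, connected and non-empty, and near every
boundary point it is the set where a real `C^∞` function with non-vanishing differential at that
point is negative. -/
structure SmoothlyBoundedDomain (n : ℕ) where
  carrier : Set (Cn n)
  isOpen : IsOpen carrier
  isConnected : IsConnected carrier
  isBounded : Bornology.IsBounded carrier
  smooth_boundary : ∀ p ∈ frontier carrier, ∃ U : Set (Cn n), IsOpen U ∧ p ∈ U ∧
    ∃ r : Cn n → ℝ, ContDiffOn ℝ ∞ r U ∧ fderiv ℝ r p ≠ 0 ∧
      ∀ x ∈ U, x ∈ carrier ↔ r x < 0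

open scoped Classical in
/-- The signed Euclidean distance `ϱ` to `bΩ`, negative inside and positive outside. -/
def signedDist {n : ℕ} (Ω : SmoothlyBoundedDomain n) (x : Cn n) : ℝ :=
  if x ∈ Ω.carrier then -Metric.infDist x (frontier Ω.carrier)
  else Metric.infDist x (frontier Ω.carrier)

/-- The vector field `N = grad ϱ` acting on functions. -/
def normalD {n : ℕ} (Ω : SmoothlyBoundedDomain n) (f : Cn n → ℂ) : Cn n → ℂ :=
  fun x => fderiv ℝ f x (gradient (signedDist Ω) x)

/-! ### Forms of type `(0,q)` -/

/-- Increasing `q`-tuples `J` of indices in `{1, …, n}`. -/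
abbrev FormIdx (n q : ℕ) : Type := {J : Fin q → Fin n // StrictMono J}

instance (n q : ℕ) : Fintype (FormIdx n q) := Fintype.ofFinite _

/-- The sign `ε^K_{kJ}` of the permutation taking `(k, J)` to `K` if there is one (it is then
unique, the entries of `K` being distinct), and `0` otherwise. -/
def epsSign {n q : ℕ} (K : FormIdx n (q + 1)) (k : Fin n) (J : FormIdx n q) : ℤ :=
  ∑ σ : Equiv.Perm (Fin (q + 1)),
    if (fun a => (Fin.cons k J.1 : Fin (q + 1) → Fin n) (σ a)) = K.1
      then ((Equiv.Perm.sign σ : ℤˣ) : ℤ) else 0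

/-- A `(0,q)`-form with smooth coefficients, given by its coefficients `φ_J`. -/
abbrev SmoothForm (n q : ℕ) : Type := FormIdx n q → SmoothFn n

/-- `∂̄` on smooth `(0,q)`-forms:
`(∂̄φ)_K = ∑_{k,J} ε^K_{kJ} ∂φ_J/∂z̄_k`. -/
def smoothDbar (n q : ℕ) : SmoothForm n q →ₗ[ℂ] SmoothForm n (q + 1) :=
  LinearMap.pi fun K => ∑ k : Fin n, ∑ J : FormIdx n q,
    (epsSign K k J : ℂ) • (smoothWirtingerBar k ∘ₗ LinearMap.proj J)

/-- The contraction `(ψ ⌟ η)_I = ∑_{k,K} ε^K_{kI} ψ_K η̄_k` of a `(0,q+1)`-form with a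
`(0,1)`-form `η = ∑_k η_k dz̄_k`, both given by their coefficient functions. -/
def contraction {n q : ℕ} (ψ : FormIdx n (q + 1) → Cn n → ℂ) (η : Fin n → Cn n → ℂ)
    (I : FormIdx n q) : Cn n → ℂ :=
  fun x => ∑ k : Fin n, ∑ K : FormIdx n (q + 1),
    (epsSign K k I : ℂ) * ψ K x * (starRingEnd ℂ) (η k x)

/-- The coefficients `∂ϱ/∂z̄_k` of `∂̄ϱ`. -/
def dbarSignedDist {n : ℕ} (Ω : SmoothlyBoundedDomain n) (k : Fin n) : Cn n → ℂ :=
  wirtingerBar k fun x => (signedDist Ω x : ℂ)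

/-! ### The Sobolev space of forms -/

theorem memLp_smooth {n : ℕ} (Ω : SmoothlyBoundedDomain n) (f : SmoothFn n) :
    MemLp (f : Cn n → ℂ) 2 (volume.restrict Ω.carrier) := by
  have hc : Continuous (f : Cn n → ℂ) := (contDiff_coe f).continuous
  have hK : IsCompact (closure Ω.carrier) := Ω.isBounded.isCompact_closure
  obtain ⟨C, hC⟩ := hK.exists_bound_of_continuousOn hc.continuousOn
  have : IsFiniteMeasure (volume.restrict Ω.carrier) :=
    ⟨by rw [Measure.restrict_apply_univ]; exact Ω.isBounded.measure_lt_top⟩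
  refine MemLp.of_bound hc.aestronglyMeasurable C ?_
  filter_upwards [ae_restrict_mem Ω.isOpen.measurableSet] with x hx using
    hC x (subset_closure hx)

/-- The class in `L²(Ω)` of a smooth function. -/
def toL2 {n : ℕ} (Ω : SmoothlyBoundedDomain n) :
    SmoothFn n →ₗ[ℂ] Lp ℂ 2 (volume.restrict Ω.carrier) where
  toFun f := (memLp_smooth Ω f).toLp _
  map_add' f g := MemLp.toLp_add (memLp_smooth Ω f) (memLp_smooth Ω g)
  map_smul' c f := MemLp.toLp_const_smul c (memLp_smooth Ω f)

/-- The Hilbert sum of copies of `L²(Ω)` that holds all derivatives of order at most `s` of all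
coefficients of a `(0,q)`-form. -/
abbrev JetSpace {n : ℕ} (Ω : SmoothlyBoundedDomain n) (s q : ℕ) : Type :=
  PiLp 2 fun _ : FormIdx n q × MultiIdx n s => Lp ℂ 2 (volume.restrict Ω.carrier)

/-- `φ ↦ (√γ_α D^α φ_J)_{J, α}`; by `inner_jet` below it carries the Sobolev inner product
`⟨·,·⟩_s` to the inner product of the Hilbert sum. -/
def jet {n : ℕ} (Ω : SmoothlyBoundedDomain n) (s q : ℕ) :
    SmoothForm n q →ₗ[ℂ] JetSpace Ω s q :=
  (WithLp.linearEquiv 2 ℂ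
    (FormIdx n q × MultiIdx n s → Lp ℂ 2 (volume.restrict Ω.carrier))).symm.toLinearMap ∘ₗ
    LinearMap.pi fun p =>
      ((Real.sqrt (gammaCoeff p.2.1) : ℝ) : ℂ) •
        (toL2 Ω ∘ₗ smoothDMulti p.2.1 ∘ₗ LinearMap.proj p.1)

/-- The inner product induced on smooth forms is
`⟨φ,ψ⟩_s = ∑_J ∑_{|α| ≤ s} γ_α ∫_Ω D^α φ_J \overline{D^α ψ_J}`
(inner products being conjugate-linear in the first argument in Mathlib). -/
theorem inner_jet {n : ℕ} (Ω : SmoothlyBoundedDomain n) (s q : ℕ) (φ ψ : SmoothForm n q) :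
    inner ℂ (jet Ω s q ψ) (jet Ω s q φ) =
      ∑ J : FormIdx n q, ∑ α : MultiIdx n s, (gammaCoeff α.1 : ℂ) *
        ∫ x in Ω.carrier, (smoothDMulti α.1 (φ J) : Cn n → ℂ) x *
          (starRingEnd ℂ) ((smoothDMulti α.1 (ψ J) : Cn n → ℂ) x) := by
  rw [PiLp.inner_apply, Fintype.sum_prod_type]
  refine Finset.sum_congr rfl fun J _ => Finset.sum_congr rfl fun α _ => ?_
  have h : ∀ χ : SmoothForm n q, jet Ω s q χ (J, α) =
      ((Real.sqrt (gammaCoeff α.1) : ℝ) : ℂ) • toL2 Ω (smoothDMulti α.1 (χ J)) :=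
    fun χ => rfl
  rw [h, h, inner_smul_left, inner_smul_right, ← mul_assoc, Complex.conj_ofReal,
    ← Complex.ofReal_mul, Real.mul_self_sqrt (Nat.cast_nonneg _), L2.inner_def]
  congr 1
  refine integral_congr_ae ?_
  filter_upwards [(memLp_smooth Ω (smoothDMulti α.1 (φ J))).coeFn_toLp,
    (memLp_smooth Ω (smoothDMulti α.1 (ψ J))).coeFn_toLp] with x h1 h2
  simp only [toL2, LinearMap.coe_mk, AddHom.coe_mk, h1, h2, RCLike.inner_apply]

/-- `W^s_{(0,q)}(Ω)`: the closure of the space of forms smooth up to the boundary with respect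
to the Sobolev inner product. -/
abbrev Sobolev {n : ℕ} (Ω : SmoothlyBoundedDomain n) (s q : ℕ) :
    Submodule ℂ (JetSpace Ω s q) :=
  (LinearMap.range (jet Ω s q)).topologicalClosure

/-- The element of `W^s_{(0,q)}(Ω)` given by a form that is smooth up to the boundary. -/
def toSobolev {n : ℕ} (Ω : SmoothlyBoundedDomain n) (s q : ℕ) :
    SmoothForm n q →ₗ[ℂ] Sobolev Ω s q :=
  (jet Ω s q).codRestrict _ fun φ =>
    Submodule.le_topologicalClosure _ (LinearMap.mem_range_self _ φ)

/-! ### The operator `∂̄` -/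

/-- The graph of `∂̄` on forms that are smooth up to the boundary. -/
def dbarGraph {n : ℕ} (Ω : SmoothlyBoundedDomain n) (s q : ℕ) :
    Submodule ℂ (Sobolev Ω s q × Sobolev Ω s (q + 1)) :=
  LinearMap.range ((toSobolev Ω s q).prod (toSobolev Ω s (q + 1) ∘ₗ smoothDbar n q))

/-- The smooth functions that vanish on `Ω`. -/
def vanishing {n : ℕ} (Ω : SmoothlyBoundedDomain n) : Submodule ℂ (SmoothFn n) where
  carrier := {f | ∀ x ∈ Ω.carrier, (f : Cn n → ℂ) x = 0}
  add_mem' hf hg x hx := by simp [hf x hx, hg x hx]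
  zero_mem' x _ := rfl
  smul_mem' c f hf x hx := by simp [hf x hx]

theorem toL2_eq_zero_iff {n : ℕ} (Ω : SmoothlyBoundedDomain n) (f : SmoothFn n) :
    toL2 Ω f = 0 ↔ f ∈ vanishing Ω := by
  have h1 : toL2 Ω f = 0 ↔ (f : Cn n → ℂ) =ᵐ[volume.restrict Ω.carrier] 0 :=
    (MemLp.toLp_eq_toLp_iff (memLp_smooth Ω f) MemLp.zero)
  rw [h1]
  constructor
  · intro h
    exact Measure.eqOn_open_of_ae_eq h Ω.isOpen (contDiff_coe f).continuous.continuousOn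
      continuousOn_const
  · intro h
    filter_upwards [ae_restrict_mem Ω.isOpen.measurableSet] with x hx using h x hx

theorem smoothD_vanishing {n : ℕ} (Ω : SmoothlyBoundedDomain n) (i : RealIdx n) :
    vanishing Ω ≤ (vanishing Ω).comap (smoothD i) := by
  intro f hf x hx
  have h : (f : Cn n → ℂ) =ᶠ[nhds x] fun _ => 0 :=
    Filter.eventually_of_mem (Ω.isOpen.mem_nhds hx) hf
  simp [smoothD, partialD, h.fderiv_eq]

theorem smoothDMulti_vanishing {n : ℕ} (Ω : SmoothlyBoundedDomain n) (α : RealIdx n → ℕ) :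
    vanishing Ω ≤ (vanishing Ω).comap (smoothDMulti α) := by
  have hpow : ∀ (i : RealIdx n) (m : ℕ), ∀ f ∈ vanishing Ω, (smoothD i ^ m) f ∈ vanishing Ω := by
    intro i m
    induction m with
    | zero => intro f hf; simpa using hf
    | succ m ih => intro f hf; rw [pow_succ]; exact ih _ (smoothD_vanishing Ω i hf)
  have hlist : ∀ (c : Fin n → RealIdx n) (l : List (Fin n)), ∀ f ∈ vanishing Ω,
      ((l.map fun j => smoothD (c j) ^ α (c j)).prod) f ∈ vanishing Ω := by
    intro c l
    induction l with
    | nil => intro f hf; simpa using hf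
    | cons j l ih => intro f hf; rw [List.map_cons, List.prod_cons]; exact hpow _ _ _ (ih f hf)
  intro f hf
  exact hlist Sum.inl _ _ (hlist Sum.inr _ f hf)

theorem toSobolev_eq_zero_iff {n : ℕ} (Ω : SmoothlyBoundedDomain n) (s q : ℕ)
    (φ : SmoothForm n q) : toSobolev Ω s q φ = 0 ↔ ∀ J, φ J ∈ vanishing Ω := by
  have key : toSobolev Ω s q φ = 0 ↔ jet Ω s q φ = 0 := Subtype.ext_iff
  have comp : ∀ p : FormIdx n q × MultiIdx n s, jet Ω s q φ p =
      ((Real.sqrt (gammaCoeff p.2.1) : ℝ) : ℂ) • toL2 Ω (smoothDMulti p.2.1 (φ p.1)) :=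
    fun p => rfl
  rw [key]
  constructor
  · intro h J
    have h0 := comp (J, ⟨fun _ => 0, by simp⟩)
    rw [h] at h0
    rw [← toL2_eq_zero_iff]
    simpa [gammaCoeff, Nat.multinomial, smoothDMulti] using h0.symm
  · intro h
    refine PiLp.ext fun p => ?_
    rw [comp, (toL2_eq_zero_iff Ω _).2 (smoothDMulti_vanishing Ω _ (h p.1)), smul_zero]
    rfl

/-- `∂̄` is well defined on the classes of smooth forms. -/
theorem dbarGraph_functional {n : ℕ} (Ω : SmoothlyBoundedDomain n) (s q : ℕ)
    (x : Sobolev Ω s q × Sobolev Ω s (q + 1)) (hx : x ∈ dbarGraph Ω s q) (h0 : x.1 = 0) :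
    x.2 = 0 := by
  obtain ⟨φ, rfl⟩ := hx
  have hφ := (toSobolev_eq_zero_iff Ω s q φ).1 h0
  refine (toSobolev_eq_zero_iff Ω s (q + 1) _).2 fun K => ?_
  simp only [smoothDbar, LinearMap.pi_apply, LinearMap.sum_apply, LinearMap.smul_apply,
    LinearMap.comp_apply, LinearMap.proj_apply]
  refine Submodule.sum_mem _ fun k _ => Submodule.sum_mem _ fun J _ =>
    Submodule.smul_mem _ _ ?_
  exact Submodule.smul_mem _ _ (Submodule.add_mem _ (smoothD_vanishing Ω _ (hφ J))
    (Submodule.smul_mem _ _ (smoothD_vanishing Ω _ (hφ J))))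

/-- `∂̄` on smooth forms as an unbounded operator in the Sobolev spaces. -/
def dbarSmooth {n : ℕ} (Ω : SmoothlyBoundedDomain n) (s q : ℕ) :
    Sobolev Ω s q →ₗ.[ℂ] Sobolev Ω s (q + 1) :=
  (dbarGraph Ω s q).toLinearPMap

theorem dbarSmooth_graph {n : ℕ} (Ω : SmoothlyBoundedDomain n) (s q : ℕ) :
    (dbarSmooth Ω s q).graph = dbarGraph Ω s q :=
  Submodule.toLinearPMap_graph_eq _ (dbarGraph_functional Ω s q)

/-- The closed, densely defined operator `∂̄ : W^s_{(0,q)}(Ω) → W^s_{(0,q+1)}(Ω)`. -/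
def dbar {n : ℕ} (Ω : SmoothlyBoundedDomain n) (s q : ℕ) :
    Sobolev Ω s q →ₗ.[ℂ] Sobolev Ω s (q + 1) :=
  (dbarSmooth Ω s q).closure

/-- The `W^s(Ω)`-Hilbert space adjoint `∂̄*` of `∂̄`. -/
def dbarAdjoint {n : ℕ} (Ω : SmoothlyBoundedDomain n) (s q : ℕ) :
    Sobolev Ω s (q + 1) →ₗ.[ℂ] Sobolev Ω s q :=
  (dbar Ω s q)†

end DbarSobolev

end

/-! By definition of the adjoint, $\psi$ lies in its domain exactly when
$\varphi\mapsto\langle\bar\partial\varphi,\psi\rangle_s$ is bounded by $C\|\varphi\|_s$ on smooth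
forms; such a bound passes to the closure of the operator. The pairing splits as a sum over the
coefficients $\varphi_J$, so everything reduces to scalar functionals that are, or are not, bounded
in the Sobolev norm of order $s$ (`SobBounded`).

Let $r$ be a smooth defining function equal to $\varrho$ near $b\Omega$, $\nu$ its gradient,
$N=\sum_j\nu_jD_j$. In $\langle D_i\varphi,\psi\rangle_s$ the terms with $|\alpha|<s$ put at most
$s$ derivatives on $\varphi$ and are bounded. The weights $\gamma_\alpha$ turn the terms with
$|\alpha|=s$ into a sum over all $s$-tuples of directions (`jetPairing_eq_sum`). These terms put
$s+1$ derivatives on $\varphi$; but $D_j-\nu_jN$ is tangential on $b\Omega$, and a tangential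
operator can be integrated by parts without boundary term, which costs one derivative and leaves a
bounded functional. Hence, modulo bounded functionals, the part of the pairing belonging to
$\varphi_J$ is $\int_\Omega h\,N^{s+1}\varphi_J$, where $\bar h$ is the contraction of $N^s\psi$
with $\bar\partial r$ (`sobBounded_dbarPairing_sub`). Since $|\nu|=1$ near $b\Omega$, $N$
annihilates the components of $\nu$ there, so $\bar h=N^s(\psi\lrcorner\bar\partial\varrho)_J$ on
$b\Omega$ (`iterate_normalD_contraction`).

It remains to see that $\int_\Omega h\,N^{s+1}\varphi$ is bounded iff $h=0$ on $b\Omega$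
(`sobBounded_normalPow_iff`). If $h=0$ there, then $hN$ has no flux through $b\Omega$ and one more
integration by parts suffices. Conversely, test with $\varphi_m=a_m(r)\,b$, where $a_m$ concentrates
at $0$ with derivatives of order at most $s$ bounded and $a_m^{(s)}(0)=\kappa\ne0$. The norms tend
to $0$, while the integrals tend to $\kappa$ times the flux of $hb\nu$, written as the integral of a
divergence over $\Omega$ so that no surface measure is needed. So all these fluxes vanish. If
$h(p)\ne0$ for some $p\in b\Omega$, dividing by $h$ gives $\int_\Omega D_iw=0$ for all $w$ supported
near $p$, and a bump could be translated across $b\Omega$ without changing its integral over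
$\Omega$ (`eq_zero_of_sobBounded`). -/

open MeasureTheory
open scoped ContDiff LinearPMap

noncomputable section

namespace DbarSobolev


/-! ### Smoothness of the signed distance near a smooth boundary point. -/

section SignedDistance

open Topology Filter

variable {E : Type*} [NormedAddCommGroup E] [InnerProductSpace ℝ E] [FiniteDimensional ℝ E]

/-- The normalised gradient of a real function. -/
def unitNormal (ρ : E → ℝ) (y : E) : E := ‖gradient ρ y‖⁻¹ • gradient ρ y

theorem gradient_ne_zero {ρ : E → ℝ} {y : E} (h : fderiv ℝ ρ y ≠ 0) : gradient ρ y ≠ 0 := by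
  simpa [gradient] using h

theorem norm_unitNormal {ρ : E → ℝ} {y : E} (h : fderiv ℝ ρ y ≠ 0) : ‖unitNormal ρ y‖ = 1 := by
  have := norm_ne_zero_iff.2 (gradient_ne_zero h)
  simp [unitNormal, norm_smul, this]

theorem contDiffAt_gradient {ρ : E → ℝ} {y : E} (h : ContDiffAt ℝ ∞ ρ y) :
    ContDiffAt ℝ ∞ (gradient ρ) y :=
  (InnerProductSpace.toDual ℝ E).symm.contDiff.contDiffAt.comp y (h.fderiv_right (by simp))

theorem contDiffAt_unitNormal {ρ : E → ℝ} {y : E} (h : ContDiffAt ℝ ∞ ρ y)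
    (h0 : fderiv ℝ ρ y ≠ 0) : ContDiffAt ℝ ∞ (unitNormal ρ) y :=
  (((contDiffAt_gradient h).norm ℝ (gradient_ne_zero h0)).inv
    (norm_ne_zero_iff.2 (gradient_ne_zero h0))).smul (contDiffAt_gradient h)

theorem inner_unitNormal {ρ : E → ℝ} {y : E} (v : E) :
    inner ℝ (unitNormal ρ y) v = ‖gradient ρ y‖⁻¹ * fderiv ℝ ρ y v := by
  simp [unitNormal, inner_smul_left, gradient]

theorem fderiv_unitNormal_pos {ρ : E → ℝ} {y : E} (h : fderiv ℝ ρ y ≠ 0) :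
    fderiv ℝ ρ y (unitNormal ρ y) = ‖gradient ρ y‖ := by
  have h1 : inner ℝ (gradient ρ y) (unitNormal ρ y) = fderiv ℝ ρ y (unitNormal ρ y) := by
    simp [gradient]
  have h2 := norm_ne_zero_iff.2 (gradient_ne_zero h)
  rw [← h1, unitNormal, inner_smul_right, real_inner_self_eq_norm_sq]
  field_simp

/-- `(y, t) ↦ (y + t n(y), ρ(y))`, where `n` is the unit normal to the level sets of `ρ`. -/
def normalMap (ρ : E → ℝ) (w : E × ℝ) : E × ℝ := (w.1 + w.2 • unitNormal ρ w.1, ρ w.1)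

theorem contDiffAt_normalMap {ρ : E → ℝ} {w : E × ℝ} (h : ContDiffAt ℝ ∞ ρ w.1)
    (h0 : fderiv ℝ ρ w.1 ≠ 0) : ContDiffAt ℝ ∞ (normalMap ρ) w := by
  have h1 : ContDiffAt ℝ ∞ (fun w : E × ℝ => unitNormal ρ w.1) w :=
    (contDiffAt_unitNormal h h0).comp w contDiffAt_fst
  exact (contDiffAt_fst.add (contDiffAt_snd.smul h1)).prodMk (h.comp w contDiffAt_fst)

/-- The derivative at $(p,0)$ is $(v,\tau)\mapsto(v+\tau n,\,d\rho(v))$. In its kernel $v=-\tau n$,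
and then $d\rho(n)=|\nabla\rho|\neq0$ forces $\tau=0$; finite dimension does the rest. -/
theorem exists_hasFDerivAt_normalMap {ρ : E → ℝ} {p : E} (h : ContDiffAt ℝ ∞ ρ p)
    (h0 : fderiv ℝ ρ p ≠ 0) :
    ∃ A : (E × ℝ) ≃L[ℝ] (E × ℝ), HasFDerivAt (normalMap ρ) (A : (E × ℝ) →L[ℝ] (E × ℝ)) (p, 0) := by
  have hn : DifferentiableAt ℝ (unitNormal ρ) p :=
    (contDiffAt_unitNormal h h0).differentiableAt (by simp)
  have hρ : DifferentiableAt ℝ ρ p := h.differentiableAt (by simp)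
  have hn' : HasFDerivAt (fun w : E × ℝ => unitNormal ρ w.1)
      ((fderiv ℝ (unitNormal ρ) p).comp (ContinuousLinearMap.fst ℝ E ℝ)) (p, 0) :=
    HasFDerivAt.comp (p, (0 : ℝ)) (f := Prod.fst) (g := unitNormal ρ) hn.hasFDerivAt hasFDerivAt_fst
  have hρ' : HasFDerivAt (fun w : E × ℝ => ρ w.1)
      ((fderiv ℝ ρ p).comp (ContinuousLinearMap.fst ℝ E ℝ)) (p, 0) :=
    HasFDerivAt.comp (p, (0 : ℝ)) (f := Prod.fst) (g := ρ) hρ.hasFDerivAt hasFDerivAt_fst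
  have hF := ((hasFDerivAt_fst (𝕜 := ℝ) (p := (p, (0 : ℝ)))).add
    ((hasFDerivAt_snd (𝕜 := ℝ) (p := (p, (0 : ℝ)))).smul hn')).prodMk hρ'
  set T : (E × ℝ) →L[ℝ] (E × ℝ) := _ with hT
  change HasFDerivAt _ T _ at hF
  have hTv : ∀ v : E × ℝ, T v = (v.1 + v.2 • unitNormal ρ p, fderiv ℝ ρ p v.1) := by
    intro v
    simp [hT]
  have hinj : Function.Injective (T : (E × ℝ) →ₗ[ℝ] (E × ℝ)) := by
    rw [← LinearMap.ker_eq_bot, LinearMap.ker_eq_bot']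
    rintro ⟨v, τ⟩ hv
    have hv' : T (v, τ) = 0 := hv
    rw [hTv, Prod.mk_eq_zero] at hv'
    obtain ⟨h1, h2⟩ := hv'
    simp only at h1 h2
    have h3 : v = -(τ • unitNormal ρ p) := eq_neg_of_add_eq_zero_left h1
    rw [h3, map_neg, map_smul, fderiv_unitNormal_pos h0] at h2
    have h4 := norm_ne_zero_iff.2 (gradient_ne_zero h0)
    have h5 : τ = 0 := by simpa [h4] using h2
    simp [h3, h5]
  refine ⟨(LinearEquiv.ofInjectiveEndo _ hinj).toContinuousLinearEquiv, ?_⟩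
  have hA : (((LinearEquiv.ofInjectiveEndo _ hinj).toContinuousLinearEquiv :
      (E × ℝ) ≃L[ℝ] (E × ℝ)) : (E × ℝ) →L[ℝ] (E × ℝ)) = T := by
    ext v <;> rfl
  rw [hA]
  exact hF

/-- First-order condition at the nearest point of a level set. -/
theorem exists_smul_unitNormal_of_isMinOn {ρ : E → ℝ} {x y : E} (h : ContDiffAt ℝ ∞ ρ y)
    (h0 : fderiv ℝ ρ y ≠ 0)
    (hmin : IsLocalMinOn (fun z => ‖x - z‖ ^ 2) {z | ρ z = ρ y} y) :
    ∃ t : ℝ, x = y + t • unitNormal ρ y := by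
  have hρ : HasStrictFDerivAt ρ (fderiv ℝ ρ y) y := h.hasStrictFDerivAt (by simp)
  have hφ : HasStrictFDerivAt (fun z => ‖x - z‖ ^ 2) _ y :=
    (hasStrictFDerivAt_norm_sq (x - y)).comp y ((hasStrictFDerivAt_id y).const_sub x)
  obtain ⟨a, b, hab, hL⟩ :=
    IsLocalExtrOn.exists_multipliers_of_hasStrictFDerivAt_1d (Or.inl hmin) hρ hφ
  have hb : b ≠ 0 := by
    rintro rfl
    have ha : a ≠ 0 := by simpa using hab
    simp [ha] at hL
    exact h0 hL
  have hg := norm_ne_zero_iff.2 (gradient_ne_zero h0)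
  have h1 : (2 * b) • (x - y) = a • gradient ρ y := by
    refine ext_inner_right ℝ fun v => ?_
    have := DFunLike.congr_fun hL v
    simp [gradient, inner_smul_left, inner_sub_left] at this ⊢
    linarith
  refine ⟨(2 * b)⁻¹ * a * ‖gradient ρ y‖, ?_⟩
  have h2 : x - y = (2 * b)⁻¹ • a • gradient ρ y := by
    rw [← h1, smul_smul, inv_mul_cancel₀ (by simpa using hb), one_smul]
  rw [unitNormal, smul_smul, mul_assoc, mul_inv_cancel₀ hg, mul_one, mul_smul, ← h2]
  abel

open scoped Classical in
/-- The signed distance to the boundary of a set. -/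
def signedInfDist (S : Set E) (x : E) : ℝ :=
  if x ∈ S then -Metric.infDist x (frontier S) else Metric.infDist x (frontier S)

/-- A zero of $\rho$ away from the closure of $S$ would have $\rho\ge0$ around it, hence be a local
minimum, which the non-zero derivative excludes. -/
theorem mem_frontier_iff_of_local {E : Type*} [NormedAddCommGroup E] [InnerProductSpace ℝ E]
    {S U : Set E} (hS : IsOpen S) (hU : IsOpen U) {ρ : E → ℝ}
    (hρ : ContDiffOn ℝ ∞ ρ U) (hiff : ∀ x ∈ U, x ∈ S ↔ ρ x < 0) {x : E} (hx : x ∈ U)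
    (h0 : fderiv ℝ ρ x ≠ 0) : x ∈ frontier S ↔ ρ x = 0 := by
  have hd : ContDiffAt ℝ ∞ ρ x := hρ.contDiffAt (hU.mem_nhds hx)
  rw [hS.frontier_eq, Set.mem_sdiff, hiff x hx, not_lt]
  constructor
  · rintro ⟨h1, h2⟩
    refine le_antisymm ?_ h2
    by_contra! h3
    have h4 : ∀ᶠ z in 𝓝 x, z ∈ U ∧ 0 < ρ z :=
      (hU.eventually_mem hx).and (hd.continuousAt.eventually (lt_mem_nhds h3))
    obtain ⟨z, hz, hz'⟩ := mem_closure_iff_nhds.1 h1 _ h4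
    exact absurd ((hiff z hz.1).1 hz') (not_lt.2 hz.2.le)
  · intro h1
    refine ⟨?_, h1.ge⟩
    by_contra h2
    have h3 : ∀ᶠ z in 𝓝 x, z ∈ U ∧ z ∉ closure S :=
      (hU.eventually_mem hx).and (isClosed_closure.isOpen_compl.eventually_mem h2)
    have h4 : IsLocalMin ρ x := by
      filter_upwards [h3] with z hz
      rw [h1]
      exact not_lt.1 fun h => hz.2 (subset_closure ((hiff z hz.1).2 h))
    exact h0 h4.fderiv_eq_zero

/-- Near a boundary point with a smooth local defining function, the signed distance is the
second component of the inverse of `normalMap`. -/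
theorem eventually_signedInfDist_eq {S U : Set E} (hS : IsOpen S) (hb : Bornology.IsBounded S)
    {p : E} (hp : p ∈ frontier S) (hU : IsOpen U) (hpU : p ∈ U) {ρ : E → ℝ}
    (hρ : ContDiffOn ℝ ∞ ρ U) (hp0 : fderiv ℝ ρ p ≠ 0) (hiff : ∀ x ∈ U, x ∈ S ↔ ρ x < 0)
    (H : OpenPartialHomeomorph (E × ℝ) (E × ℝ)) (hH : (H : E × ℝ → E × ℝ) = normalMap ρ)
    (hpH : (p, (0 : ℝ)) ∈ H.source) :
    ∀ᶠ x in 𝓝 p, signedInfDist S x = (H.symm (x, 0)).2 := by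
  have hat : ∀ y ∈ U, ContDiffAt ℝ ∞ ρ y := fun y hy => hρ.contDiffAt (hU.mem_nhds hy)
  have hcont : ContinuousAt (fderiv ℝ ρ) p :=
    ((hat p hpU).fderiv_right (m := ∞) (by simp)).continuousAt
  have e1 : ∀ᶠ y in 𝓝 p, y ∈ U ∧ fderiv ℝ ρ y ≠ 0 :=
    (hU.eventually_mem hpU).and (hcont.eventually_ne hp0)
  -- Two base points are needed: the mean value theorem below evaluates $d\rho$ at a point other
  -- than the foot $y$ carrying the normal.
  have e2 : ∀ᶠ w : E × E in 𝓝 (p, p), 0 < fderiv ℝ ρ w.1 (unitNormal ρ w.2) := by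
    have hc : ContinuousAt (fun w : E × E => fderiv ℝ ρ w.1 (unitNormal ρ w.2)) (p, p) :=
      (hcont.comp (f := Prod.fst) (x := (p, p)) continuousAt_fst).clm_apply
        (ContinuousAt.comp (f := Prod.snd) (g := unitNormal ρ) (x := (p, p))
          (contDiffAt_unitNormal (hat p hpU) hp0).continuousAt continuousAt_snd)
    refine hc.eventually (lt_mem_nhds ?_)
    simp only [fderiv_unitNormal_pos hp0]
    exact norm_pos_iff.2 (gradient_ne_zero hp0)
  have e3 : ∀ᶠ w in 𝓝 (p, (0 : ℝ)), w ∈ H.source := H.open_source.eventually_mem hpH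
  obtain ⟨δ₁, hδ₁, h1⟩ := Metric.eventually_nhds_iff.1 e1
  obtain ⟨δ₂, hδ₂, h2⟩ := Metric.eventually_nhds_iff.1 e2
  obtain ⟨δ₃, hδ₃, h3⟩ := Metric.eventually_nhds_iff.1 e3
  set δ := min δ₁ (min δ₂ δ₃) with hδ
  have hδpos : 0 < δ := lt_min hδ₁ (lt_min hδ₂ hδ₃)
  have hfc : IsCompact (frontier S) :=
    Metric.isCompact_of_isClosed_isBounded isClosed_frontier
      (hb.closure.subset frontier_subset_closure)
  -- Half the radius, because the boundary point $y$ nearest to $x$ satisfies $|y-p|\le2|x-p|$.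
  filter_upwards [Metric.ball_mem_nhds p (half_pos hδpos)] with x hx
  rw [Metric.mem_ball] at hx
  obtain ⟨y, hy, hxy⟩ := hfc.exists_infDist_eq_dist ⟨p, hp⟩ x
  have hxy' : dist x y ≤ dist x p := hxy ▸ Metric.infDist_le_dist_of_mem hp
  have hyp : dist y p < δ := by
    have := dist_triangle_left y p x
    linarith
  have hyU := h1 (hyp.trans_le (min_le_left _ _))
  have hy0 : ρ y = 0 := (mem_frontier_iff_of_local hS hU hρ hiff hyU.1 hyU.2).1 hy
  have hmin : IsLocalMinOn (fun z => ‖x - z‖ ^ 2) {z | ρ z = ρ y} y := by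
    have e4 : ∀ᶠ z in 𝓝 y, dist z p < δ :=
      (Metric.isOpen_ball (x := p) (ε := δ)).eventually_mem hyp
    filter_upwards [nhdsWithin_le_nhds e4, self_mem_nhdsWithin] with z hz hz'
    have hzU := h1 (hz.trans_le (min_le_left _ _))
    have hzS : z ∈ frontier S :=
      (mem_frontier_iff_of_local hS hU hρ hiff hzU.1 hzU.2).2 (hz'.trans hy0)
    have := hxy ▸ Metric.infDist_le_dist_of_mem (x := x) hzS
    rw [dist_eq_norm, dist_eq_norm] at this
    gcongr
  obtain ⟨t, ht⟩ := exists_smul_unitNormal_of_isMinOn (hat y hyU.1) hyU.2 hmin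
  have htn : dist x y = |t| := by
    rw [dist_eq_norm, ht, add_sub_cancel_left, norm_smul, norm_unitNormal hyU.2, mul_one,
      Real.norm_eq_abs]
  have hsrc : (y, t) ∈ H.source := by
    refine h3 ?_
    rw [Prod.dist_eq, max_lt_iff]
    refine ⟨hyp.trans_le ((min_le_right _ _).trans (min_le_right _ _)), ?_⟩
    have : δ ≤ δ₃ := (min_le_right _ _).trans (min_le_right _ _)
    simp only [Real.dist_eq, sub_zero, ← htn]
    linarith
  have himg : H (y, t) = (x, 0) := by
    rw [hH, normalMap, hy0, ← ht]
  rw [← himg, H.left_inv hsrc]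
  have hxU := h1 (y := x) (by linarith [min_le_left δ₁ (min δ₂ δ₃)])
  have hconv : Convex ℝ (Metric.ball p δ) := convex_ball p δ
  -- So far $|t|$ is the distance. The mean value theorem gives $\rho(x)=t\,d\rho_z(n(y))$ with a
  -- positive second factor, so $t$ has the sign of $\rho(x)$.
  obtain ⟨z, hz, hmv⟩ := domain_mvt (f := ρ) (f' := fderiv ℝ ρ) (s := Metric.ball p δ)
    (x := y) (y := x) (fun w hw => ((hat w (h1 (lt_of_lt_of_le hw (min_le_left _ _))).1
      ).differentiableAt (by simp)).hasFDerivAt.hasFDerivWithinAt) hconv hyp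
    (by rw [Metric.mem_ball]; linarith)
  have hzp : dist z p < δ := hconv.segment_subset hyp (by rw [Metric.mem_ball]; linarith) hz
  have hpos := h2 (y := (z, y)) (by
    rw [Prod.dist_eq, max_lt_iff]
    have : δ ≤ δ₂ := (min_le_right _ _).trans (min_le_left _ _)
    exact ⟨hzp.trans_le this, hyp.trans_le this⟩)
  have hxt : x - y = t • unitNormal ρ y := by rw [ht]; abel
  rw [hxt, map_smul, hy0, sub_zero, smul_eq_mul] at hmv
  rw [signedInfDist, hxy, htn, hiff x hxU.1, hmv]
  split_ifs with hs
  · have : t < 0 := by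
      by_contra! h
      exact absurd hs (not_lt.2 (mul_nonneg h hpos.le))
    rw [abs_of_neg this, neg_neg]
  · have : 0 ≤ t := by
      by_contra! h
      exact hs (mul_neg_of_neg_of_pos h hpos)
    exact abs_of_nonneg this

/-- The signed distance is smooth with unit gradient near a smooth boundary point. -/
theorem eventually_contDiffAt_signedInfDist {S U : Set E} (hS : IsOpen S)
    (hb : Bornology.IsBounded S)
    {p : E} (hp : p ∈ frontier S) (hU : IsOpen U) (hpU : p ∈ U) {ρ : E → ℝ}
    (hρ : ContDiffOn ℝ ∞ ρ U) (hp0 : fderiv ℝ ρ p ≠ 0) (hiff : ∀ x ∈ U, x ∈ S ↔ ρ x < 0) :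
    ∀ᶠ x in 𝓝 p, ContDiffAt ℝ ∞ (signedInfDist S) x ∧ ‖gradient (signedInfDist S) x‖ = 1 := by
  have hat : ∀ y ∈ U, ContDiffAt ℝ ∞ ρ y := fun y hy => hρ.contDiffAt (hU.mem_nhds hy)
  have hcont : ContinuousAt (fderiv ℝ ρ) p :=
    ((hat p hpU).fderiv_right (m := ∞) (by simp)).continuousAt
  obtain ⟨A, hA⟩ := exists_hasFDerivAt_normalMap (hat p hpU) hp0
  have hF := contDiffAt_normalMap (w := (p, (0 : ℝ))) (hat p hpU) hp0
  set H := hF.toOpenPartialHomeomorph (normalMap ρ) hA (by simp) with hHdef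
  have hH : (H : E × ℝ → E × ℝ) = normalMap ρ := hF.toOpenPartialHomeomorph_coe hA (by simp)
  have hpH : (p, (0 : ℝ)) ∈ H.source := hF.mem_toOpenPartialHomeomorph_source hA (by simp)
  have hp00 : ρ p = 0 := (mem_frontier_iff_of_local hS hU hρ hiff hpU hp0).1 hp
  have hFp : H (p, 0) = (p, 0) := by
    rw [hH]; simp [normalMap, hp00]
  have hpT : (p, (0 : ℝ)) ∈ H.target := hFp ▸ H.map_source hpH
  have hGp : H.symm (p, 0) = (p, 0) := by
    conv_lhs => rw [← hFp]
    exact H.left_inv hpH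
  have hGc : ContinuousAt (fun x : E => H.symm (x, (0 : ℝ))) p :=
    ContinuousAt.comp (f := fun x : E => (x, (0 : ℝ))) (g := H.symm)
      (H.continuousAt_symm hpT) (by fun_prop)
  have hGt : Tendsto (fun x : E => H.symm (x, (0 : ℝ))) (𝓝 p) (𝓝 (p, 0)) := by
    have := hGc.tendsto
    rwa [hGp] at this
  have e1 : ∀ᶠ w : E × ℝ in 𝓝 (p, 0), w.1 ∈ U ∧ fderiv ℝ ρ w.1 ≠ 0 := by
    have : ∀ᶠ y in 𝓝 p, y ∈ U ∧ fderiv ℝ ρ y ≠ 0 :=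
      (hU.eventually_mem hpU).and (hcont.eventually_ne hp0)
    exact (continuousAt_fst (p := (p, (0 : ℝ)))).eventually this
  -- Smoothness of the inverse is needed at all points near $p$; invertibility of the derivative is
  -- an open condition.
  have e2 : ∀ᶠ w : E × ℝ in 𝓝 (p, 0), ∃ B : (E × ℝ) ≃L[ℝ] (E × ℝ),
      (B : (E × ℝ) →L[ℝ] (E × ℝ)) = fderiv ℝ (normalMap ρ) w := by
    have hc : ContinuousAt (fderiv ℝ (normalMap ρ)) (p, 0) :=
      (hF.fderiv_right (m := ∞) (by simp)).continuousAt
    exact hc.eventually ((ContinuousLinearEquiv.isOpen (𝕜 := ℝ) (E := E × ℝ)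
      (F := E × ℝ)).eventually_mem ⟨A, hA.fderiv.symm⟩)
  have e3 : ∀ᶠ x : E in 𝓝 p, (x, (0 : ℝ)) ∈ H.target :=
    (show ContinuousAt (fun x : E => (x, (0 : ℝ))) p by fun_prop).eventually
      (H.open_target.eventually_mem hpT)
  have e4 := eventually_signedInfDist_eq hS hb hp hU hpU hρ hp0 hiff H hH hpH
  filter_upwards [hGt.eventually e1, hGt.eventually e2, e3.eventually_nhds, e4.eventually_nhds]
    with x h1 h2 h3 h4
  obtain ⟨B, hB⟩ := h2
  have hxT : (x, (0 : ℝ)) ∈ H.target := h3.self_of_nhds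
  have hFw := contDiffAt_normalMap (hat _ h1.1) h1.2
  have hG : ContDiffAt ℝ ∞ (fun x : E => H.symm (x, (0 : ℝ))) x := by
    have : ContDiffAt ℝ ∞ H.symm (x, (0 : ℝ)) := by
      refine H.contDiffAt_symm (f₀' := B) hxT ?_ ?_
      · rw [hB, hH]
        exact (hFw.differentiableAt (by simp)).hasFDerivAt
      · rw [hH]; exact hFw
    exact ContDiffAt.comp (f := fun x : E => (x, (0 : ℝ))) (g := H.symm) x this (by fun_prop)
  have ht : ContDiffAt ℝ ∞ (fun x : E => (H.symm (x, (0 : ℝ))).2) x :=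
    contDiffAt_snd.comp x hG
  have hy : ContDiffAt ℝ ∞ (fun x : E => (H.symm (x, (0 : ℝ))).1) x :=
    contDiffAt_fst.comp x hG
  refine ⟨ht.congr_of_eventuallyEq h4, ?_⟩
  set y : E → E := fun x => (H.symm (x, (0 : ℝ))).1 with hydef
  set t : E → ℝ := fun x => (H.symm (x, (0 : ℝ))).2 with htdef
  have hyd : DifferentiableAt ℝ y x := hy.differentiableAt (by simp)
  have htd : DifferentiableAt ℝ t x := ht.differentiableAt (by simp)
  have hinv : ∀ᶠ z in 𝓝 x, y z + t z • unitNormal ρ (y z) = z ∧ ρ (y z) = 0 := by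
    filter_upwards [h3] with z hz
    have := H.right_inv hz
    rw [hH, normalMap, Prod.mk.injEq] at this
    exact this
  have hnd : DifferentiableAt ℝ (unitNormal ρ) (y x) :=
    (contDiffAt_unitNormal (hat _ h1.1) h1.2).differentiableAt (by simp)
  have hρd : DifferentiableAt ℝ ρ (y x) := (hat _ h1.1).differentiableAt (by simp)
  have hny : HasFDerivAt (fun z => unitNormal ρ (y z)) _ x :=
    hnd.hasFDerivAt.comp x hyd.hasFDerivAt
  have d1 := hyd.hasFDerivAt.add (htd.hasFDerivAt.smul hny)
  have d1' := d1.unique ((hasFDerivAt_id x).congr_of_eventuallyEq (hinv.mono fun z hz => hz.1))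
  have d2 : HasFDerivAt (fun z => ρ (y z)) _ x := hρd.hasFDerivAt.comp x hyd.hasFDerivAt
  have d2' := d2.unique ((hasFDerivAt_const (0 : ℝ) x).congr_of_eventuallyEq
    (hinv.mono fun z hz => hz.2))
  have hunit : ∀ v, inner ℝ (unitNormal ρ (y x)) (fderiv ℝ (unitNormal ρ) (y x) v) = 0 := by
    intro v
    have hev : ∀ᶠ z in 𝓝 (y x), ‖unitNormal ρ z‖ ^ 2 = 1 := by
      have : ∀ᶠ z in 𝓝 (y x), fderiv ℝ ρ z ≠ 0 :=
        (((hat _ h1.1).fderiv_right (m := ∞) (by simp)).continuousAt).eventually_ne h1.2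
      filter_upwards [this] with z hz
      rw [norm_unitNormal hz, one_pow]
    have d3 := (hnd.hasFDerivAt.norm_sq).unique
      ((hasFDerivAt_const (1 : ℝ) (y x)).congr_of_eventuallyEq hev)
    simpa using DFunLike.congr_fun d3 v
  -- Differentiate $y+t\,n(y)=x$ and pair with $n(y)$. The term in $dy$ vanishes since $\rho(y)$ is
  -- constant, the term in $dn$ since $|n|=1$, and $dt=\langle n(y),\cdot\rangle$ remains.
  have hgrad : gradient t x = unitNormal ρ (y x) := by
    refine ext_inner_right ℝ fun v => ?_
    have g1 := congrArg (inner ℝ (unitNormal ρ (y x))) (DFunLike.congr_fun d1' v)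
    have g2 := DFunLike.congr_fun d2' v
    simp only [add_apply, smul_apply,
      ContinuousLinearMap.comp_apply, ContinuousLinearMap.smulRight_apply, inner_add_right,
      inner_smul_right, hunit, real_inner_self_eq_norm_sq,
      ContinuousLinearMap.id_apply] at g1
    rw [inner_unitNormal (fderiv ℝ y x v)] at g1
    simp only [ContinuousLinearMap.comp_apply, zero_apply] at g2
    rw [g2] at g1
    have hone : ‖unitNormal ρ (y x)‖ = 1 := norm_unitNormal h1.2
    rw [hone] at g1
    rw [← g1]
    simp [gradient]
  have : gradient (signedInfDist S) x = gradient t x := by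
    have h4' : signedInfDist S =ᶠ[𝓝 x] t := h4
    rw [gradient, gradient, h4'.fderiv_eq]
  rw [this, hgrad, norm_unitNormal h1.2]

end SignedDistance


/-! ### A global defining function with unit gradient near the boundary. -/

section DefiningFunctions

open Topology Filter

theorem inner_dirVec {n : ℕ} (i : RealIdx n) (v : Cn n) :
    inner ℝ (dirVec i) v = Sum.elim (fun j => (v j).re) (fun j => (v j).im) i := by
  rcases i with j | j
  · simp only [dirVec, PiLp.inner_apply, Complex.inner, Sum.elim_inl]
    rw [Finset.sum_eq_single j] <;> simp +contextual
  · simp only [dirVec, PiLp.inner_apply, Complex.inner, Sum.elim_inr]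
    rw [Finset.sum_eq_single j] <;> simp +contextual

theorem sum_inner_dirVec_smul {n : ℕ} (v : Cn n) :
    ∑ i : RealIdx n, inner ℝ (dirVec i) v • dirVec i = v := by
  ext j
  simp only [inner_dirVec]
  simp only [Fintype.sum_sum_type, dirVec, Sum.elim_inl, Sum.elim_inr,
    PiLp.add_apply, WithLp.ofLp_sum, Finset.sum_apply, PiLp.smul_apply]
  rw [Finset.sum_eq_single j, Finset.sum_eq_single j]
  · simp [Complex.re_add_im]
  all_goals simp +contextual [eq_comm]

theorem sum_inner_dirVec_sq {n : ℕ} (v : Cn n) :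
    ∑ i : RealIdx n, inner ℝ (dirVec i) v ^ 2 = ‖v‖ ^ 2 := by
  conv_rhs => rw [← real_inner_self_eq_norm_sq, ← sum_inner_dirVec_smul v, sum_inner_dirVec_smul v]
  conv_rhs => rw [← sum_inner_dirVec_smul v, inner_sum, sum_inner_dirVec_smul v]
  refine Finset.sum_congr rfl fun i _ => ?_
  rw [inner_smul_right, real_inner_comm v, sq]

/-- A smooth global defining function of `Ω` which near the boundary is the signed distance and
has unit gradient there. -/
structure DefiningFunction {n : ℕ} (Ω : SmoothlyBoundedDomain n) where
  toFun : Cn n → ℝ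
  smooth : ContDiff ℝ ∞ toFun
  neg_iff : ∀ x, x ∈ Ω.carrier ↔ toFun x < 0
  zero_iff : ∀ x, x ∈ frontier Ω.carrier ↔ toFun x = 0
  nhd : Set (Cn n)
  isOpen_nhd : IsOpen nhd
  frontier_subset : frontier Ω.carrier ⊆ nhd
  eq_signedDist : ∀ x ∈ nhd, toFun x = signedDist Ω x
  norm_gradient : ∀ x ∈ nhd, ‖gradient toFun x‖ = 1

theorem signedDist_eq_signedInfDist {n : ℕ} (Ω : SmoothlyBoundedDomain n) :
    signedDist Ω = signedInfDist Ω.carrier := rfl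

theorem eventually_contDiffAt_signedDist {n : ℕ} (Ω : SmoothlyBoundedDomain n) {p : Cn n}
    (hp : p ∈ frontier Ω.carrier) :
    ∀ᶠ x in 𝓝 p, ContDiffAt ℝ ∞ (signedDist Ω) x ∧ ‖gradient (signedDist Ω) x‖ = 1 := by
  obtain ⟨U, hU, hpU, r, hr, h0, hiff⟩ := Ω.smooth_boundary p hp
  rw [signedDist_eq_signedInfDist]
  exact eventually_contDiffAt_signedInfDist Ω.isOpen Ω.isBounded hp hU hpU hr h0 hiff

/-- A cut-off $\kappa$ glues $\varrho$ near $b\Omega$ to the locally constant function $\mp1$ away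
from it. Both have the same sign off $b\Omega$, so the convex combination $r$ has it too. -/
theorem nonempty_definingFunction {n : ℕ} (Ω : SmoothlyBoundedDomain n) :
    Nonempty (DefiningFunction Ω) := by
  classical
  set S := Ω.carrier with hS
  set O : Set (Cn n) := interior {x | ContDiffAt ℝ ∞ (signedDist Ω) x ∧
    ‖gradient (signedDist Ω) x‖ = 1} with hO
  have hFO : frontier S ⊆ O := fun p hp =>
    mem_interior_iff_mem_nhds.2 (eventually_contDiffAt_signedDist Ω hp)
  have hOsm : ∀ x ∈ O, ContDiffAt ℝ ∞ (signedDist Ω) x ∧ ‖gradient (signedDist Ω) x‖ = 1 :=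
    fun x hx => interior_subset (s := {x | ContDiffAt ℝ ∞ (signedDist Ω) x ∧
      ‖gradient (signedDist Ω) x‖ = 1}) hx
  obtain ⟨κ, hκ0, hκ1, hκ⟩ := exists_contMDiffMap_zero_one_nhds_of_isClosed (n := ⊤)
    (modelWithCornersSelf ℝ (Cn n)) (s := Oᶜ) (t := frontier S) isOpen_interior.isClosed_compl
    isClosed_frontier (Set.disjoint_left.2 fun x hx hx' => hx (hFO hx'))
  have hκs : ContDiff ℝ ∞ κ := κ.contMDiff.contDiff
  rw [eventually_nhdsSet_iff_forall] at hκ0 hκ1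
  set sg : Cn n → ℝ := fun x => if x ∈ S then -1 else 1 with hsg
  set r : Cn n → ℝ := fun x => κ x * signedDist Ω x + (1 - κ x) * sg x with hr
  have hsmooth : ContDiff ℝ ∞ r := by
    rw [contDiff_iff_contDiffAt]
    intro x
    by_cases hx : x ∈ frontier S
    · refine (hOsm x (hFO hx)).1.congr_of_eventuallyEq ?_
      filter_upwards [hκ1 x hx] with z hz
      simp [hr, hz]
    · have h1 : ContDiffAt ℝ ∞ (fun x => κ x * signedDist Ω x) x := by
        by_cases hxO : x ∈ O
        · exact hκs.contDiffAt.mul (hOsm x hxO).1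
        · refine (contDiffAt_const (c := (0 : ℝ))).congr_of_eventuallyEq ?_
          filter_upwards [hκ0 x hxO] with z hz
          simp [hz]
      have h2 : ContDiffAt ℝ ∞ sg x := by
        by_cases hxS : x ∈ S
        · refine (contDiffAt_const (c := (-1 : ℝ))).congr_of_eventuallyEq ?_
          filter_upwards [Ω.isOpen.eventually_mem hxS] with z hz
          exact if_pos hz
        · refine (contDiffAt_const (c := (1 : ℝ))).congr_of_eventuallyEq ?_
          have : x ∈ (closure S)ᶜ := fun h => hx (by
            rw [Ω.isOpen.frontier_eq]; exact ⟨h, hxS⟩)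
          filter_upwards [isClosed_closure.isOpen_compl.eventually_mem this] with z hz
          exact if_neg fun h => hz (subset_closure h)
      exact h1.add ((contDiffAt_const.sub hκs.contDiffAt).mul h2)
  have hfr : ∀ x, x ∈ frontier S → r x = 0 := by
    intro x hx
    have h1 : κ x = 1 := (hκ1 x hx).self_of_nhds
    have h2 : signedDist Ω x = 0 := by
      simp [signedDist, ← hS, Metric.infDist_zero_of_mem hx]
    simp [hr, h1, h2]
  have hdist : ∀ x ∉ frontier S, κ x ≠ 0 → 0 < Metric.infDist x (frontier S) := by
    intro x hx hk
    by_cases hne : (frontier S).Nonempty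
    · exact (isClosed_frontier.notMem_iff_infDist_pos hne).1 hx
    -- If the boundary is empty (as for $n=0$), `Metric.infDist` has the default value $0$; then the
    -- unit gradient condition fails everywhere, `O` is empty and $\kappa=0$.
    · exfalso
      rw [Set.not_nonempty_iff_eq_empty] at hne
      have hxO : x ∈ O := by
        by_contra h
        exact hk (hκ0 x h).self_of_nhds
      have hz : ∀ y, y ∈ frontier S ↔ False := by simp [hne]
      have hnn := (hOsm x hxO).2
      have hloc : signedDist Ω = fun _ => 0 := by
        funext y
        simp [signedDist, ← hS, hne]
      rw [hloc] at hnn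
      simp [gradient] at hnn
  have hneg : ∀ x, x ∈ S → r x < 0 := by
    intro x hx
    have hxf : x ∉ frontier S := fun h => (Ω.isOpen.frontier_eq ▸ h).2 hx
    have h1 : signedDist Ω x = -Metric.infDist x (frontier S) := if_pos hx
    have h2 : sg x = -1 := if_pos hx
    have h3 := hκ x
    simp only [hr, h1, h2]
    rcases eq_or_ne (κ x) 0 with h0 | h0
    · rw [h0]; simp
    · have := mul_pos (lt_of_le_of_ne h3.1 h0.symm) (hdist x hxf h0)
      have := h3.2
      linarith
  have hpos : ∀ x, x ∉ S → x ∉ frontier S → 0 < r x := by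
    intro x hx hxf
    have h1 : signedDist Ω x = Metric.infDist x (frontier S) := if_neg hx
    have h2 : sg x = 1 := if_neg hx
    have h3 := hκ x
    simp only [hr, h1, h2]
    rcases eq_or_ne (κ x) 0 with h0 | h0
    · rw [h0]; simp
    · have := mul_pos (lt_of_le_of_ne h3.1 h0.symm) (hdist x hxf h0)
      have := h3.2
      linarith
  set V : Set (Cn n) := interior {x | κ x = 1} ∩ O with hV
  have heq : ∀ x ∈ V, r =ᶠ[𝓝 x] signedDist Ω := by
    intro x hx
    filter_upwards [isOpen_interior.eventually_mem hx.1] with z hz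
    have : κ z = 1 := interior_subset (s := {x | κ x = 1}) hz
    simp [hr, this]
  refine ⟨⟨r, hsmooth, fun x => ⟨hneg x, fun h => ?_⟩, fun x => ⟨hfr x, fun h => ?_⟩, V,
    isOpen_interior.inter isOpen_interior, fun x hx =>
      ⟨mem_interior_iff_mem_nhds.2 (hκ1 x hx), hFO hx⟩,
    fun x hx => (heq x hx).self_of_nhds, fun x hx => ?_⟩⟩
  · by_contra hx
    by_cases hxf : x ∈ frontier S
    · exact absurd (hfr x hxf) h.ne
    · exact absurd (hpos x hx hxf) (not_lt.2 h.le)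
  · by_contra hxf
    by_cases hx : x ∈ S
    · exact absurd h (hneg x hx).ne
    · exact absurd h (hpos x hx hxf).ne'
  · rw [gradient, (heq x hx).fderiv_eq]
    exact (hOsm x hx.2).2

namespace DefiningFunction

variable {n : ℕ} {Ω : SmoothlyBoundedDomain n} (r : DefiningFunction Ω)

/-- The derivatives of the defining function, as complex-valued functions. -/
def nu (i : RealIdx n) : Cn n → ℂ := partialD i fun x => (r.toFun x : ℂ)

theorem contDiff_ofReal : ContDiff ℝ ∞ fun x => (r.toFun x : ℂ) :=
  Complex.ofRealCLM.contDiff.comp r.smooth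

theorem contDiff_nu (i : RealIdx n) : ContDiff ℝ ∞ (r.nu i) :=
  contDiff_partialD i r.contDiff_ofReal

theorem differentiable_toFun : Differentiable ℝ r.toFun := r.smooth.differentiable (by simp)

theorem nu_apply (i : RealIdx n) (x : Cn n) :
    r.nu i x = ((fderiv ℝ r.toFun x (dirVec i) : ℝ) : ℂ) := by
  have h : HasFDerivAt (fun x => (r.toFun x : ℂ))
      (Complex.ofRealCLM.comp (fderiv ℝ r.toFun x)) x :=
    Complex.ofRealCLM.hasFDerivAt.comp x (r.differentiable_toFun x).hasFDerivAt
  rw [nu, partialD, h.fderiv]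
  rfl

theorem conj_nu (i : RealIdx n) (x : Cn n) : (starRingEnd ℂ) (r.nu i x) = r.nu i x := by
  rw [nu_apply, Complex.conj_ofReal]

theorem inner_dirVec_gradient (i : RealIdx n) (x : Cn n) :
    inner ℝ (dirVec i) (gradient r.toFun x) = fderiv ℝ r.toFun x (dirVec i) := by
  rw [real_inner_comm]
  simp [gradient]

theorem sum_nu_mul_self {x : Cn n} (hx : x ∈ r.nhd) : ∑ i, r.nu i x * r.nu i x = 1 := by
  have h := sum_inner_dirVec_sq (gradient r.toFun x)
  rw [r.norm_gradient x hx, one_pow] at h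
  simp only [inner_dirVec_gradient] at h
  simp only [nu_apply]
  rw [← Complex.ofReal_one, ← h]
  push_cast
  exact Finset.sum_congr rfl fun i _ => (sq _).symm

theorem fderiv_gradient (f : Cn n → ℂ) (x : Cn n) :
    fderiv ℝ f x (gradient r.toFun x) = ∑ i, r.nu i x * partialD i f x := by
  conv_lhs => rw [← sum_inner_dirVec_smul (gradient r.toFun x)]
  simp only [map_sum, map_smul, inner_dirVec_gradient, nu_apply, partialD, Complex.real_smul]

end DefiningFunction

end DefiningFunctions


/-! ### The divergence theorem for fields tangential at the boundary. -/

section DivergenceTheorem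

open Topology Filter

variable {n : ℕ}

theorem partialD_mul (i : RealIdx n) {f g : Cn n → ℂ} (hf : ContDiff ℝ ∞ f) (hg : ContDiff ℝ ∞ g)
    (x : Cn n) :
    partialD i (fun y => f y * g y) x = partialD i f x * g x + f x * partialD i g x := by
  have := ((hf.differentiable (by simp) x).hasFDerivAt.mul
    (hg.differentiable (by simp) x).hasFDerivAt).fderiv
  simp only [partialD]
  rw [show (fun y => f y * g y) = f * g from rfl, this]
  simp only [add_apply, smul_apply, smul_eq_mul]
  ring

theorem partialD_sub (i : RealIdx n) {f g : Cn n → ℂ} (hf : ContDiff ℝ ∞ f) (hg : ContDiff ℝ ∞ g)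
    (x : Cn n) : partialD i (fun y => f y - g y) x = partialD i f x - partialD i g x := by
  simp only [partialD]
  rw [fderiv_fun_sub (hf.differentiable (by simp) x) (hg.differentiable (by simp) x)]
  rfl

theorem partialD_sum {ι : Type*} (s : Finset ι) (i : RealIdx n) {f : ι → Cn n → ℂ}
    (hf : ∀ j, ContDiff ℝ ∞ (f j)) (x : Cn n) :
    partialD i (fun y => ∑ j ∈ s, f j y) x = ∑ j ∈ s, partialD i (f j) x := by
  simp only [partialD]
  rw [fderiv_fun_sum fun j _ => (hf j).differentiable (by simp) x]
  simp

theorem contDiff_sum_mul {ι : Type*} (s : Finset ι) {f g : ι → Cn n → ℂ}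
    (hf : ∀ j, ContDiff ℝ ∞ (f j)) (hg : ∀ j, ContDiff ℝ ∞ (g j)) :
    ContDiff ℝ ∞ fun x => ∑ j ∈ s, f j x * g j x :=
  ContDiff.sum fun j _ => (hf j).mul (hg j)

theorem integral_partialD_eq_zero (i : RealIdx n) {g : Cn n → ℂ} (hg : ContDiff ℝ ∞ g)
    (hc : HasCompactSupport g) : ∫ x, partialD i g x = 0 := by
  have hg' : Continuous (partialD i g) := (contDiff_partialD i hg).continuous
  have hc' : HasCompactSupport (partialD i g) := hc.fderiv_apply ℝ _
  have := integral_mul_fderiv_eq_neg_fderiv_mul_of_integrable (μ := (volume : Measure (Cn n)))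
    (f := fun _ => (1 : ℂ)) (g := g) (v := dirVec i) (by simp)
    (by simp only [one_mul]; exact hg'.integrable_of_hasCompactSupport hc')
    (by simpa using hg.continuous.integrable_of_hasCompactSupport hc)
    (fun x _ => differentiableAt_const _) (fun x _ => hg.differentiable (by simp) x)
  simpa [partialD] using this

theorem integrableOn_of_continuous (Ω : SmoothlyBoundedDomain n) {F : Type*}
    [NormedAddCommGroup F] {u : Cn n → F} (hu : Continuous u) : IntegrableOn u Ω.carrier :=
  (hu.continuousOn.integrableOn_compact Ω.isBounded.isCompact_closure).mono_set subset_closure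

/-- A function vanishing on the boundary is dominated by the defining function. -/
theorem DefiningFunction.exists_bound_of_vanishing {Ω : SmoothlyBoundedDomain n}
    (r : DefiningFunction Ω) {u : Cn n → ℂ} (hu : ContDiff ℝ ∞ u)
    (h0 : ∀ x ∈ frontier Ω.carrier, u x = 0) :
    ∃ C, ∀ x ∈ Ω.carrier, ‖u x‖ ≤ C * |r.toFun x| := by
  have hK : IsCompact (closure Ω.carrier) := Ω.isBounded.isCompact_closure
  have hfc : IsCompact (frontier Ω.carrier) :=
    hK.of_isClosed_subset isClosed_frontier frontier_subset_closure
  suffices h : ∃ C, ∀ x ∈ closure Ω.carrier, ‖u x‖ ≤ C * |r.toFun x| by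
    obtain ⟨C, hC⟩ := h
    exact ⟨C, fun x hx => hC x (subset_closure hx)⟩
  refine hK.induction_on (p := fun s => ∃ C, ∀ x ∈ s, ‖u x‖ ≤ C * |r.toFun x|) ⟨0, by simp⟩
    ?_ ?_ ?_
  · rintro s t hst ⟨C, hC⟩
    exact ⟨C, fun x hx => hC x (hst hx)⟩
  · rintro s t ⟨C, hC⟩ ⟨D, hD⟩
    refine ⟨max C D, ?_⟩
    rintro x (hx | hx)
    · exact (hC x hx).trans (mul_le_mul_of_nonneg_right (le_max_left _ _) (abs_nonneg _))
    · exact (hD x hx).trans (mul_le_mul_of_nonneg_right (le_max_right _ _) (abs_nonneg _))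
  · intro x _
    suffices h : ∃ C, ∀ᶠ z in 𝓝 x, ‖u z‖ ≤ C * |r.toFun z| by
      obtain ⟨C, hC⟩ := h
      exact ⟨{z | ‖u z‖ ≤ C * |r.toFun z|}, mem_nhdsWithin_of_mem_nhds hC, C, fun z hz => hz⟩
    by_cases hx : r.toFun x = 0
    -- Near a boundary point $u$ is Lipschitz and $|r(z)|$ is the distance from $z$ to its nearest
    -- boundary point, where $u=0$.
    · have hxf := (r.zero_iff x).2 hx
      obtain ⟨K, t, ht, hLip⟩ :=
        ((hu.of_le (by simp : (1 : WithTop ℕ∞) ≤ ∞)).contDiffAt (x := x)).exists_lipschitzOnWith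
      obtain ⟨δ, hδ, hball⟩ := Metric.mem_nhds_iff.1 ht
      refine ⟨K, ?_⟩
      filter_upwards [Metric.ball_mem_nhds x (half_pos hδ),
        r.isOpen_nhd.mem_nhds (r.frontier_subset hxf)] with z hz hzn
      rw [Metric.mem_ball] at hz
      obtain ⟨y, hy, hzy⟩ := hfc.exists_infDist_eq_dist ⟨x, hxf⟩ z
      have h1 : dist z y ≤ dist z x := hzy ▸ Metric.infDist_le_dist_of_mem hxf
      have h2 : dist y x < δ := by
        have := dist_triangle_left y x z
        linarith
      have h3 := hLip.dist_le_mul z (hball (by rw [Metric.mem_ball]; linarith)) y (hball h2)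
      rw [h0 y hy, dist_zero_right, ← hzy] at h3
      refine h3.trans_eq ?_
      rw [r.eq_signedDist z hzn, signedDist]
      split_ifs
      · rw [abs_neg, abs_of_nonneg Metric.infDist_nonneg]
      · rw [abs_of_nonneg Metric.infDist_nonneg]
    · have hpos : 0 < |r.toFun x| := abs_pos.2 hx
      have hc : ContinuousAt (fun z => (‖u x‖ + 1) / |r.toFun x| * 2 * |r.toFun z| - ‖u z‖) x :=
        (continuousAt_const.mul r.smooth.continuous.continuousAt.abs).sub
          hu.continuous.continuousAt.norm
      -- Chosen so that the right-hand side at $x$ is $2(\|u(x)\|+1)$; the strict inequality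
      -- persists nearby.
      refine ⟨(‖u x‖ + 1) / |r.toFun x| * 2, ?_⟩
      have : 0 < (fun z => (‖u x‖ + 1) / |r.toFun x| * 2 * |r.toFun z| - ‖u z‖) x := by
        have h1 : (‖u x‖ + 1) / |r.toFun x| * 2 * |r.toFun x| = (‖u x‖ + 1) * 2 := by
          field_simp
        simp only [h1]
        have := norm_nonneg (u x)
        linarith
      filter_upwards [hc.eventually (lt_mem_nhds this)] with z hz
      linarith

theorem deriv_smoothTransition_of_neg {τ : ℝ} (h : τ < 0) : deriv Real.smoothTransition τ = 0 := by
  have : Real.smoothTransition =ᶠ[𝓝 τ] fun _ => 0 := by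
    filter_upwards [gt_mem_nhds h] with z hz using Real.smoothTransition.zero_of_nonpos hz.le
  rw [this.deriv_eq, deriv_const]

theorem deriv_smoothTransition_of_one_lt {τ : ℝ} (h : 1 < τ) :
    deriv Real.smoothTransition τ = 0 := by
  have : Real.smoothTransition =ᶠ[𝓝 τ] fun _ => 1 := by
    filter_upwards [lt_mem_nhds h] with z hz using Real.smoothTransition.one_of_one_le hz.le
  rw [this.deriv_eq, deriv_const]

/-- For $\tau=-mr-1$ the quantity is $-mr\,T'(\tau)$. It is what appears, uniformly in $m$, when the
derivative of the cut-off $T(\tau)$ multiplies a function that is $O(|r|)$. The bound holds because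
$T'$ lives on $[0,1]$. -/
theorem exists_bound_deriv_smoothTransition :
    ∃ B, ∀ τ, |(τ + 1) * deriv Real.smoothTransition τ| ≤ B := by
  have hc : Continuous fun τ : ℝ => (τ + 1) * deriv Real.smoothTransition τ :=
    (by fun_prop : Continuous fun τ : ℝ => τ + 1).mul
      ((Real.smoothTransition.contDiff (n := 1)).continuous_deriv le_rfl)
  obtain ⟨B, hB⟩ := (isCompact_Icc (a := (0 : ℝ)) (b := 1)).exists_bound_of_continuousOn
    hc.continuousOn
  refine ⟨max B 0, fun τ => ?_⟩
  rcases lt_or_ge τ 0 with h | h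
  · simp [deriv_smoothTransition_of_neg h]
  · rcases lt_or_ge 1 τ with h' | h'
    · simp [deriv_smoothTransition_of_one_lt h']
    · exact (hB τ ⟨h, h'⟩).trans (le_max_left _ _)

/-- The integral over `Ω` of the divergence of a vector field that is tangential at the boundary
is zero. -/
theorem DefiningFunction.integral_divergence_eq_zero {Ω : SmoothlyBoundedDomain n}
    (r : DefiningFunction Ω) {V : RealIdx n → Cn n → ℂ} (hV : ∀ i, ContDiff ℝ ∞ (V i))
    (h0 : ∀ x ∈ frontier Ω.carrier, ∑ i, V i x * r.nu i x = 0) :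
    ∫ x in Ω.carrier, ∑ i, partialD i (V i) x = 0 := by
  set T := Real.smoothTransition with hT
  have hTd : ContDiff ℝ ∞ T := Real.smoothTransition.contDiff
  set u : Cn n → ℂ := fun x => ∑ i, V i x * r.nu i x with hu
  have hus : ContDiff ℝ ∞ u := contDiff_sum_mul _ hV r.contDiff_nu
  -- For $m\ge1$ the cut-off $T(\tau_m)$ is $0$ where $r\ge-1/m$ and $1$ where $r\le-2/m$. The shift
  -- by $1$ makes $\tau_m<0$ off $\Omega$, boundary included, so $T$ and $T'$ both vanish there.
  set τ : ℕ → Cn n → ℝ := fun m x => -(m : ℝ) * r.toFun x - 1 with hτ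
  set η : ℕ → Cn n → ℂ := fun m x => (T (τ m x) : ℂ) with hη
  have hτs : ∀ m, ContDiff ℝ ∞ (τ m) := fun m =>
    (contDiff_const.mul r.smooth).sub contDiff_const
  have hηs : ∀ m, ContDiff ℝ ∞ (η m) := fun m =>
    Complex.ofRealCLM.contDiff.comp (hTd.comp (hτs m))
  have hτneg : ∀ m x, x ∉ Ω.carrier → τ m x < 0 := by
    intro m x hx
    rw [r.neg_iff, not_lt] at hx
    have : 0 ≤ (m : ℝ) * r.toFun x := mul_nonneg (Nat.cast_nonneg _) hx
    simp only [hτ]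
    linarith
  have hηz : ∀ m x, x ∉ Ω.carrier → η m x = 0 := fun m x hx => by
    simp [hη, hT, Real.smoothTransition.zero_of_nonpos (hτneg m x hx).le]
  have hηD : ∀ m i x, partialD i (η m) x =
      -((m * deriv T (τ m x) : ℝ) : ℂ) * r.nu i x := by
    intro m i x
    have h1 : HasFDerivAt (τ m) (-(m : ℝ) • fderiv ℝ r.toFun x) x :=
      ((r.differentiable_toFun x).hasFDerivAt.const_mul (-(m : ℝ))).sub_const 1
    have h2 := ((hTd.differentiable (by simp)) (τ m x)).hasDerivAt.comp_hasFDerivAt x h1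
    have h3 : HasFDerivAt (η m)
        (Complex.ofRealCLM.comp (deriv T (τ m x) • (-(m : ℝ) • fderiv ℝ r.toFun x))) x :=
      Complex.ofRealCLM.hasFDerivAt.comp x h2
    rw [partialD, h3.fderiv, r.nu_apply]
    simp
    ring
  have hcomp : ∀ m i, HasCompactSupport fun x => η m x * V i x := by
    intro m i
    refine HasCompactSupport.of_support_subset_isCompact Ω.isBounded.isCompact_closure ?_
    intro x hx
    by_contra h
    exact hx (by simp [hηz m x fun h' => h (subset_closure h')])
  have hdivc : Continuous fun x => ∑ i, partialD i (V i) x :=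
    continuous_finsetSum _ fun i _ => (contDiff_partialD i (hV i)).continuous
  -- $\eta_mV$ has compact support and vanishes off $\Omega$, so its divergence integrates to zero.
  -- As $m\to\infty$ the left side tends to $\int_\Omega\operatorname{div}V$, the right side to $0$
  -- by dominated convergence.
  have key : ∀ m, ∫ x in Ω.carrier, η m x * ∑ i, partialD i (V i) x =
      ∫ x in Ω.carrier, ((m * deriv T (τ m x) : ℝ) : ℂ) * u x := by
    intro m
    have hcont1 : Continuous fun x => ((m * deriv T (τ m x) : ℝ) : ℂ) * u x := by
      refine (Complex.continuous_ofReal.comp (continuous_const.mul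
        ((hTd.continuous_deriv (by simp)).comp (hτs m).continuous))).mul hus.continuous
    have hpt : ∀ x, ∑ i, partialD i (fun y => η m y * V i y) x =
        η m x * ∑ i, partialD i (V i) x - ((m * deriv T (τ m x) : ℝ) : ℂ) * u x := by
      intro x
      simp only [partialD_mul _ (hηs m) (hV _), hηD, hu, Finset.sum_add_distrib, Finset.mul_sum]
      rw [add_comm, sub_eq_add_neg, ← Finset.sum_neg_distrib]
      congr 1
      exact Finset.sum_congr rfl fun i _ => by ring
    have hz : ∫ x, ∑ i, partialD i (fun y => η m y * V i y) x = 0 := by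
      rw [integral_finsetSum]
      · exact Finset.sum_eq_zero fun i _ =>
          integral_partialD_eq_zero i ((hηs m).mul (hV i)) (hcomp m i)
      · intro i _
        exact (contDiff_partialD i ((hηs m).mul (hV i))).continuous.integrable_of_hasCompactSupport
          ((hcomp m i).fderiv_apply ℝ _)
    have hset : ∫ x in Ω.carrier, ∑ i, partialD i (fun y => η m y * V i y) x = 0 := by
      rw [setIntegral_eq_integral_of_forall_compl_eq_zero, hz]
      intro x hx
      rw [hpt, hηz m x hx, deriv_smoothTransition_of_neg (hτneg m x hx)]
      simp
    simp only [hpt] at hset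
    rw [integral_sub] at hset
    · exact sub_eq_zero.1 hset
    · exact integrableOn_of_continuous Ω ((hηs m).continuous.mul hdivc)
    · exact integrableOn_of_continuous Ω hcont1
  have hlarge : ∀ x ∈ Ω.carrier, ∀ᶠ m : ℕ in atTop, 1 < τ m x := by
    intro x hx
    have hr := (r.neg_iff x).1 hx
    have h1 : Tendsto (fun m : ℕ => (m : ℝ) * -r.toFun x) atTop atTop :=
      tendsto_natCast_atTop_atTop.atTop_mul_const (neg_pos.2 hr)
    filter_upwards [h1.eventually_gt_atTop 2] with m hm
    simp only [hτ]
    linarith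
  have lim1 : Tendsto (fun m => ∫ x in Ω.carrier, η m x * ∑ i, partialD i (V i) x) atTop
      (𝓝 (∫ x in Ω.carrier, ∑ i, partialD i (V i) x)) := by
    refine tendsto_integral_of_dominated_convergence (fun x => ‖∑ i, partialD i (V i) x‖)
      (fun m => ((hηs m).continuous.mul hdivc).aestronglyMeasurable)
      (integrableOn_of_continuous Ω hdivc.norm) ?_ ?_
    · intro m
      refine ae_of_all _ fun x => ?_
      rw [norm_mul]
      refine mul_le_of_le_one_left (norm_nonneg _) ?_
      simp only [hη, Complex.norm_real, Real.norm_eq_abs]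
      rw [abs_of_nonneg (Real.smoothTransition.nonneg _)]
      exact Real.smoothTransition.le_one _
    · filter_upwards [ae_restrict_mem Ω.isOpen.measurableSet] with x hx
      refine tendsto_const_nhds.congr' ?_
      filter_upwards [hlarge x hx] with m hm
      simp [hη, hT, Real.smoothTransition.one_of_one_le hm.le]
  have lim2 : Tendsto (fun m : ℕ => ∫ x in Ω.carrier, ((m * deriv T (τ m x) : ℝ) : ℂ) * u x) atTop
      (𝓝 (∫ _ in Ω.carrier, 0)) := by
    obtain ⟨C, hC⟩ := r.exists_bound_of_vanishing hus h0
    obtain ⟨B, hB⟩ := exists_bound_deriv_smoothTransition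
    refine tendsto_integral_of_dominated_convergence (fun _ => |C| * B) (fun m => ?_)
      (integrableOn_of_continuous Ω continuous_const) ?_ ?_
    · exact ((Complex.continuous_ofReal.comp (continuous_const.mul
        ((hTd.continuous_deriv (by simp)).comp (hτs m).continuous))).mul
          hus.continuous).aestronglyMeasurable
    · intro m
      filter_upwards [ae_restrict_mem Ω.isOpen.measurableSet] with x hx
      rw [norm_mul, Complex.norm_real, Real.norm_eq_abs]
      have h1 : ‖u x‖ ≤ |C| * |r.toFun x| :=
        (hC x hx).trans (mul_le_mul_of_nonneg_right (le_abs_self C) (abs_nonneg _))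
      calc |m * deriv T (τ m x)| * ‖u x‖ ≤ |m * deriv T (τ m x)| * (|C| * |r.toFun x|) := by gcongr
        _ = |C| * |(τ m x + 1) * deriv T (τ m x)| := by
            simp only [hτ, abs_mul, sub_add_cancel, abs_neg]
            ring
        _ ≤ |C| * B := by gcongr; exact hB _
    · filter_upwards [ae_restrict_mem Ω.isOpen.measurableSet] with x hx
      refine tendsto_const_nhds.congr' ?_
      filter_upwards [hlarge x hx] with m hm
      simp [hT, deriv_smoothTransition_of_one_lt hm]
  rw [integral_zero] at lim2
  simp only [key] at lim1
  exact tendsto_nhds_unique lim1 lim2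

end DivergenceTheorem


/-! ### Multi-indices, lists of directions, and the weights $\gamma_\alpha$. -/

section Derivatives

variable {n : ℕ}

theorem smoothD_apply (i : RealIdx n) (f : SmoothFn n) :
    (smoothD i f : Cn n → ℂ) = partialD i f := rfl

theorem partialD_comm (i j : RealIdx n) {f : Cn n → ℂ} (hf : ContDiff ℝ ∞ f) :
    partialD i (partialD j f) = partialD j (partialD i f) := by
  have hd : Differentiable ℝ (fderiv ℝ f) :=
    (hf.fderiv_right (m := ∞) (by simp)).differentiable (by simp)
  have key : ∀ (k l : RealIdx n) (x : Cn n),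
      partialD k (partialD l f) x = fderiv ℝ (fderiv ℝ f) x (dirVec k) (dirVec l) := by
    intro k l x
    have h : HasFDerivAt (fun y => fderiv ℝ f y (dirVec l)) _ x :=
      (hd x).hasFDerivAt.clm_apply (hasFDerivAt_const (dirVec l) x)
    have h' : partialD l f = fun y => fderiv ℝ f y (dirVec l) := rfl
    rw [h', partialD, h.fderiv]
    simp
  ext x
  rw [key, key]
  exact (hf.contDiffAt.isSymmSndFDerivAt
    (by rw [minSmoothness_of_isRCLikeNormedField]; exact ENat.LEInfty.out)) _ _

theorem commute_smoothD (i j : RealIdx n) : Commute (smoothD i) (smoothD j) := by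
  refine LinearMap.ext fun f => Subtype.ext ?_
  exact partialD_comm i j (contDiff_coe f)

theorem commute_smoothD_listProd (i : RealIdx n) (c : Fin n → RealIdx n) (α : RealIdx n → ℕ)
    (l : List (Fin n)) :
    Commute (smoothD i) (l.map fun j => smoothD (c j) ^ α (c j)).prod := by
  refine Commute.list_prod_right _ _ fun a ha => ?_
  obtain ⟨j, -, rfl⟩ := List.mem_map.1 ha
  exact (commute_smoothD i (c j)).pow_right _

theorem listProd_pow_update_of_notMem (i : RealIdx n) (c : Fin n → RealIdx n) (α : RealIdx n → ℕ)
    (l : List (Fin n)) (hl : ∀ j ∈ l, c j ≠ i) :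
    (l.map fun j => smoothD (c j) ^ (α + Pi.single i 1 : RealIdx n → ℕ) (c j)).prod =
      (l.map fun j => smoothD (c j) ^ α (c j)).prod := by
  congr 1
  refine List.map_congr_left fun j hj => ?_
  simp [hl j hj]

theorem listProd_pow_update_of_mem (c : Fin n → RealIdx n) (hc : Function.Injective c) (k : Fin n)
    (α : RealIdx n → ℕ) (l : List (Fin n)) (hl : l.Nodup) (hk : k ∈ l) :
    (l.map fun j => smoothD (c j) ^ (α + Pi.single (c k) 1 : RealIdx n → ℕ) (c j)).prod =
      smoothD (c k) * (l.map fun j => smoothD (c j) ^ α (c j)).prod := by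
  induction l with
  | nil => simp at hk
  | cons a l ih =>
    rw [List.nodup_cons] at hl
    rw [List.map_cons, List.prod_cons, List.map_cons, List.prod_cons]
    by_cases hak : a = k
    · subst hak
      rw [listProd_pow_update_of_notMem]
      · simp [pow_succ', mul_assoc]
      · intro j hj h
        exact hl.1 (hc h ▸ hj)
    · have hk' : k ∈ l := by
        rcases List.mem_cons.1 hk with h | h
        · exact absurd h.symm hak
        · exact h
      rw [ih hl.2 hk', ← mul_assoc, ← mul_assoc]
      congr 1
      have : c a ≠ c k := fun h => hak (hc h)
      simp only [Pi.add_apply, Pi.single_apply, this, if_false, add_zero]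
      exact ((commute_smoothD _ _).pow_right _).eq.symm

theorem smoothDMulti_add_single (i : RealIdx n) (α : RealIdx n → ℕ) :
    smoothDMulti (α + Pi.single i 1) = smoothD i * smoothDMulti α := by
  rw [smoothDMulti, smoothDMulti]
  rcases i with k | k
  · rw [listProd_pow_update_of_mem Sum.inl Sum.inl_injective k α _ (List.nodup_finRange n)
      (List.mem_finRange k), listProd_pow_update_of_notMem (Sum.inl k) Sum.inr α _ (by simp),
      mul_assoc]
  · rw [listProd_pow_update_of_mem Sum.inr Sum.inr_injective k α _ (List.nodup_finRange n)
      (List.mem_finRange k), listProd_pow_update_of_notMem (Sum.inr k) Sum.inl α _ (by simp),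
      ← mul_assoc, ← mul_assoc, (commute_smoothD_listProd (Sum.inr k) Sum.inl α _).eq]

theorem smoothDMulti_zero : smoothDMulti (fun _ : RealIdx n => 0) = 1 := by
  simp [smoothDMulti]

theorem commute_smoothD_smoothDMulti (i : RealIdx n) (α : RealIdx n → ℕ) :
    Commute (smoothD i) (smoothDMulti α) :=
  (commute_smoothD_listProd i Sum.inl α _).mul_right (commute_smoothD_listProd i Sum.inr α _)

/-- The iterated derivative along a list of coordinate directions. -/
def listD (L : List (RealIdx n)) : Module.End ℂ (SmoothFn n) := (L.map smoothD).prod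

theorem listD_nil (f : SmoothFn n) : listD [] f = f := by simp [listD]

theorem listD_cons (i : RealIdx n) (L : List (RealIdx n)) (f : SmoothFn n) :
    listD (i :: L) f = smoothD i (listD L f) := by
  simp [listD]

theorem listD_smoothD (i : RealIdx n) (L : List (RealIdx n)) (f : SmoothFn n) :
    listD L (smoothD i f) = smoothD i (listD L f) := by
  have h : Commute (smoothD i) (listD L) := by
    refine Commute.list_prod_right _ _ fun a ha => ?_
    obtain ⟨j, -, rfl⟩ := List.mem_map.1 ha
    exact commute_smoothD i j
  exact (LinearMap.congr_fun h.eq f).symm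

/-- Multi-indices enter through the inner product, whereas the inductions below run over lists of
directions. This lemma and `listD_eq_smoothDMulti` translate between the two while preserving the
order. -/
theorem exists_listD_eq (α : RealIdx n → ℕ) :
    ∃ L : List (RealIdx n), L.length = ∑ i, α i ∧ smoothDMulti α = listD L := by
  induction hm : ∑ i, α i generalizing α with
  | zero =>
    have : α = fun _ => 0 := by
      funext i
      exact (Finset.sum_eq_zero_iff.1 hm) i (Finset.mem_univ i)
    exact ⟨[], rfl, by rw [this, smoothDMulti_zero]; simp [listD]⟩
  | succ m ih =>
    obtain ⟨i, -, hi⟩ : ∃ i ∈ Finset.univ, α i ≠ 0 := by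
      refine Finset.exists_ne_zero_of_sum_ne_zero ?_
      rw [hm]; simp
    set β : RealIdx n → ℕ := α - Pi.single i 1 with hβ
    have hαβ : α = β + Pi.single i 1 := by
      funext j
      by_cases hj : j = i
      · subst hj
        simp [hβ]
        omega
      · simp [hβ, hj]
    have hsum : ∑ j, β j = m := by
      have : ∑ j, α j = ∑ j, β j + 1 := by
        conv_lhs => rw [hαβ]
        simp [Finset.sum_add_distrib]
      omega
    obtain ⟨L, hL, hL'⟩ := ih β hsum
    refine ⟨i :: L, by simp [hL], ?_⟩
    rw [hαβ, smoothDMulti_add_single, hL']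
    simp [listD]

theorem listD_eq_smoothDMulti (L : List (RealIdx n)) :
    ∃ α : RealIdx n → ℕ, ∑ i, α i = L.length ∧ listD L = smoothDMulti α := by
  induction L with
  | nil => exact ⟨fun _ => 0, by simp, by rw [smoothDMulti_zero]; simp [listD]⟩
  | cons i L ih =>
    obtain ⟨α, h1, h2⟩ := ih
    refine ⟨α + Pi.single i 1, by simp [Finset.sum_add_distrib, h1], ?_⟩
    rw [smoothDMulti_add_single, ← h2]
    simp [listD]

/-- The sum over all `t`-tuples of directions of `(D_{i₁} ⋯ D_{i_t} f) \overline{D_{i₁} ⋯ D_{i_t} g}`. -/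
def jetPairing : ℕ → SmoothFn n → SmoothFn n → Cn n → ℂ
  | 0, f, g => fun x => (f : Cn n → ℂ) x * (starRingEnd ℂ) ((g : Cn n → ℂ) x)
  | t + 1, f, g => fun x => ∑ i, jetPairing t (smoothD i f) (smoothD i g) x

/-- The linear functional on polynomials sending `X^α` to `D^α f(x) \overline{D^α g(x)}`. -/
def pairingFunctional (f g : SmoothFn n) (x : Cn n) : MvPolynomial (RealIdx n) ℂ →ₗ[ℂ] ℂ :=
  (MvPolynomial.basisMonomials (RealIdx n) ℂ).constr ℂ fun α =>
    (smoothDMulti α f : Cn n → ℂ) x * (starRingEnd ℂ) ((smoothDMulti α g : Cn n → ℂ) x)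

theorem pairingFunctional_monomial (f g : SmoothFn n) (x : Cn n) (α : RealIdx n →₀ ℕ) :
    pairingFunctional f g x (MvPolynomial.monomial α 1) =
      (smoothDMulti α f : Cn n → ℂ) x * (starRingEnd ℂ) ((smoothDMulti α g : Cn n → ℂ) x) := by
  have := (MvPolynomial.basisMonomials (RealIdx n) ℂ).constr_basis ℂ (fun α : RealIdx n →₀ ℕ =>
    (smoothDMulti α f : Cn n → ℂ) x * (starRingEnd ℂ) ((smoothDMulti α g : Cn n → ℂ) x)) α
  rwa [MvPolynomial.coe_basisMonomials] at this

/-- Multiplication by $X_i$ raises $\alpha_i$ by one, which amounts to applying $D_i$ to both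
functions. -/
theorem pairingFunctional_X_mul (f g : SmoothFn n) (x : Cn n) (i : RealIdx n)
    (p : MvPolynomial (RealIdx n) ℂ) :
    pairingFunctional f g x (MvPolynomial.X i * p) =
      pairingFunctional (smoothD i f) (smoothD i g) x p := by
  have h : pairingFunctional f g x ∘ₗ LinearMap.mulLeft ℂ (MvPolynomial.X i) =
      pairingFunctional (smoothD i f) (smoothD i g) x := by
    refine (MvPolynomial.basisMonomials (RealIdx n) ℂ).ext fun α => ?_
    have hD : ∀ k : SmoothFn n, smoothDMulti (α + Finsupp.single i 1 : RealIdx n →₀ ℕ) k =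
        smoothDMulti α (smoothD i k) := by
      intro k
      rw [Finsupp.coe_add, Finsupp.single_eq_pi_single, smoothDMulti_add_single,
        (commute_smoothD_smoothDMulti i α).eq]
      rfl
    simp only [MvPolynomial.coe_basisMonomials, LinearMap.comp_apply, LinearMap.mulLeft_apply,
      MvPolynomial.X, MvPolynomial.monomial_mul, one_mul, pairingFunctional_monomial]
    rw [add_comm, hD, hD]
  exact LinearMap.congr_fun h p

theorem jetPairing_eq_pairingFunctional (t : ℕ) (f g : SmoothFn n) (x : Cn n) :
    jetPairing t f g x = pairingFunctional f g x ((∑ i, MvPolynomial.X i) ^ t) := by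
  induction t generalizing f g with
  | zero =>
    have := pairingFunctional_monomial f g x 0
    rw [pow_zero, ← MvPolynomial.C_1, MvPolynomial.C_apply, this, Finsupp.coe_zero]
    have h0 : smoothDMulti (0 : RealIdx n → ℕ) = 1 := smoothDMulti_zero
    rw [h0]
    rfl
  | succ t ih =>
    rw [pow_succ', Finset.sum_mul, map_sum]
    simp only [pairingFunctional_X_mul, ← ih]
    rfl

/-- The multinomial theorem applied to $(\sum_iX_i)^t$. This is where the choice
$\gamma_\alpha=|\alpha|!/\alpha!$ matters: it makes the top-order part of the inner product a sum
over tuples, from which directions can be peeled off one at a time. -/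
theorem jetPairing_eq_sum (t : ℕ) (f g : SmoothFn n) (x : Cn n) :
    jetPairing t f g x = ∑ α ∈ Finset.piAntidiag (Finset.univ : Finset (RealIdx n)) t,
      (gammaCoeff α : ℂ) * ((smoothDMulti α f : Cn n → ℂ) x *
        (starRingEnd ℂ) ((smoothDMulti α g : Cn n → ℂ) x)) := by
  rw [jetPairing_eq_pairingFunctional, Finset.sum_pow_eq_sum_piAntidiag, map_sum]
  refine Finset.sum_congr rfl fun α _ => ?_
  have h1 : ∏ i, (MvPolynomial.X i : MvPolynomial (RealIdx n) ℂ) ^ α i =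
      MvPolynomial.monomial (Finsupp.equivFunOnFinite.symm α) 1 := by
    rw [MvPolynomial.monomial_eq, MvPolynomial.C_1, one_mul,
      Finsupp.prod_fintype _ _ (fun i => by simp)]
    rfl
  rw [h1, ← nsmul_eq_mul, map_nsmul, pairingFunctional_monomial, nsmul_eq_mul]
  rfl

/-- Only the part of order exactly $s$ can put $s+1$ derivatives on $\varphi$ in $\langle
D_i\varphi,\psi\rangle_s$. -/
theorem sum_multiIdx_eq (s : ℕ) (F : (RealIdx n → ℕ) → ℂ) :
    ∑ α : MultiIdx n s, F α.1 = ∑ α ∈ Finset.piAntidiag (Finset.univ : Finset (RealIdx n)) s, F α +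
      ∑ α : MultiIdx n s, if ∑ i, α.1 i < s then F α.1 else 0 := by
  have h1 : ∑ α ∈ Finset.piAntidiag (Finset.univ : Finset (RealIdx n)) s, F α =
      ∑ α : MultiIdx n s, if ∑ i, α.1 i = s then F α.1 else 0 := by
    rw [← Finset.sum_filter]
    refine Finset.sum_bij' (fun α hα => (⟨α, by
      rw [Finset.mem_piAntidiag] at hα; exact hα.1.le⟩ : MultiIdx n s)) (fun α _ => α.1)
      ?_ ?_ ?_ ?_ ?_
    · intro α hα
      rw [Finset.mem_piAntidiag] at hα
      simpa using hα.1
    · intro α hα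
      rw [Finset.mem_filter] at hα
      simpa [Finset.mem_piAntidiag] using hα.2
    all_goals simp
  rw [h1, ← Finset.sum_add_distrib]
  refine Finset.sum_congr rfl fun α _ => ?_
  rcases lt_or_eq_of_le α.2 with h | h
  · rw [if_pos h, if_neg h.ne, zero_add]
  · rw [if_pos h, if_neg h.not_lt, add_zero]

end Derivatives


/-! ### Reduction to normal derivatives modulo bounded functionals. -/

section BoundedFunctionals

variable {n : ℕ}

theorem contDiff_conj {f : Cn n → ℂ} (hf : ContDiff ℝ ∞ f) :
    ContDiff ℝ ∞ fun x => (starRingEnd ℂ) (f x) :=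
  Complex.conjCLE.contDiff.comp hf

/-- A Sobolev norm of order `s` on smooth functions. -/
def sobNorm (Ω : SmoothlyBoundedDomain n) (s : ℕ) (φ : SmoothFn n) : ℝ :=
  ∑ α : MultiIdx n s, ‖toL2 Ω (smoothDMulti α.1 φ)‖

theorem sobNorm_nonneg (Ω : SmoothlyBoundedDomain n) (s : ℕ) (φ : SmoothFn n) :
    0 ≤ sobNorm Ω s φ := Finset.sum_nonneg fun _ _ => norm_nonneg _

theorem norm_toL2_listD_le (Ω : SmoothlyBoundedDomain n) {s : ℕ} {L : List (RealIdx n)}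
    (hL : L.length ≤ s) (φ : SmoothFn n) : ‖toL2 Ω (listD L φ)‖ ≤ sobNorm Ω s φ := by
  obtain ⟨α, h1, h2⟩ := listD_eq_smoothDMulti L
  rw [h2]
  have key := Finset.single_le_sum (s := Finset.univ)
    (f := fun α : MultiIdx n s => ‖toL2 Ω (smoothDMulti α.1 φ)‖)
    (fun _ _ => norm_nonneg _) (Finset.mem_univ (⟨α, h1.le.trans hL⟩ : MultiIdx n s))
  exact key

/-- Functionals on smooth functions that are bounded in the Sobolev norm of order `s`. -/
def SobBounded (Ω : SmoothlyBoundedDomain n) (s : ℕ) (ℓ : SmoothFn n → ℂ) : Prop :=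
  ∃ C, ∀ φ, ‖ℓ φ‖ ≤ C * sobNorm Ω s φ

namespace SobBounded

variable {Ω : SmoothlyBoundedDomain n} {s : ℕ} {ℓ ℓ' : SmoothFn n → ℂ}

theorem zero : SobBounded Ω s fun _ => 0 := ⟨0, by simp⟩

theorem add (h : SobBounded Ω s ℓ) (h' : SobBounded Ω s ℓ') :
    SobBounded Ω s fun φ => ℓ φ + ℓ' φ := by
  obtain ⟨C, hC⟩ := h
  obtain ⟨D, hD⟩ := h'
  refine ⟨C + D, fun φ => (norm_add_le _ _).trans ?_⟩
  rw [add_mul]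
  exact add_le_add (hC φ) (hD φ)

theorem const_mul (h : SobBounded Ω s ℓ) (c : ℂ) : SobBounded Ω s fun φ => c * ℓ φ := by
  obtain ⟨C, hC⟩ := h
  refine ⟨‖c‖ * C, fun φ => ?_⟩
  rw [norm_mul, mul_assoc]
  exact mul_le_mul_of_nonneg_left (hC φ) (norm_nonneg _)

theorem sum {ι : Type*} (t : Finset ι) {ℓ : ι → SmoothFn n → ℂ}
    (h : ∀ j ∈ t, SobBounded Ω s (ℓ j)) : SobBounded Ω s fun φ => ∑ j ∈ t, ℓ j φ := by
  classical
  induction t using Finset.induction_on with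
  | empty => simpa using zero
  | insert a t ha ih =>
    simp only [Finset.sum_insert ha]
    exact (h a (Finset.mem_insert_self _ _)).add
      (ih fun j hj => h j (Finset.mem_insert_of_mem hj))

theorem congr (h : SobBounded Ω s ℓ) (he : ∀ φ, ℓ' φ = ℓ φ) : SobBounded Ω s ℓ' := by
  obtain ⟨C, hC⟩ := h
  exact ⟨C, fun φ => by rw [he]; exact hC φ⟩

end SobBounded

theorem memLp_continuous (Ω : SmoothlyBoundedDomain n) {f : Cn n → ℂ} (hc : Continuous f) :
    MemLp f 2 (volume.restrict Ω.carrier) := by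
  obtain ⟨C, hC⟩ := Ω.isBounded.isCompact_closure.exists_bound_of_continuousOn hc.continuousOn
  have : IsFiniteMeasure (volume.restrict Ω.carrier) :=
    ⟨by rw [Measure.restrict_apply_univ]; exact Ω.isBounded.measure_lt_top⟩
  refine MemLp.of_bound hc.aestronglyMeasurable C ?_
  filter_upwards [ae_restrict_mem Ω.isOpen.measurableSet] with x hx using
    hC x (subset_closure hx)

/-- Cauchy–Schwarz in $L^2(\Omega)$. Apart from the zero functional, the bounded functionals met
below all come from this one. -/
theorem sobBounded_integral_listD (Ω : SmoothlyBoundedDomain n) {s : ℕ} {h : Cn n → ℂ}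
    (hh : Continuous h) {L : List (RealIdx n)} (hL : L.length ≤ s) :
    SobBounded Ω s fun φ => ∫ x in Ω.carrier, h x * (listD L φ : Cn n → ℂ) x := by
  have hh' : MemLp (fun x => (starRingEnd ℂ) (h x)) 2 (volume.restrict Ω.carrier) :=
    memLp_continuous Ω (Complex.continuous_conj.comp hh)
  refine ⟨‖hh'.toLp _‖, fun φ => ?_⟩
  have : ∫ x in Ω.carrier, h x * (listD L φ : Cn n → ℂ) x =
      inner ℂ (hh'.toLp _) (toL2 Ω (listD L φ)) := by
    rw [L2.inner_def]
    refine integral_congr_ae ?_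
    filter_upwards [hh'.coeFn_toLp, (memLp_smooth Ω (listD L φ)).coeFn_toLp] with x h1 h2
    simp only [toL2, LinearMap.coe_mk, AddHom.coe_mk, h1, h2, RCLike.inner_apply,
      Complex.conj_conj]
    ring
  simp only [this]
  exact (norm_inner_le_norm _ _).trans
    (mul_le_mul_of_nonneg_left (norm_toL2_listD_le Ω hL φ) (norm_nonneg _))

namespace DefiningFunction

variable {Ω : SmoothlyBoundedDomain n} (r : DefiningFunction Ω)

/-- Integration by parts without boundary term for tangential first-order operators. -/
theorem integral_tangential {c : RealIdx n → Cn n → ℂ} (hc : ∀ j, ContDiff ℝ ∞ (c j))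
    (h0 : ∀ x ∈ frontier Ω.carrier, ∑ j, c j x * r.nu j x = 0) {u : Cn n → ℂ}
    (hu : ContDiff ℝ ∞ u) :
    ∫ x in Ω.carrier, ∑ j, c j x * partialD j u x =
      -∫ x in Ω.carrier, (∑ j, partialD j (c j) x) * u x := by
  have h := r.integral_divergence_eq_zero (V := fun j x => c j x * u x)
    (fun j => (hc j).mul hu) (fun x hx => by
      have : ∑ j, c j x * u x * r.nu j x = (∑ j, c j x * r.nu j x) * u x := by
        rw [Finset.sum_mul]
        exact Finset.sum_congr rfl fun j _ => by ring
      rw [this, h0 x hx, zero_mul])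
  have hpt : ∀ x, ∑ j, partialD j (fun y => c j y * u y) x =
      (∑ j, partialD j (c j) x) * u x + ∑ j, c j x * partialD j u x := by
    intro x
    simp only [partialD_mul _ (hc _) hu, Finset.sum_add_distrib, Finset.sum_mul]
  simp only [hpt] at h
  rw [integral_add] at h
  · exact (neg_eq_of_add_eq_zero_right h).symm
  · exact integrableOn_of_continuous Ω ((continuous_finsetSum _ fun j _ =>
      (contDiff_partialD j (hc j)).continuous).mul hu.continuous)
  · exact integrableOn_of_continuous Ω
      (contDiff_sum_mul _ hc fun j => contDiff_partialD j hu).continuous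

/-- The integrand may carry $s+1$ derivatives of $\varphi$; integration by parts moves one of them
to the coefficients, and no boundary term appears. -/
theorem sobBounded_tangential {s : ℕ} {c : RealIdx n → Cn n → ℂ} (hc : ∀ j, ContDiff ℝ ∞ (c j))
    (h0 : ∀ x ∈ frontier Ω.carrier, ∑ j, c j x * r.nu j x = 0) {L : List (RealIdx n)}
    (hL : L.length ≤ s) :
    SobBounded Ω s fun φ =>
      ∫ x in Ω.carrier, ∑ j, c j x * (smoothD j (listD L φ) : Cn n → ℂ) x := by
  have hcont : Continuous fun x => ∑ j, partialD j (c j) x :=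
    continuous_finsetSum _ fun j _ => (contDiff_partialD j (hc j)).continuous
  refine ((sobBounded_integral_listD Ω hcont hL).const_mul (-1)).congr fun φ => ?_
  rw [neg_one_mul]
  exact r.integral_tangential hc h0 (contDiff_coe _)

/-- `∑ ν_{j₁} ⋯ ν_{j_k} D_{j₁} ⋯ D_{j_k} f`, the `k`-th derivative in the direction of the gradient
of the defining function. -/
def normalPow : ℕ → SmoothFn n → Cn n → ℂ
  | 0, f => f
  | k + 1, f => fun x => ∑ j, r.nu j x * normalPow k (smoothD j f) x

theorem normalPow_succ (k : ℕ) (f : SmoothFn n) (x : Cn n) :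
    r.normalPow (k + 1) f x = ∑ j, r.nu j x * r.normalPow k (smoothD j f) x := rfl

theorem contDiff_normalPow (k : ℕ) (f : SmoothFn n) : ContDiff ℝ ∞ (r.normalPow k f) := by
  induction k generalizing f with
  | zero => exact contDiff_coe f
  | succ k ih => exact contDiff_sum_mul _ r.contDiff_nu fun j => ih (smoothD j f)

theorem integral_mul_normalPow_succ {h : Cn n → ℂ} (hh : ContDiff ℝ ∞ h) (k : ℕ)
    (f : SmoothFn n) :
    ∫ x in Ω.carrier, h x * r.normalPow (k + 1) f x =
      ∑ j, ∫ x in Ω.carrier, h x * r.nu j x * r.normalPow k (smoothD j f) x := by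
  rw [← integral_finsetSum]
  · refine integral_congr_ae (ae_of_all _ fun x => ?_)
    simp only [normalPow, Finset.mul_sum, mul_assoc]
  · intro j _
    exact integrableOn_of_continuous Ω
      ((hh.mul (r.contDiff_nu j)).mul (r.contDiff_normalPow k _)).continuous

/-- $D_i-\nu_iN$ is tangential on $b\Omega$ because $|\nu|=1$ there. For $k>0$ an outer factor
$\nu_j$ of the normal power is absorbed into $h$ and its $D_j$ joins the list, which lowers $k$. -/
theorem sobBounded_exchange {s : ℕ} (k : ℕ) {h : Cn n → ℂ} (hh : ContDiff ℝ ∞ h) (i : RealIdx n)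
    {L : List (RealIdx n)} (hL : L.length + k ≤ s) :
    SobBounded Ω s fun φ =>
      (∫ x in Ω.carrier, h x * r.normalPow k (smoothD i (listD L φ)) x) -
        ∫ x in Ω.carrier, h x * r.nu i x * r.normalPow (k + 1) (listD L φ) x := by
  induction k generalizing h L with
  | zero =>
    -- The coefficients of $h(D_i-\nu_iN)$; their flux density on $b\Omega$ is
    -- $h\nu_i(1-|\nu|^2)=0$.
    set c : RealIdx n → Cn n → ℂ := fun j x =>
      (if j = i then h x else 0) - h x * r.nu i x * r.nu j x with hc
    have hcs : ∀ j, ContDiff ℝ ∞ (c j) := by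
      intro j
      refine ContDiff.sub ?_ ((hh.mul (r.contDiff_nu i)).mul (r.contDiff_nu j))
      by_cases hji : j = i
      · simpa [hji] using hh
      · simpa [hji] using contDiff_const
    have hsum : ∀ (w : RealIdx n → ℂ) (x : Cn n), ∑ j, c j x * w j =
        h x * w i - h x * r.nu i x * ∑ j, r.nu j x * w j := by
      intro w x
      simp only [hc, sub_mul, Finset.sum_sub_distrib, ite_mul, zero_mul, Finset.sum_ite_eq',
        Finset.mem_univ, if_true, Finset.mul_sum, mul_assoc]
    refine (r.sobBounded_tangential hcs (fun x hx => ?_) (by simpa using hL)).congr fun φ => ?_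
    · rw [hsum, r.sum_nu_mul_self (r.frontier_subset hx)]
      ring
    · rw [← integral_sub]
      · refine integral_congr_ae (ae_of_all _ fun x => ?_)
        simp only [hsum]
        rfl
      · exact integrableOn_of_continuous Ω (hh.mul (contDiff_coe _)).continuous
      · exact integrableOn_of_continuous Ω
          ((hh.mul (r.contDiff_nu i)).mul (r.contDiff_normalPow _ _)).continuous
  | succ k ih =>
    have hj : ∀ j ∈ Finset.univ, SobBounded Ω s fun φ =>
        (∫ x in Ω.carrier, h x * r.nu j x * r.normalPow k (smoothD i (listD (j :: L) φ)) x) -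
        ∫ x in Ω.carrier, h x * r.nu j x * r.nu i x *
          r.normalPow (k + 1) (listD (j :: L) φ) x := fun j _ =>
      ih (hh.mul (r.contDiff_nu j)) (by simp only [List.length_cons]; omega)
    refine (SobBounded.sum _ hj).congr fun φ => ?_
    rw [r.integral_mul_normalPow_succ hh,
      r.integral_mul_normalPow_succ (hh.mul (r.contDiff_nu i)), Finset.sum_sub_distrib]
    congr 1
    · refine Finset.sum_congr rfl fun j _ => ?_
      have hcm := LinearMap.congr_fun (commute_smoothD i j).eq (listD L φ)
      rw [Module.End.mul_apply, Module.End.mul_apply] at hcm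
      rw [listD_cons, hcm]
    · refine Finset.sum_congr rfl fun j _ => integral_congr_ae (ae_of_all _ fun x => ?_)
      simp only [listD_cons]
      ring

/-- The product of the components of the gradient along a list of directions. -/
def nuList (L : List (RealIdx n)) (x : Cn n) : ℂ := (L.map fun i => r.nu i x).prod

theorem contDiff_nuList (L : List (RealIdx n)) : ContDiff ℝ ∞ (r.nuList L) := by
  induction L with
  | nil => exact contDiff_const
  | cons i L ih =>
    have : r.nuList (i :: L) = fun x => r.nu i x * r.nuList L x := by
      funext x
      simp [nuList]
    rw [this]
    exact (r.contDiff_nu i).mul ih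

/-- The directions of the list are exchanged one by one for $\nu_iN$. The total order stays $s+1$,
so each exchange costs only a bounded functional. -/
theorem sobBounded_listD_sub_normalPow {s : ℕ} {h : Cn n → ℂ} (hh : ContDiff ℝ ∞ h)
    {L : List (RealIdx n)} {k : ℕ} (hL : L.length + k = s + 1) :
    SobBounded Ω s fun φ =>
      (∫ x in Ω.carrier, h x * r.normalPow k (listD L φ) x) -
        ∫ x in Ω.carrier, h x * r.nuList L x * r.normalPow (s + 1) φ x := by
  induction L generalizing h k with
  | nil =>
    have : k = s + 1 := by simpa using hL
    subst this
    refine SobBounded.zero.congr fun φ => ?_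
    simp [nuList, listD_nil]
  | cons i L ih =>
    have h1 := r.sobBounded_exchange (s := s) k hh i (L := L)
      (by simp only [List.length_cons] at hL; omega)
    have h2 := ih (hh.mul (r.contDiff_nu i)) (k := k + 1)
      (by simp only [List.length_cons] at hL; omega)
    refine (h1.add h2).congr fun φ => ?_
    rw [sub_add_sub_cancel, listD_cons]
    simp only [nuList, List.map_cons, List.prod_cons, mul_assoc]

theorem continuous_jetPairing (t : ℕ) (f g : SmoothFn n) : Continuous (jetPairing t f g) := by
  induction t generalizing f g with
  | zero => exact (contDiff_coe f).continuous.mul (contDiff_conj (contDiff_coe g)).continuous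
  | succ t ih => exact continuous_finsetSum _ fun i _ => ih _ _

/-- Each $D_i$ acts on $\varphi$ and on $\psi$. On $\varphi$ it is exchanged for $\nu_iN$, and the
factor $\nu_i$ so released, being real, combines with the $D_i$ on $\psi$; summed over $i$ this
builds up the normal derivatives of $\psi$. -/
theorem sobBounded_jetPairing_sub_normalPow {s : ℕ} (t : ℕ) {h : Cn n → ℂ} (hh : ContDiff ℝ ∞ h)
    (ψ : SmoothFn n) {L : List (RealIdx n)} (hL : L.length + t = s + 1) :
    SobBounded Ω s fun φ =>
      (∫ x in Ω.carrier, h x * jetPairing t (listD L φ) ψ x) -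
        ∫ x in Ω.carrier, h x * r.nuList L x * (starRingEnd ℂ) (r.normalPow t ψ x) *
          r.normalPow (s + 1) φ x := by
  induction t generalizing ψ L with
  | zero =>
    refine (r.sobBounded_listD_sub_normalPow (hh.mul (contDiff_conj (contDiff_coe ψ)))
      (k := 0) hL).congr fun φ => ?_
    congr 1
    · refine integral_congr_ae (ae_of_all _ fun x => ?_)
      simp only [jetPairing, normalPow]
      ring
    · refine integral_congr_ae (ae_of_all _ fun x => ?_)
      simp only [normalPow]
      ring
  | succ t ih =>
    refine (SobBounded.sum Finset.univ fun i _ => ih (smoothD i ψ) (L := i :: L)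
      (by simp only [List.length_cons]; omega)).congr fun φ => ?_
    rw [Finset.sum_sub_distrib, ← integral_finsetSum, ← integral_finsetSum]
    · congr 1
      · refine integral_congr_ae (ae_of_all _ fun x => ?_)
        simp only [jetPairing, Finset.mul_sum, listD_cons]
      · refine integral_congr_ae (ae_of_all _ fun x => ?_)
        simp only [normalPow_succ r t ψ, map_sum, map_mul, conj_nu, nuList, List.map_cons,
          List.prod_cons, Finset.mul_sum, Finset.sum_mul]
        exact Finset.sum_congr rfl fun i _ => by ring
    · intro i _
      exact integrableOn_of_continuous Ω (((hh.mul (r.contDiff_nuList _)).mul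
        (contDiff_conj (r.contDiff_normalPow _ _))).mul (r.contDiff_normalPow _ _)).continuous
    · intro i _
      exact integrableOn_of_continuous Ω (hh.continuous.mul (continuous_jetPairing _ _ _))

/-- Modulo bounded functionals, the Sobolev inner product of `D_i φ` with `ψ` only involves
normal derivatives. -/
theorem sobBounded_sobolevInner_sub (s : ℕ) (i : RealIdx n) (ψ : SmoothFn n) :
    SobBounded Ω s fun φ =>
      (∑ α : MultiIdx n s, (gammaCoeff α.1 : ℂ) *
        ∫ x in Ω.carrier, (smoothDMulti α.1 (smoothD i φ) : Cn n → ℂ) x *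
          (starRingEnd ℂ) ((smoothDMulti α.1 ψ : Cn n → ℂ) x)) -
      ∫ x in Ω.carrier, r.nu i x * (starRingEnd ℂ) (r.normalPow s ψ x) *
        r.normalPow (s + 1) φ x := by
  have h1 := r.sobBounded_jetPairing_sub_normalPow (s := s) s (contDiff_const (c := (1 : ℂ))) ψ
    (L := [i]) (by simp [add_comm])
  -- Below top order, $D^\alpha D_i$ has order at most $s$, so each term is bounded directly.
  have h2 : SobBounded Ω s fun φ => ∑ α : MultiIdx n s, if ∑ i, α.1 i < s then
      (gammaCoeff α.1 : ℂ) *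
        ∫ x in Ω.carrier, (smoothDMulti α.1 (smoothD i φ) : Cn n → ℂ) x *
          (starRingEnd ℂ) ((smoothDMulti α.1 ψ : Cn n → ℂ) x) else 0 := by
    refine SobBounded.sum _ fun α _ => ?_
    by_cases hα : ∑ i, α.1 i < s
    · simp only [if_pos hα]
      refine SobBounded.const_mul ?_ _
      obtain ⟨L, hL, hL'⟩ := exists_listD_eq α.1
      refine (sobBounded_integral_listD Ω
        (contDiff_conj (contDiff_coe (smoothDMulti α.1 ψ))).continuous (L := i :: L)
        (by simp only [List.length_cons]; omega)).congr fun φ => ?_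
      refine integral_congr_ae (ae_of_all _ fun x => ?_)
      simp only [hL', listD_smoothD, listD_cons]
      ring
    · simp only [if_neg hα]
      exact SobBounded.zero
  refine (h1.add h2).congr fun φ => ?_
  rw [sum_multiIdx_eq s fun α => (gammaCoeff α : ℂ) *
        ∫ x in Ω.carrier, (smoothDMulti α (smoothD i φ) : Cn n → ℂ) x *
          (starRingEnd ℂ) ((smoothDMulti α ψ : Cn n → ℂ) x)]
  have h3 : ∑ α ∈ Finset.piAntidiag (Finset.univ : Finset (RealIdx n)) s, (gammaCoeff α : ℂ) *
      ∫ x in Ω.carrier, (smoothDMulti α (smoothD i φ) : Cn n → ℂ) x *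
          (starRingEnd ℂ) ((smoothDMulti α ψ : Cn n → ℂ) x) =
      ∫ x in Ω.carrier, 1 * jetPairing s (listD [i] φ) ψ x := by
    simp only [← integral_const_mul]
    rw [← integral_finsetSum]
    · refine integral_congr_ae (ae_of_all _ fun x => ?_)
      simp only [one_mul, jetPairing_eq_sum, listD_cons, listD_nil]
    · intro α _
      exact integrableOn_of_continuous Ω (continuous_const.mul
        ((contDiff_coe _).continuous.mul (contDiff_conj (contDiff_coe _)).continuous))
  rw [h3]
  have h4 : ∫ x in Ω.carrier, 1 * r.nuList [i] x * (starRingEnd ℂ) (r.normalPow s ψ x) *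
      r.normalPow (s + 1) φ x = ∫ x in Ω.carrier, r.nu i x *
        (starRingEnd ℂ) (r.normalPow s ψ x) * r.normalPow (s + 1) φ x := by
    simp [nuList]
  rw [h4]
  ring

end DefiningFunction

end BoundedFunctionals


/-! ### Iterated normal derivatives near the boundary. -/

section NormalDerivative

open Topology

variable {n : ℕ}

namespace DefiningFunction

variable {Ω : SmoothlyBoundedDomain n} (r : DefiningFunction Ω)

/-- The derivative in the direction of the gradient of the defining function. -/
def normalField (f : Cn n → ℂ) (x : Cn n) : ℂ := ∑ i, r.nu i x * partialD i f x

theorem normalField_mul {f g : Cn n → ℂ} (hf : ContDiff ℝ ∞ f) (hg : ContDiff ℝ ∞ g) (x : Cn n) :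
    r.normalField (fun y => f y * g y) x = r.normalField f x * g x + f x * r.normalField g x := by
  simp only [normalField, partialD_mul _ hf hg, mul_add, Finset.sum_add_distrib, Finset.sum_mul,
    Finset.mul_sum]
  congr 1 <;> exact Finset.sum_congr rfl fun i _ => by ring

theorem normalField_sum {ι : Type*} (t : Finset ι) {f : ι → Cn n → ℂ}
    (hf : ∀ j, ContDiff ℝ ∞ (f j)) (x : Cn n) :
    r.normalField (fun y => ∑ j ∈ t, f j y) x = ∑ j ∈ t, r.normalField (f j) x := by
  simp only [normalField, partialD_sum t _ hf, Finset.mul_sum]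
  rw [Finset.sum_comm]

theorem partialD_const (i : RealIdx n) (c : ℂ) (x : Cn n) :
    partialD i (fun _ => c) x = 0 := by
  simp [partialD]

theorem normalField_const (c : ℂ) (x : Cn n) : r.normalField (fun _ => c) x = 0 := by
  simp [normalField, partialD]

theorem partialD_nu_comm (i j : RealIdx n) : partialD i (r.nu j) = partialD j (r.nu i) :=
  partialD_comm i j r.contDiff_ofReal

/-- The gradient field is parallel along itself where it has unit length. -/
theorem normalField_nu {x : Cn n} (hx : x ∈ r.nhd) (j : RealIdx n) :
    r.normalField (r.nu j) x = 0 := by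
  have h1 : (fun y => ∑ i, r.nu i y * r.nu i y) =ᶠ[𝓝 x] fun _ => 1 := by
    filter_upwards [r.isOpen_nhd.mem_nhds hx] with y hy using r.sum_nu_mul_self hy
  -- Differentiating $|\nu|^2=1$ gives $\sum_i\nu_iD_j\nu_i=0$, and $D_j\nu_i=D_i\nu_j$ because
  -- $\nu$ is a gradient.
  have h2 : partialD j (fun y => ∑ i, r.nu i y * r.nu i y) x = 0 := by
    rw [partialD, h1.fderiv_eq]
    simp
  rw [partialD_sum _ _ fun i => (r.contDiff_nu i).mul (r.contDiff_nu i)] at h2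
  simp only [partialD_mul _ (r.contDiff_nu _) (r.contDiff_nu _), r.partialD_nu_comm j] at h2
  have h3 : ∑ i, (partialD i (r.nu j) x * r.nu i x + r.nu i x * partialD i (r.nu j) x) =
      2 * r.normalField (r.nu j) x := by
    rw [normalField, Finset.mul_sum]
    exact Finset.sum_congr rfl fun i _ => by ring
  rw [h3] at h2
  simpa using h2

/-- `normalPow` keeps all coefficients $\nu_j$ outside the derivatives. Near $b\Omega$ this agrees
with iterating the field, because $N\nu_j=0$ there. -/
theorem normalField_normalPow {x : Cn n} (hx : x ∈ r.nhd) (k : ℕ) (f : SmoothFn n) :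
    r.normalField (r.normalPow k f) x = r.normalPow (k + 1) f x := by
  induction k generalizing f with
  | zero => rfl
  | succ k ih =>
    have h : r.normalPow (k + 1) f = fun y => ∑ j, r.nu j y * r.normalPow k (smoothD j f) y := rfl
    rw [h, r.normalField_sum _ fun j => (r.contDiff_nu j).mul (r.contDiff_normalPow k _),
      normalPow_succ]
    refine Finset.sum_congr rfl fun j _ => ?_
    rw [r.normalField_mul (r.contDiff_nu j) (r.contDiff_normalPow k _), r.normalField_nu hx, ih]
    ring

/-- The coefficients of `∂̄` of the defining function. -/
def dbarCoeff (k : Fin n) : Cn n → ℂ := wirtingerBar k fun x => (r.toFun x : ℂ)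

theorem dbarCoeff_apply (k : Fin n) (x : Cn n) :
    r.dbarCoeff k x = (1 / 2 : ℂ) * (r.nu (Sum.inl k) x + Complex.I * r.nu (Sum.inr k) x) := rfl

theorem conj_dbarCoeff_apply (k : Fin n) (x : Cn n) : (starRingEnd ℂ) (r.dbarCoeff k x) =
    (1 / 2 : ℂ) * r.nu (Sum.inl k) x + (-(1 / 2) * Complex.I) * r.nu (Sum.inr k) x := by
  rw [dbarCoeff_apply]
  simp only [map_mul, map_add, conj_nu, Complex.conj_I, map_div₀, map_one, map_ofNat]
  ring

theorem contDiff_conj_dbarCoeff (k : Fin n) :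
    ContDiff ℝ ∞ fun x => (starRingEnd ℂ) (r.dbarCoeff k x) := by
  simp only [conj_dbarCoeff_apply]
  exact (contDiff_const.mul (r.contDiff_nu _)).add (contDiff_const.mul (r.contDiff_nu _))

theorem normalField_conj_dbarCoeff {x : Cn n} (hx : x ∈ r.nhd) (k : Fin n) :
    r.normalField (fun y => (starRingEnd ℂ) (r.dbarCoeff k y)) x = 0 := by
  simp only [conj_dbarCoeff_apply]
  have := r.normalField_sum (Finset.univ : Finset (Fin 2))
    (f := ![fun y => (1 / 2 : ℂ) * r.nu (Sum.inl k) y,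
      fun y => (-(1 / 2) * Complex.I) * r.nu (Sum.inr k) y]) (by
      intro j
      fin_cases j
      · exact contDiff_const.mul (r.contDiff_nu _)
      · exact contDiff_const.mul (r.contDiff_nu _)) x
  simp only [Fin.sum_univ_two, Matrix.cons_val_zero, Matrix.cons_val_one] at this
  rw [this, r.normalField_mul contDiff_const (r.contDiff_nu _),
    r.normalField_mul contDiff_const (r.contDiff_nu _), r.normalField_nu hx, r.normalField_nu hx,
    r.normalField_const, r.normalField_const]
  ring

/-- Agreement on an open set passes to derivatives, so this can be iterated; it also replaces
$\varrho$, which may fail to be smooth globally, by $r$. -/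
theorem normalD_eq {f F : Cn n → ℂ} (hfF : Set.EqOn f F r.nhd) :
    Set.EqOn (normalD Ω f) (r.normalField F) r.nhd := by
  intro x hx
  have h1 : f =ᶠ[𝓝 x] F := by
    filter_upwards [r.isOpen_nhd.mem_nhds hx] with y hy using hfF hy
  have h2 : signedDist Ω =ᶠ[𝓝 x] r.toFun := by
    filter_upwards [r.isOpen_nhd.mem_nhds hx] with y hy using (r.eq_signedDist y hy).symm
  rw [normalD, h1.fderiv_eq]
  have h3 : gradient (signedDist Ω) x = gradient r.toFun x := by
    rw [gradient, gradient, h2.fderiv_eq]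
  rw [h3, r.fderiv_gradient]
  rfl

theorem dbarSignedDist_eq (k : Fin n) : Set.EqOn (dbarSignedDist Ω k) (r.dbarCoeff k) r.nhd := by
  intro x hx
  have h2 : (fun y => (signedDist Ω y : ℂ)) =ᶠ[𝓝 x] fun y => (r.toFun y : ℂ) := by
    filter_upwards [r.isOpen_nhd.mem_nhds hx] with y hy
    rw [r.eq_signedDist y hy]
  simp only [dbarSignedDist, dbarCoeff, wirtingerBar, partialD, h2.fderiv_eq]

/-- The contraction of the `s`-th normal derivative of a form with `∂̄` of the defining function. -/
def normalTrace {q : ℕ} (s : ℕ) (ψ : SmoothForm n (q + 1)) (I : FormIdx n q) (x : Cn n) : ℂ :=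
  ∑ k : Fin n, ∑ K : FormIdx n (q + 1),
    (epsSign K k I : ℂ) * r.normalPow s (ψ K) x * (starRingEnd ℂ) (r.dbarCoeff k x)

theorem contDiff_normalTrace {q : ℕ} (s : ℕ) (ψ : SmoothForm n (q + 1)) (I : FormIdx n q) :
    ContDiff ℝ ∞ (r.normalTrace s ψ I) :=
  ContDiff.sum fun k _ => ContDiff.sum fun _ _ =>
    (contDiff_const.mul (r.contDiff_normalPow s _)).mul (r.contDiff_conj_dbarCoeff k)

/-- Near the boundary the iterated normal derivatives of the contraction are the contractions of
the iterated normal derivatives. -/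
theorem iterate_normalD_contraction {q : ℕ} (s : ℕ) (ψ : SmoothForm n (q + 1))
    (I : FormIdx n q) :
    Set.EqOn ((normalD Ω)^[s] (contraction (fun K => (ψ K : Cn n → ℂ)) (dbarSignedDist Ω) I))
      (r.normalTrace s ψ I) r.nhd := by
  induction s with
  | zero =>
    intro x hx
    simp only [Function.iterate_zero, id_eq, contraction, normalTrace, normalPow]
    simp only [r.dbarSignedDist_eq _ hx]
  | succ s ih =>
    intro x hx
    rw [Function.iterate_succ_apply', r.normalD_eq ih hx]
    have hterm : ∀ (k : Fin n) (K : FormIdx n (q + 1)), ContDiff ℝ ∞ fun x =>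
        (epsSign K k I : ℂ) * r.normalPow s (ψ K) x * (starRingEnd ℂ) (r.dbarCoeff k x) :=
      fun k K => (contDiff_const.mul (r.contDiff_normalPow s _)).mul (r.contDiff_conj_dbarCoeff k)
    have h : r.normalTrace s ψ I = fun x => ∑ k : Fin n, ∑ K : FormIdx n (q + 1),
        (epsSign K k I : ℂ) * r.normalPow s (ψ K) x * (starRingEnd ℂ) (r.dbarCoeff k x) := rfl
    rw [h, r.normalField_sum _ fun k => ContDiff.sum fun K _ => hterm k K]
    refine Finset.sum_congr rfl fun k _ => ?_
    rw [r.normalField_sum _ (hterm k)]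
    refine Finset.sum_congr rfl fun K _ => ?_
    rw [r.normalField_mul (contDiff_const.mul (r.contDiff_normalPow s _))
      (r.contDiff_conj_dbarCoeff k), r.normalField_mul contDiff_const (r.contDiff_normalPow s _),
      r.normalField_const, r.normalField_conj_dbarCoeff hx, r.normalField_normalPow hx]
    ring

/-- If the coefficient vanishes on the boundary then the top-order normal functional is bounded. -/
theorem sobBounded_normalPow_of_vanishing {s : ℕ} (k : ℕ) {h : Cn n → ℂ} (hh : ContDiff ℝ ∞ h)
    (h0 : ∀ x ∈ frontier Ω.carrier, h x = 0) {L : List (RealIdx n)} (hL : L.length + k ≤ s) :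
    SobBounded Ω s fun φ => ∫ x in Ω.carrier, h x * r.normalPow (k + 1) (listD L φ) x := by
  induction k generalizing h L with
  | zero =>
    -- With $h=0$ on $b\Omega$ the field $h\nu$ vanishes there, so $hN$ counts as tangential.
    refine (r.sobBounded_tangential (c := fun j x => h x * r.nu j x)
      (fun j => hh.mul (r.contDiff_nu j)) (fun x hx => by simp [h0 x hx])
      (by simpa using hL)).congr fun φ => ?_
    refine integral_congr_ae (ae_of_all _ fun x => ?_)
    simp only [normalPow, Finset.mul_sum, mul_assoc]
  | succ k ih =>
    refine (SobBounded.sum Finset.univ fun j _ => ih (h := fun x => h x * r.nu j x)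
      (hh.mul (r.contDiff_nu j)) (fun x hx => by simp [h0 x hx]) (L := j :: L)
      (by simp only [List.length_cons]; omega)).congr fun φ => ?_
    simp only [listD_cons]
    exact r.integral_mul_normalPow_succ hh (k + 1) (listD L φ)

end DefiningFunction

end NormalDerivative


/-! ### Test functions concentrating at the boundary. -/

section Concentration

open Topology Filter

/-- A bump times $t^s$ equals $t^s$ near $0$, where the $s$-th derivative is $s!$. -/
theorem exists_profile (s : ℕ) :
    ∃ A : ℝ → ℝ, ContDiff ℝ ∞ A ∧ HasCompactSupport A ∧ iteratedDeriv s A 0 ≠ 0 := by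
  let χ : ContDiffBump (0 : ℝ) := ⟨1, 2, one_pos, one_lt_two⟩
  refine ⟨fun t => t ^ s * χ t, (contDiff_id.pow s).mul χ.contDiff,
    χ.hasCompactSupport.mul_left, ?_⟩
  have h : (fun t => t ^ s * χ t) =ᶠ[𝓝 0] fun t => t ^ s := by
    filter_upwards [Metric.closedBall_mem_nhds (0 : ℝ) one_pos] with t ht
    rw [χ.one_of_mem_closedBall ht, mul_one]
  rw [h.iteratedDeriv_eq]
  simp

theorem hasCompactSupport_iteratedDeriv {A : ℝ → ℝ} (h : HasCompactSupport A) (j : ℕ) :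
    HasCompactSupport (iteratedDeriv j A) := by
  induction j with
  | zero => simpa using h
  | succ j ih => rw [iteratedDeriv_succ]; exact ih.deriv

/-- Functions concentrating at `0` whose derivatives of order at most `s` stay bounded and whose
`s`-th derivative at `0` stays fixed. -/
theorem exists_concentrating (s : ℕ) :
    ∃ (a : ℕ → ℝ → ℝ) (κ B : ℝ), κ ≠ 0 ∧ (∀ m, ContDiff ℝ ∞ (a m)) ∧
      (∀ m, iteratedDeriv s (a m) 0 = κ) ∧
      (∀ m, ∀ j ≤ s, ∀ t, |iteratedDeriv j (a m) t| ≤ B) ∧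
      ∀ t < 0, ∀ j, ∀ᶠ m in atTop, iteratedDeriv j (a m) t = 0 := by
  obtain ⟨A, hA, hAc, hA0⟩ := exists_profile s
  have hcont : ∀ j : ℕ, Continuous (iteratedDeriv j A) := fun j =>
    hA.continuous_iteratedDeriv j (by exact_mod_cast le_top)
  have hbd : ∀ j : ℕ, ∃ B, ∀ t, |iteratedDeriv j A t| ≤ B := fun j =>
    (hasCompactSupport_iteratedDeriv hAc j).exists_bound_of_continuous (hcont j)
  choose B hB using hbd
  have hB0 : ∀ j, 0 ≤ B j := fun j => (abs_nonneg _).trans (hB j 0)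
  have hder : ∀ (m j : ℕ) (t : ℝ),
      iteratedDeriv j (fun t => (((m : ℝ) + 1) ^ s)⁻¹ * A (((m : ℝ) + 1) * t)) t =
        (((m : ℝ) + 1) ^ s)⁻¹ * (((m : ℝ) + 1) ^ j * iteratedDeriv j A (((m : ℝ) + 1) * t)) := by
    intro m j t
    rw [iteratedDeriv_const_mul_field, iteratedDeriv_comp_const_mul
      (hA.of_le (by exact_mod_cast le_top))]
  -- With $M=m+1$ the $j$-th derivative is $M^{j-s}A^{(j)}(Mt)$: bounded for $j\le s$, independent
  -- of $M$ at $t=0$ for $j=s$, and eventually zero at fixed $t<0$ because $Mt$ leaves the support.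
  -- The next derivative may grow like $M$.
  refine ⟨fun m t => (((m : ℝ) + 1) ^ s)⁻¹ * A (((m : ℝ) + 1) * t), iteratedDeriv s A 0,
    ∑ j ∈ Finset.range (s + 1), B j, hA0, ?_, ?_, ?_, ?_⟩
  · intro m
    exact contDiff_const.mul (hA.comp (contDiff_const.mul contDiff_id))
  · intro m
    have : ((m : ℝ) + 1) ^ s ≠ 0 := by positivity
    rw [hder, mul_zero, ← mul_assoc, inv_mul_cancel₀ this, one_mul]
  · intro m j hj t
    have h1 : (((m : ℝ) + 1) ^ s)⁻¹ * ((m : ℝ) + 1) ^ j ≤ 1 := by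
      rw [inv_mul_le_iff₀ (by positivity), mul_one]
      exact pow_le_pow_right₀ (by linarith [Nat.cast_nonneg (α := ℝ) m]) hj
    rw [hder, ← mul_assoc, abs_mul, abs_of_nonneg (by positivity)]
    calc _ ≤ 1 * B j := mul_le_mul h1 (hB j _) (abs_nonneg _) zero_le_one
      _ ≤ _ := by
        rw [one_mul]
        exact Finset.single_le_sum (f := B) (fun j _ => hB0 j)
          (Finset.mem_range.2 (Nat.lt_succ_of_le hj))
  · intro t ht j
    obtain ⟨R, hR⟩ := (hasCompactSupport_iteratedDeriv hAc j).isBounded.subset_closedBall 0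
    have h1 : Tendsto (fun m : ℕ => ((m : ℝ) + 1) * -t) atTop atTop :=
      (tendsto_natCast_atTop_atTop.atTop_add tendsto_const_nhds).atTop_mul_const (neg_pos.2 ht)
    filter_upwards [h1.eventually_gt_atTop R] with m hm
    rw [hder, image_eq_zero_of_notMem_tsupport (f := iteratedDeriv j A), mul_zero, mul_zero]
    intro hmem
    have := hR hmem
    rw [Metric.mem_closedBall, Real.dist_eq, sub_zero] at this
    have h2 := neg_abs_le (((m : ℝ) + 1) * t)
    linarith

variable {n : ℕ}

namespace DefiningFunction

variable {Ω : SmoothlyBoundedDomain n} (r : DefiningFunction Ω)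

/-- A function of the defining function as a complex-valued function. -/
def comp (a : ℝ → ℝ) (x : Cn n) : ℂ := (a (r.toFun x) : ℂ)

theorem contDiff_comp {a : ℝ → ℝ} (ha : ContDiff ℝ ∞ a) : ContDiff ℝ ∞ (r.comp a) :=
  Complex.ofRealCLM.contDiff.comp (ha.comp r.smooth)

theorem partialD_comp {a : ℝ → ℝ} (ha : ContDiff ℝ ∞ a) (i : RealIdx n) (x : Cn n) :
    partialD i (r.comp a) x = r.comp (deriv a) x * r.nu i x := by
  have h2 := ((ha.differentiable (by simp)) (r.toFun x)).hasDerivAt.comp_hasFDerivAt x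
    (r.differentiable_toFun x).hasFDerivAt
  have h3 : HasFDerivAt (r.comp a)
      (Complex.ofRealCLM.comp (deriv a (r.toFun x) • fderiv ℝ r.toFun x)) x :=
    Complex.ofRealCLM.hasFDerivAt.comp x h2
  rw [partialD, h3.fderiv, r.nu_apply]
  simp [comp]

theorem contDiff_iteratedDeriv {a : ℝ → ℝ} (ha : ContDiff ℝ ∞ a) (j : ℕ) :
    ContDiff ℝ ∞ (iteratedDeriv j a) := by
  induction j with
  | zero => simpa using ha
  | succ j ih =>
    rw [iteratedDeriv_succ]
    exact (contDiff_infty_iff_deriv.1 ih).2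

/-- `F a = ∑_{j ≤ k} a^{(j)}(r) c_j` for all smooth `a`, with leading coefficient `c_k = top`. -/
def HasExpansion (F : {a : ℝ → ℝ // ContDiff ℝ ∞ a} → Cn n → ℂ) (k : ℕ) (top : Cn n → ℂ) : Prop :=
  ∃ c : ℕ → Cn n → ℂ, (∀ j, ContDiff ℝ ∞ (c j)) ∧ c k = top ∧
    ∀ a x, F a x = ∑ j ∈ Finset.range (k + 1), r.comp (iteratedDeriv j a.1) x * c j x

/-- By the chain rule, $D_i$ either raises the order of $a^{(j)}(r)$ at the price of a factor
$\nu_i$, or falls on $c_j$; only the first can reach order $k+1$. -/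
theorem HasExpansion.partialD {F : {a : ℝ → ℝ // ContDiff ℝ ∞ a} → Cn n → ℂ} {k : ℕ}
    {top : Cn n → ℂ} (h : r.HasExpansion F k top) (i : RealIdx n) :
    r.HasExpansion (fun a => partialD i (F a)) (k + 1) fun x => r.nu i x * top x := by
  obtain ⟨c, hc, htop, hF⟩ := h
  -- The second guard is essential: $c_j$ for $j>k$ is arbitrary and must not enter the new leading
  -- coefficient.
  refine ⟨fun j x => (if j = 0 then 0 else r.nu i x * c (j - 1) x) +
    (if j ≤ k then DbarSobolev.partialD i (c j) x else 0), ?_, ?_, ?_⟩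
  · intro j
    refine ContDiff.add ?_ ?_
    · by_cases hj : j = 0
      · simpa [hj] using contDiff_const
      · simpa [hj] using (r.contDiff_nu i).mul (hc (j - 1))
    · by_cases hj : j ≤ k
      · simpa [hj] using contDiff_partialD i (hc j)
      · simpa [hj] using contDiff_const
  · funext x
    simp [htop]
  · intro a x
    have hFa : F a = fun x => ∑ j ∈ Finset.range (k + 1), r.comp (iteratedDeriv j a.1) x * c j x :=
      funext (hF a)
    have hsm : ∀ j, ContDiff ℝ ∞ (r.comp (iteratedDeriv j a.1)) := fun j =>
      r.contDiff_comp (contDiff_iteratedDeriv a.2 j)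
    simp only [hFa]
    rw [partialD_sum _ _ fun j => (hsm j).mul (hc j)]
    simp only [partialD_mul _ (hsm _) (hc _), r.partialD_comp (contDiff_iteratedDeriv a.2 _),
      ← iteratedDeriv_succ, mul_add, Finset.sum_add_distrib]
    congr 1
    · rw [Finset.sum_range_succ' _ (k + 1)]
      simp [mul_assoc]
    · rw [Finset.sum_range_succ _ (k + 1)]
      simp only [add_le_iff_nonpos_right, nonpos_iff_eq_zero, one_ne_zero,
        if_false, mul_zero, add_zero]
      refine Finset.sum_congr rfl fun j hj => ?_
      rw [if_pos (Nat.lt_succ_iff.1 (Finset.mem_range.1 hj))]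

theorem HasExpansion.mul {F : {a : ℝ → ℝ // ContDiff ℝ ∞ a} → Cn n → ℂ} {k : ℕ}
    {top : Cn n → ℂ} (h : r.HasExpansion F k top) {g : Cn n → ℂ} (hg : ContDiff ℝ ∞ g) :
    r.HasExpansion (fun a x => g x * F a x) k fun x => g x * top x := by
  obtain ⟨c, hc, htop, hF⟩ := h
  refine ⟨fun j x => g x * c j x, fun j => hg.mul (hc j), by simp only [htop], fun a x => ?_⟩
  simp only [hF, Finset.mul_sum]
  exact Finset.sum_congr rfl fun j _ => by ring

theorem HasExpansion.sum {ι : Type*} [Fintype ι]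
    {F : ι → {a : ℝ → ℝ // ContDiff ℝ ∞ a} → Cn n → ℂ} {k : ℕ}
    {top : ι → Cn n → ℂ} (h : ∀ i, r.HasExpansion (F i) k (top i)) :
    r.HasExpansion (fun a x => ∑ i, F i a x) k fun x => ∑ i, top i x := by
  choose c hc htop hF using h
  refine ⟨fun j x => ∑ i, c i j x, fun j => ContDiff.sum fun i _ => hc i j, ?_, fun a x => ?_⟩
  · simp only [htop]
  · simp only [hF, Finset.mul_sum]
    rw [Finset.sum_comm]

/-- The smooth function `a(r) b`. -/
def compMul (a : {a : ℝ → ℝ // ContDiff ℝ ∞ a}) (b : SmoothFn n) : SmoothFn n :=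
  ⟨fun x => r.comp a.1 x * (b : Cn n → ℂ) x, (r.contDiff_comp a.2).mul (contDiff_coe b)⟩

theorem hasExpansion_listD (b : SmoothFn n) (L : List (RealIdx n)) :
    r.HasExpansion (fun a => (listD L (r.compMul a b) : Cn n → ℂ)) L.length
      fun x => r.nuList L x * (b : Cn n → ℂ) x := by
  induction L with
  | nil =>
    refine ⟨fun _ => b, fun _ => contDiff_coe b, by simp [nuList], fun a x => ?_⟩
    simp [listD_nil, compMul]
  | cons i L ih =>
    have := ih.partialD r i
    simp only [listD_cons, smoothD_apply, List.length_cons]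
    convert this using 2 with x
    simp [nuList, mul_assoc]

/-- Each normal derivative contributes $|\nu|^2$ to the leading coefficient. The power is kept
because $|\nu|=1$ is known only near $b\Omega$. -/
theorem hasExpansion_normalPow (b : SmoothFn n) (k : ℕ) (L : List (RealIdx n)) :
    r.HasExpansion (fun a => r.normalPow k (listD L (r.compMul a b))) (L.length + k)
      fun x => r.nuList L x * (∑ j, r.nu j x * r.nu j x) ^ k * (b : Cn n → ℂ) x := by
  induction k generalizing L with
  | zero => simpa [normalPow] using r.hasExpansion_listD b L
  | succ k ih =>
    have hlen : L.length + 1 + k = L.length + (k + 1) := by ring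
    have hj : ∀ j, r.HasExpansion
        (fun a x => r.nu j x * r.normalPow k (smoothD j (listD L (r.compMul a b))) x)
        (L.length + (k + 1))
        fun x => r.nu j x *
          (r.nuList (j :: L) x * (∑ j, r.nu j x * r.nu j x) ^ k * (b : Cn n → ℂ) x) := by
      intro j
      have := (ih (j :: L)).mul r (r.contDiff_nu j)
      simp only [listD_cons, List.length_cons, hlen] at this
      exact this
    have htop : (fun x => r.nuList L x * (∑ j, r.nu j x * r.nu j x) ^ (k + 1) *
        (b : Cn n → ℂ) x) = fun x => ∑ j, r.nu j x *
          (r.nuList (j :: L) x * (∑ j, r.nu j x * r.nu j x) ^ k * (b : Cn n → ℂ) x) := by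
      funext x
      rw [pow_succ, Finset.mul_sum, Finset.mul_sum, Finset.sum_mul]
      refine Finset.sum_congr rfl fun j _ => ?_
      simp only [nuList, List.map_cons, List.prod_cons]
      ring
    rw [htop]
    exact HasExpansion.sum r hj

end DefiningFunction

end Concentration


/-! ### Boundedness forces the boundary fluxes to vanish. -/

section Necessity

open Topology Filter

variable {n : ℕ}

theorem norm_toL2_sq (Ω : SmoothlyBoundedDomain n) (f : SmoothFn n) :
    ‖toL2 Ω f‖ ^ 2 = ∫ x in Ω.carrier, ‖(f : Cn n → ℂ) x‖ ^ 2 := by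
  have h1 := inner_self_eq_norm_sq_to_K (𝕜 := ℂ) (toL2 Ω f)
  rw [L2.inner_def] at h1
  have h2 : ∫ x in Ω.carrier, inner ℂ (toL2 Ω f x) (toL2 Ω f x) =
      ∫ x in Ω.carrier, ((‖(f : Cn n → ℂ) x‖ ^ 2 : ℝ) : ℂ) := by
    refine integral_congr_ae ?_
    filter_upwards [(memLp_smooth Ω f).coeFn_toLp] with x hx
    simp only [toL2, LinearMap.coe_mk, AddHom.coe_mk, hx]
    rw [inner_self_eq_norm_sq_to_K]
    push_cast
    rfl
  rw [h2, integral_complex_ofReal] at h1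
  have h3 : ((‖toL2 Ω f‖ ^ 2 : ℝ) : ℂ) =
      ((∫ x in Ω.carrier, ‖(f : Cn n → ℂ) x‖ ^ 2 : ℝ) : ℂ) := by
    rw [Complex.ofReal_pow]
    exact h1.symm
  exact_mod_cast h3

namespace DefiningFunction

variable {Ω : SmoothlyBoundedDomain n} (r : DefiningFunction Ω)

theorem contDiff_sum_nu_sq : ContDiff ℝ ∞ fun x => ∑ j, r.nu j x * r.nu j x :=
  contDiff_sum_mul _ r.contDiff_nu r.contDiff_nu

/-- If the top-order normal functional with coefficient `h` is bounded, then the flux of every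
multiple of `h` through the boundary is zero. -/
theorem integral_divergence_of_sobBounded {s : ℕ} {h : Cn n → ℂ} (hh : ContDiff ℝ ∞ h)
    (hb : SobBounded Ω s fun φ => ∫ x in Ω.carrier, h x * r.normalPow (s + 1) φ x)
    (b : SmoothFn n) :
    ∫ x in Ω.carrier, ∑ j, partialD j (fun y =>
      h y * (∑ i, r.nu i y * r.nu i y) ^ s * (b : Cn n → ℂ) y * r.nu j y) x = 0 := by
  obtain ⟨a, κ, B, hκ, ha, haκ, haB, ha0⟩ := exists_concentrating s
  set u : ℕ → ℕ → Cn n → ℂ := fun m j => r.comp (iteratedDeriv j (a m)) with hu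
  have hus : ∀ m j, ContDiff ℝ ∞ (u m j) := fun m j =>
    r.contDiff_comp (contDiff_iteratedDeriv (ha m) j)
  have huB : ∀ m, ∀ j ≤ s, ∀ x, ‖u m j x‖ ≤ B := by
    intro m j hj x
    simp only [hu, comp, Complex.norm_real]
    exact haB m j hj _
  have hu0 : ∀ x ∈ Ω.carrier, ∀ j, ∀ᶠ m in atTop, u m j x = 0 := by
    intro x hx j
    filter_upwards [ha0 _ ((r.neg_iff x).1 hx) j] with m hm
    simp [hu, comp, hm]
  have hB0 : 0 ≤ B := (abs_nonneg _).trans (haB 0 0 (Nat.zero_le _) 0)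
  -- Dominated convergence; it stops at order $s$, since beyond that no uniform bound on the
  -- derivatives is available.
  have hlim : ∀ j ≤ s, ∀ c : Cn n → ℂ, Continuous c →
      Tendsto (fun m => ∫ x in Ω.carrier, u m j x * c x) atTop (𝓝 0) := by
    intro j hj c hc
    have := tendsto_integral_of_dominated_convergence (μ := volume.restrict Ω.carrier)
      (F := fun m x => u m j x * c x) (f := fun _ => 0) (fun x => B * ‖c x‖)
      (fun m => ((hus m j).continuous.mul hc).aestronglyMeasurable)
      (integrableOn_of_continuous Ω (continuous_const.mul hc.norm))
      (fun m => ae_of_all _ fun x => by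
        rw [norm_mul]
        exact mul_le_mul_of_nonneg_right (huB m j hj x) (norm_nonneg _))
      (by
        filter_upwards [ae_restrict_mem Ω.isOpen.measurableSet] with x hx
        refine tendsto_const_nhds.congr' ?_
        filter_upwards [hu0 x hx j] with m hm
        simp [hm])
    simpa using this
  set φ : ℕ → SmoothFn n := fun m => r.compMul ⟨a m, ha m⟩ b with hφ
  have hnorm : Tendsto (fun m => sobNorm Ω s (φ m)) atTop (𝓝 0) := by
    have hα : ∀ α : MultiIdx n s,
        Tendsto (fun m => ‖toL2 Ω (smoothDMulti α.1 (φ m))‖) atTop (𝓝 0) := by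
      intro α
      obtain ⟨L, hL, hL'⟩ := exists_listD_eq α.1
      have hLs : L.length ≤ s := hL.trans_le α.2
      obtain ⟨c, hc, -, hF⟩ := r.hasExpansion_listD b L
      have hF' : ∀ m x, (listD L (φ m) : Cn n → ℂ) x =
          ∑ j ∈ Finset.range (L.length + 1), u m j x * c j x := fun m x => hF ⟨a m, ha m⟩ x
      have hsq : Tendsto (fun m => ∫ x in Ω.carrier, ‖(listD L (φ m) : Cn n → ℂ) x‖ ^ 2) atTop
          (𝓝 0) := by
        have := tendsto_integral_of_dominated_convergence (μ := volume.restrict Ω.carrier)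
          (F := fun m x => ‖(listD L (φ m) : Cn n → ℂ) x‖ ^ 2) (f := fun _ => 0)
          (fun x => (∑ j ∈ Finset.range (L.length + 1), B * ‖c j x‖) ^ 2)
          (fun m => ((contDiff_coe (listD L (φ m))).continuous.norm.pow 2).aestronglyMeasurable)
          (integrableOn_of_continuous Ω ((continuous_finsetSum _ fun j _ =>
            continuous_const.mul (hc j).continuous.norm).pow 2))
          (fun m => ae_of_all _ fun x => by
            rw [Real.norm_of_nonneg (by positivity), hF']
            refine pow_le_pow_left₀ (norm_nonneg _) ((norm_sum_le _ _).trans ?_) 2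
            refine Finset.sum_le_sum fun j hj => ?_
            rw [norm_mul]
            refine mul_le_mul_of_nonneg_right (huB m j ?_ x) (norm_nonneg _)
            have := Finset.mem_range.1 hj
            omega)
          (by
            filter_upwards [ae_restrict_mem Ω.isOpen.measurableSet] with x hx
            refine tendsto_const_nhds.congr' ?_
            have : ∀ᶠ m in atTop, ∀ j ∈ Finset.range (L.length + 1), u m j x = 0 :=
              (Finset.eventually_all _).2 fun j _ => hu0 x hx j
            filter_upwards [this] with m hm
            rw [hF', Finset.sum_eq_zero fun j hj => by rw [hm j hj, zero_mul]]
            simp)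
        simpa using this
      have hsqrt := (Real.continuous_sqrt.tendsto 0).comp hsq
      rw [Real.sqrt_zero] at hsqrt
      refine hsqrt.congr fun m => ?_
      rw [Function.comp_apply, ← norm_toL2_sq, Real.sqrt_sq (norm_nonneg _), hL']
    have := tendsto_finsetSum (Finset.univ : Finset (MultiIdx n s)) fun α _ => hα α
    simpa [sobNorm] using this
  obtain ⟨C, hC⟩ := hb
  have hlim1 : Tendsto (fun m => ∫ x in Ω.carrier, h x * r.normalPow (s + 1) (φ m) x) atTop
      (𝓝 0) := by
    refine squeeze_zero_norm (fun m => hC (φ m)) ?_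
    simpa using hnorm.const_mul C
  set S : Cn n → ℂ := fun x => ∑ i, r.nu i x * r.nu i x with hS
  have hSs : ContDiff ℝ ∞ S := r.contDiff_sum_nu_sq
  set H : Cn n → ℂ := fun y => h y * S y ^ s * (b : Cn n → ℂ) y with hH
  have hHs : ContDiff ℝ ∞ H := (hh.mul (hSs.pow s)).mul (contDiff_coe b)
  -- In the expansion of $N^{s+1}\varphi_m$ the terms of order at most $s$ tend to zero, so the
  -- leading one, with coefficient $hS^{s+1}b=HS$, does too.
  have hlim2 : Tendsto (fun m => ∫ x in Ω.carrier, H x * S x * u m (s + 1) x) atTop (𝓝 0) := by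
    obtain ⟨c, hc, htop, hF⟩ := r.hasExpansion_normalPow b (s + 1) []
    simp only [List.length_nil, zero_add, listD_nil] at htop hF
    have hrest : Tendsto (fun m => ∑ j ∈ Finset.range (s + 1),
        ∫ x in Ω.carrier, u m j x * (h x * c j x)) atTop (𝓝 0) := by
      have := tendsto_finsetSum (Finset.range (s + 1)) fun j hj =>
        hlim j (Nat.lt_succ_iff.1 (Finset.mem_range.1 hj)) (fun x => h x * c j x)
          (hh.continuous.mul (hc j).continuous)
      simpa using this
    have hsub := hlim1.sub hrest
    rw [sub_zero] at hsub
    refine hsub.congr fun m => ?_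
    rw [← integral_finsetSum, ← integral_sub]
    · refine integral_congr_ae (ae_of_all _ fun x => ?_)
      have hFm : r.normalPow (s + 1) (φ m) x =
          ∑ j ∈ Finset.range (s + 1 + 1), u m j x * c j x := hF ⟨a m, ha m⟩ x
      simp only [hFm]
      rw [Finset.sum_range_succ, htop, mul_add, Finset.mul_sum]
      have hn : r.nuList [] x = 1 := by simp [nuList]
      simp only [hn]
      have : ∑ j ∈ Finset.range (s + 1), h x * (u m j x * c j x) =
          ∑ j ∈ Finset.range (s + 1), u m j x * (h x * c j x) :=
        Finset.sum_congr rfl fun j _ => by ring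
      rw [this, add_sub_cancel_left]
      simp only [hH, hS, pow_succ]
      ring
    · exact integrableOn_of_continuous Ω (hh.mul (r.contDiff_normalPow _ _)).continuous
    · exact integrableOn_of_continuous Ω (continuous_finsetSum _ fun j _ =>
        (hus m j).continuous.mul (hh.continuous.mul (hc j).continuous))
    · intro j _
      exact integrableOn_of_continuous Ω
        ((hus m j).continuous.mul (hh.continuous.mul (hc j).continuous))
  set G : Cn n → ℂ := fun x => ∑ j, partialD j (fun y => H y * r.nu j y) x with hG
  have hGc : Continuous G := continuous_finsetSum _ fun j _ =>
    (contDiff_partialD j (hHs.mul (r.contDiff_nu j))).continuous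
  -- Since $a_m^{(s)}(0)=\kappa$, the field $H\nu\,(a_m^{(s)}(r)-\kappa)$ vanishes on $b\Omega$ and
  -- its divergence integrates to zero. Subtracting $\kappa$ turns the boundary term into
  -- $\kappa\int_\Omega\operatorname{div}(H\nu)$.
  have hibp : ∀ m, ∫ x in Ω.carrier, H x * S x * u m (s + 1) x =
      (κ : ℂ) * (∫ x in Ω.carrier, G x) - ∫ x in Ω.carrier, u m s x * G x := by
    intro m
    have hws : ContDiff ℝ ∞ fun x => u m s x - (κ : ℂ) := (hus m s).sub contDiff_const
    have hz := r.integral_divergence_eq_zero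
      (V := fun j x => (H x * r.nu j x) * (u m s x - (κ : ℂ)))
      (fun j => (hHs.mul (r.contDiff_nu j)).mul hws) (fun x hx => by
        have : u m s x = κ := by
          simp only [hu, comp, (r.zero_iff x).1 hx, haκ]
        simp [this])
    have hpt : ∀ x, ∑ j, partialD j (fun y => (H y * r.nu j y) * (u m s y - (κ : ℂ))) x =
        u m s x * G x - (κ : ℂ) * G x + H x * S x * u m (s + 1) x := by
      intro x
      have hd : ∀ j, partialD j (fun y => u m s y - (κ : ℂ)) x = u m (s + 1) x * r.nu j x := by
        intro j
        rw [partialD_sub j (hus m s) contDiff_const, partialD_const, sub_zero]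
        have := r.partialD_comp (contDiff_iteratedDeriv (ha m) s) j x
        rw [← iteratedDeriv_succ] at this
        exact this
      simp only [partialD_mul _ (hHs.mul (r.contDiff_nu _)) hws, hd, Finset.sum_add_distrib,
        ← Finset.sum_mul]
      congr 1
      · simp only [hG]
        ring
      · simp only [hS, Finset.mul_sum, Finset.sum_mul]
        exact Finset.sum_congr rfl fun j _ => by ring
    simp only [hpt] at hz
    have i1 : IntegrableOn (fun x => u m s x * G x) Ω.carrier :=
      integrableOn_of_continuous Ω ((hus m s).continuous.mul hGc)
    have i2 : IntegrableOn (fun x => (κ : ℂ) * G x) Ω.carrier :=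
      integrableOn_of_continuous Ω (continuous_const.mul hGc)
    have i3 : IntegrableOn (fun x => H x * S x * u m (s + 1) x) Ω.carrier :=
      integrableOn_of_continuous Ω ((hHs.mul hSs).mul (hus m (s + 1))).continuous
    have i12 : IntegrableOn (fun x => u m s x * G x - (κ : ℂ) * G x) Ω.carrier := i1.sub i2
    rw [integral_add i12 i3, integral_sub i1 i2, integral_const_mul] at hz
    linear_combination hz
  have hlim3 : Tendsto (fun m => ∫ x in Ω.carrier, H x * S x * u m (s + 1) x) atTop
      (𝓝 ((κ : ℂ) * ∫ x in Ω.carrier, G x)) := by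
    simp only [hibp]
    simpa using tendsto_const_nhds.sub (hlim s le_rfl G hGc)
  have := tendsto_nhds_unique hlim3 hlim2
  rcases mul_eq_zero.1 this with h0 | h0
  · exact absurd (Complex.ofReal_eq_zero.1 h0) hκ
  · exact h0

/-- If the top-order normal functional with coefficient `h` is bounded, then derivatives of
functions supported where `h ≠ 0` have zero integral over `Ω`. -/
theorem integral_partialD_of_sobBounded {s : ℕ} {h : Cn n → ℂ} (hh : ContDiff ℝ ∞ h)
    (hb : SobBounded Ω s fun φ => ∫ x in Ω.carrier, h x * r.normalPow (s + 1) φ x)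
    {w : Cn n → ℂ} (hw : ContDiff ℝ ∞ w) (hsupp : ∀ x ∈ tsupport w, h x ≠ 0) (i : RealIdx n) :
    ∫ x in Ω.carrier, partialD i w x = 0 := by
  -- The choice $b=w\nu_i/h$ cancels $h$; it is smooth because $h\ne0$ on the support of $w$.
  have hbs : ContDiff ℝ ∞ fun x => w x * r.nu i x * (h x)⁻¹ := by
    rw [contDiff_iff_contDiffAt]
    intro x
    by_cases hx : x ∈ tsupport w
    · exact (hw.mul (r.contDiff_nu i)).contDiffAt.mul (hh.contDiffAt.inv (hsupp x hx))
    · refine (contDiffAt_const (c := (0 : ℂ))).congr_of_eventuallyEq ?_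
      filter_upwards [(isClosed_tsupport w).isOpen_compl.mem_nhds hx] with y hy
      rw [image_eq_zero_of_notMem_tsupport hy]
      simp
  have h1 := r.integral_divergence_of_sobBounded hh hb ⟨_, hbs⟩
  set S : Cn n → ℂ := fun x => ∑ i, r.nu i x * r.nu i x with hS
  have hSs : ContDiff ℝ ∞ S := r.contDiff_sum_nu_sq
  have heq : ∀ y, h y * S y ^ s * (w y * r.nu i y * (h y)⁻¹) = S y ^ s * (w y * r.nu i y) := by
    intro y
    by_cases hy : y ∈ tsupport w
    · have := hsupp y hy
      field_simp
    · simp [image_eq_zero_of_notMem_tsupport hy]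
  change ∫ x in Ω.carrier, ∑ j, partialD j (fun y =>
    h y * S y ^ s * (w y * r.nu i y * (h y)⁻¹) * r.nu j y) x = 0 at h1
  simp only [heq] at h1
  have hHs : ContDiff ℝ ∞ fun y => S y ^ s * (w y * r.nu i y) :=
    (hSs.pow s).mul (hw.mul (r.contDiff_nu i))
  have hif : ∀ j, ContDiff ℝ ∞ fun y => if j = i then w y else 0 := by
    intro j
    by_cases hj : j = i
    · simpa [hj] using hw
    · simpa [hj] using contDiff_const
  -- The fields $w\,e_i$ and $S^sw\nu_i\,\nu$ have the same flux density $w\nu_i$ on $b\Omega$, so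
  -- their divergences have the same integral; that of the second is zero by `h1`.
  have h2 := r.integral_divergence_eq_zero
    (V := fun j y => (if j = i then w y else 0) - S y ^ s * (w y * r.nu i y) * r.nu j y)
    (fun j => (hif j).sub (hHs.mul (r.contDiff_nu j))) (fun x hx => by
      have hS1 : S x = 1 := r.sum_nu_mul_self (r.frontier_subset hx)
      have : ∑ j, r.nu j x * r.nu j x = 1 := hS1
      simp only [sub_mul, Finset.sum_sub_distrib, ite_mul, zero_mul, Finset.sum_ite_eq',
        Finset.mem_univ, if_true, hS1, one_pow, one_mul, mul_assoc, ← Finset.mul_sum, this]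
      ring)
  have hpt : ∀ x, ∑ j, partialD j (fun y => (if j = i then w y else 0) -
      S y ^ s * (w y * r.nu i y) * r.nu j y) x = partialD i w x -
        ∑ j, partialD j (fun y => S y ^ s * (w y * r.nu i y) * r.nu j y) x := by
    intro x
    simp only [partialD_sub _ (hif _) (hHs.mul (r.contDiff_nu _)), Finset.sum_sub_distrib]
    congr 1
    rw [Finset.sum_eq_single i]
    · simp
    · intro j _ hj
      simp [hj, partialD_const]
    · simp
  simp only [hpt] at h2
  rw [integral_sub, h1, sub_zero] at h2
  · exact h2
  · exact integrableOn_of_continuous Ω (contDiff_partialD i hw).continuous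
  · exact integrableOn_of_continuous Ω (continuous_finsetSum _ fun j _ =>
      (contDiff_partialD j (hHs.mul (r.contDiff_nu j))).continuous)

end DefiningFunction

end Necessity


/-! ### Vanishing of the coefficient by translating a bump across the boundary. -/

section TopOrder

open Topology Filter

variable {n : ℕ} {Ω : SmoothlyBoundedDomain n} (r : DefiningFunction Ω)

theorem DefiningFunction.integral_fderiv_of_sobBounded {s : ℕ} {h : Cn n → ℂ}
    (hh : ContDiff ℝ ∞ h)
    (hb : SobBounded Ω s fun φ => ∫ x in Ω.carrier, h x * r.normalPow (s + 1) φ x)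
    {w : Cn n → ℂ} (hw : ContDiff ℝ ∞ w) (hsupp : ∀ x ∈ tsupport w, h x ≠ 0) (v : Cn n) :
    ∫ x in Ω.carrier, fderiv ℝ w x v = 0 := by
  have hpt : ∀ x, fderiv ℝ w x v = ∑ i, ((inner ℝ (dirVec i) v : ℝ) : ℂ) * partialD i w x := by
    intro x
    conv_lhs => rw [← sum_inner_dirVec_smul v]
    simp only [map_sum, map_smul, partialD, Complex.real_smul]
  simp only [hpt]
  rw [integral_finsetSum]
  · refine Finset.sum_eq_zero fun i _ => ?_
    rw [integral_const_mul, r.integral_partialD_of_sobBounded hh hb hw hsupp, mul_zero]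
  · intro i _
    exact integrableOn_of_continuous Ω
      (continuous_const.mul (contDiff_partialD i hw).continuous)

/-- Translating a compactly supported function changes its integral over `Ω` at the rate given by
its directional derivative. -/
theorem hasDerivAt_integral_translate (Ω : SmoothlyBoundedDomain n) {g : Cn n → ℂ}
    (hg : ContDiff ℝ ∞ g) (hc : HasCompactSupport g) (q v : Cn n) (t : ℝ) :
    HasDerivAt (fun t : ℝ => ∫ x in Ω.carrier, g (x - (q + t • v)))
      (-∫ x in Ω.carrier, fderiv ℝ (fun y => g (y - (q + t • v))) x v) t := by
  have hg' : Continuous (fderiv ℝ g) := hg.continuous_fderiv (by simp)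
  obtain ⟨C, hC⟩ := (hc.fderiv ℝ).exists_bound_of_continuous hg'
  have hcontF : ∀ t : ℝ, Continuous fun x => g (x - (q + t • v)) := fun t =>
    hg.continuous.comp (by fun_prop)
  have hcontF' : ∀ t : ℝ, Continuous fun x => fderiv ℝ g (x - (q + t • v)) (-v) := fun t =>
    (hg'.comp (by fun_prop)).clm_apply continuous_const
  have key := hasDerivAt_integral_of_dominated_loc_of_deriv_le (μ := volume.restrict Ω.carrier)
    (F := fun (t : ℝ) x => g (x - (q + t • v)))
    (F' := fun (t : ℝ) x => fderiv ℝ g (x - (q + t • v)) (-v)) (x₀ := t)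
    (bound := fun _ => C * ‖v‖) (s := Set.univ) univ_mem
    (Eventually.of_forall fun t => (hcontF t).aestronglyMeasurable)
    (integrableOn_of_continuous Ω (hcontF t)) (hcontF' t).aestronglyMeasurable
    (ae_of_all _ fun x t _ => by
      refine (ContinuousLinearMap.le_opNorm _ _).trans ?_
      rw [norm_neg]
      exact mul_le_mul_of_nonneg_right (hC _) (norm_nonneg _))
    (integrableOn_of_continuous Ω continuous_const)
    (ae_of_all _ fun x t _ => by
      have h1 : HasDerivAt (fun t : ℝ => x - (q + t • v)) (-v) t := by
        have := (((hasDerivAt_id t).smul_const v).const_add q).const_sub x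
        simpa using this
      exact (hg.differentiable (by simp) _).hasFDerivAt.comp_hasDerivAt t h1)
  have heq : -∫ x in Ω.carrier, fderiv ℝ (fun y => g (y - (q + t • v))) x v =
      ∫ x in Ω.carrier, fderiv ℝ g (x - (q + t • v)) (-v) := by
    rw [← integral_neg]
    refine integral_congr_ae (ae_of_all _ fun x => ?_)
    simp only [fderiv_comp_sub, map_neg]
  rw [heq]
  exact key.2

/-- The top-order normal functional is bounded only if its coefficient vanishes on the boundary. -/
theorem DefiningFunction.eq_zero_of_sobBounded {s : ℕ} {h : Cn n → ℂ}
    (hh : ContDiff ℝ ∞ h)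
    (hb : SobBounded Ω s fun φ => ∫ x in Ω.carrier, h x * r.normalPow (s + 1) φ x)
    {p : Cn n} (hp : p ∈ frontier Ω.carrier) : h p = 0 := by
  by_contra hp0
  obtain ⟨δ, hδ, hball⟩ := Metric.eventually_nhds_iff.1
    (hh.continuous.continuousAt.eventually_ne hp0)
  have hr0 : r.toFun p = 0 := (r.zero_iff p).1 hp
  obtain ⟨q, hqΩ, hqp⟩ : ∃ q ∈ Ω.carrier, dist q p < δ / 2 := by
    obtain ⟨q, hq, hd⟩ := Metric.mem_closure_iff.1 (frontier_subset_closure hp) _ (half_pos hδ)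
    exact ⟨q, hq, by rwa [dist_comm]⟩
  -- Points with $r>0$ exist arbitrarily close to $p$: otherwise $p$ would be a local maximum of
  -- $r$, against the unit gradient.
  obtain ⟨q', hq'p, hq'⟩ : ∃ q', dist q' p < δ / 2 ∧ 0 < r.toFun q' := by
    by_contra! hcon
    have hmax : IsLocalMax r.toFun p := by
      filter_upwards [Metric.ball_mem_nhds p (half_pos hδ)] with z hz
      rw [hr0]
      exact hcon z hz
    have h1 := r.norm_gradient p (r.frontier_subset hp)
    rw [gradient, hmax.fderiv_eq_zero] at h1
    simp at h1
  obtain ⟨ε₁, hε₁, hb₁⟩ := Metric.isOpen_iff.1 Ω.isOpen q hqΩ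
  obtain ⟨ε₂, hε₂, hb₂⟩ := Metric.isOpen_iff.1
    (isOpen_lt continuous_const r.smooth.continuous : IsOpen {z | 0 < r.toFun z}) q' hq'
  -- A bump of radius $\varepsilon/2$ centred anywhere on the segment from $q$ to $q'$ stays in the
  -- ball where $h\ne0$. At $q$ its core lies in $\Omega$; at $q'$ its support misses $\Omega$.
  set ε := min (δ / 2) (min ε₁ ε₂) with hε
  have hεpos : 0 < ε := lt_min (half_pos hδ) (lt_min hε₁ hε₂)
  have hεδ : ε ≤ δ / 2 := min_le_left _ _
  have hεε₁ : ε ≤ ε₁ := (min_le_right _ _).trans (min_le_left _ _)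
  have hεε₂ : ε ≤ ε₂ := (min_le_right _ _).trans (min_le_right _ _)
  let β : ContDiffBump (0 : Cn n) := ⟨ε / 4, ε / 2, by linarith, by linarith⟩
  set g : Cn n → ℂ := fun x => (β x : ℂ) with hg
  have hgs : ContDiff ℝ ∞ g := Complex.ofRealCLM.contDiff.comp β.contDiff
  have hg0 : ∀ x, ε / 2 ≤ ‖x‖ → g x = 0 := by
    intro x hx
    simp only [hg]
    rw [β.zero_of_le_dist (by simpa [dist_eq_norm] using hx), Complex.ofReal_zero]
  have hgc : HasCompactSupport g :=
    β.hasCompactSupport.comp_left (g := fun t : ℝ => (t : ℂ)) Complex.ofReal_zero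
  set v := q' - q with hv
  set J : ℝ → ℂ := fun t => ∫ x in Ω.carrier, g (x - (q + t • v)) with hJ
  have hder : ∀ t ∈ Set.Icc (0 : ℝ) 1, HasDerivAt J 0 t := by
    intro t ht
    have h1 := hasDerivAt_integral_translate Ω hgs hgc q v t
    have hcen : dist (q + t • v) p < δ / 2 := by
      have hconv := (convex_ball p (δ / 2)).add_smul_sub_mem (x := q) (y := q') hqp hq'p ht
      exact hconv
    have hts : ContDiff ℝ ∞ fun y => g (y - (q + t • v)) :=
      hgs.comp (contDiff_id.sub contDiff_const)
    rw [r.integral_fderiv_of_sobBounded hh hb hts, neg_zero] at h1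
    · exact h1
    · intro x hx
      apply hball
      have hxc : dist x (q + t • v) ≤ ε / 2 := by
        have hsub : tsupport (fun y => g (y - (q + t • v))) ⊆
            Metric.closedBall (q + t • v) (ε / 2) := by
          refine closure_minimal (fun y hy => ?_) Metric.isClosed_closedBall
          rw [Metric.mem_closedBall, dist_eq_norm]
          by_contra! hcon
          exact hy (hg0 _ hcon.le)
        exact hsub hx
      have := dist_triangle x (q + t • v) p
      linarith
  have h01 : J 1 = J 0 := by
    have hcst := constant_of_has_deriv_right_zero (f := J) (a := 0) (b := 1)
      (fun t ht => (hder t ht).continuousAt.continuousWithinAt)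
      (fun t ht => (hder t ⟨ht.1, ht.2.le⟩).hasDerivWithinAt)
    exact hcst 1 (Set.right_mem_Icc.2 zero_le_one)
  have hJ1 : J 1 = 0 := by
    simp only [hJ]
    refine setIntegral_eq_zero_of_forall_eq_zero fun x hx => hg0 _ ?_
    by_contra! hcon
    have hxq : dist x q' < ε₂ := by
      rw [dist_eq_norm]
      have : x - (q + (1 : ℝ) • v) = x - q' := by simp [hv]
      rw [this] at hcon
      linarith
    have h1 : 0 < r.toFun x := hb₂ hxq
    exact absurd ((r.neg_iff x).1 hx) (not_lt.2 h1.le)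
  have hJ0 : J 0 = ((∫ x in Ω.carrier, β (x - q) : ℝ) : ℂ) := by
    simp only [hJ, zero_smul, add_zero, hg]
    exact integral_complex_ofReal
  have hpos : 0 < ∫ x in Ω.carrier, β (x - q) := by
    rw [setIntegral_pos_iff_support_of_nonneg_ae]
    · refine lt_of_lt_of_le (Metric.measure_ball_pos volume q (by linarith : 0 < ε / 4))
        (measure_mono fun x hx => ?_)
      rw [Metric.mem_ball, dist_eq_norm] at hx
      refine ⟨?_, hb₁ (by rw [Metric.mem_ball, dist_eq_norm]; linarith)⟩
      rw [Function.mem_support, β.one_of_mem_closedBall]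
      · exact one_ne_zero
      · rw [Metric.mem_closedBall, dist_zero_right]
        exact hx.le
    · exact ae_of_all _ fun x => β.nonneg
    · exact integrableOn_of_continuous Ω (β.continuous.comp (by fun_prop))
  rw [h01, hJ0] at hJ1
  exact hpos.ne' (Complex.ofReal_eq_zero.1 hJ1)

end TopOrder


/-! ### The domain of the adjoint and the splitting into scalar functionals. -/

section AdjointDomain

variable {n : ℕ}

/-- A bound on the graph of an operator extends to the closure of the operator. -/
theorem norm_inner_le_of_mem_graph_closure {E F : Type*} [NormedAddCommGroup E]
    [InnerProductSpace ℂ E] [NormedAddCommGroup F] [InnerProductSpace ℂ F] {T : E →ₗ.[ℂ] F}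
    {y : F} {C : ℝ} (hC : ∀ z ∈ T.graph, ‖inner ℂ y z.2‖ ≤ C * ‖z.1‖) {z : E × F}
    (hz : z ∈ T.closure.graph) : ‖inner ℂ y z.2‖ ≤ C * ‖z.1‖ := by
  by_cases hcl : T.IsClosable
  · rw [← hcl.graph_closure_eq_closure_graph] at hz
    have hclosed : IsClosed {z : E × F | ‖inner ℂ y z.2‖ ≤ C * ‖z.1‖} :=
      isClosed_le (Continuous.inner continuous_const continuous_snd).norm
        (continuous_const.mul continuous_fst.norm)
    exact closure_minimal (fun z hz => hC z hz) hclosed hz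
  -- The closure of a non-closable operator is by default the operator itself, so closability need
  -- not be assumed.
  · rw [LinearPMap.closure_def' hcl] at hz
    exact hC z hz

/-- The domain of the adjoint of the closure of an operator, in terms of the operator itself. -/
theorem mem_domain_adjoint_closure_iff {E F : Type*} [NormedAddCommGroup E]
    [InnerProductSpace ℂ E] [CompleteSpace E] [NormedAddCommGroup F] [InnerProductSpace ℂ F]
    (T : E →ₗ.[ℂ] F) (y : F) :
    y ∈ T.closure†.domain ↔ ∃ C : ℝ, ∀ z ∈ T.graph, ‖inner ℂ y z.2‖ ≤ C * ‖z.1‖ := by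
  rw [LinearPMap.mem_adjoint_domain_iff]
  constructor
  · intro hc
    let S : T.closure.domain →L[ℂ] ℂ := ⟨(innerₛₗ ℂ y).comp T.closure.toFun, hc⟩
    refine ⟨‖S‖, fun z hz => ?_⟩
    obtain ⟨w, hw1, hw2⟩ := (LinearPMap.mem_graph_iff _).1
      (LinearPMap.le_graph_of_le (LinearPMap.le_closure T) hz)
    have h : ‖inner ℂ y (T.closure w)‖ ≤ ‖S‖ * ‖(w : E)‖ := S.le_opNorm w
    rwa [hw1, hw2] at h
  · rintro ⟨C, hC⟩
    refine AddMonoidHomClass.continuous_of_bound _ C fun w => ?_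
    have h : ‖inner ℂ y (T.closure w)‖ ≤ C * ‖(w : E)‖ :=
      norm_inner_le_of_mem_graph_closure (z := ((w : E), T.closure w)) hC (T.closure.mem_graph w)
    exact h

/-- The domain of the adjoint of the closure of an operator with a parametrized graph. -/
theorem mem_domain_adjoint_closure_iff_of_graph_eq {V E F : Type*} [AddCommGroup V] [Module ℂ V]
    [NormedAddCommGroup E] [InnerProductSpace ℂ E] [CompleteSpace E] [NormedAddCommGroup F]
    [InnerProductSpace ℂ F] {T : E →ₗ.[ℂ] F} {a : V →ₗ[ℂ] E} {b : V →ₗ[ℂ] F}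
    (hT : T.graph = LinearMap.range (a.prod b)) (y : F) :
    y ∈ T.closure†.domain ↔ ∃ C : ℝ, ∀ v, ‖inner ℂ y (b v)‖ ≤ C * ‖a v‖ := by
  rw [mem_domain_adjoint_closure_iff, hT]
  refine exists_congr fun C => ⟨fun h v => h _ ⟨v, rfl⟩, ?_⟩
  rintro h _ ⟨v, rfl⟩
  exact h v

theorem mem_domain_dbarAdjoint_iff (Ω : SmoothlyBoundedDomain n) (s q : ℕ)
    (y : Sobolev Ω s (q + 1)) :
    y ∈ (dbarAdjoint Ω s q).domain ↔ ∃ C : ℝ, ∀ φ : SmoothForm n q,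
      ‖inner ℂ y (toSobolev Ω s (q + 1) (smoothDbar n q φ))‖ ≤ C * ‖toSobolev Ω s q φ‖ :=
  mem_domain_adjoint_closure_iff_of_graph_eq (dbarSmooth_graph Ω s q) y

theorem one_le_sqrt_gammaCoeff (α : RealIdx n → ℕ) : 1 ≤ Real.sqrt (gammaCoeff α) := by
  rw [Real.one_le_sqrt]
  exact_mod_cast Nat.multinomial_pos _ _

theorem jet_apply (Ω : SmoothlyBoundedDomain n) (s q : ℕ) (φ : SmoothForm n q)
    (p : FormIdx n q × MultiIdx n s) :
    jet Ω s q φ p = ((Real.sqrt (gammaCoeff p.2.1) : ℝ) : ℂ) •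
      toL2 Ω (smoothDMulti p.2.1 (φ p.1)) := rfl

theorem norm_jet_apply (Ω : SmoothlyBoundedDomain n) (s q : ℕ) (φ : SmoothForm n q)
    (p : FormIdx n q × MultiIdx n s) :
    ‖jet Ω s q φ p‖ = Real.sqrt (gammaCoeff p.2.1) * ‖toL2 Ω (smoothDMulti p.2.1 (φ p.1))‖ := by
  rw [jet_apply, norm_smul, Complex.norm_real, Real.norm_of_nonneg (Real.sqrt_nonneg _)]

/-- The weights satisfy $\gamma_\alpha\ge1$ and there are finitely many $\alpha$. Together with
`norm_jet_single_le` this makes `sobNorm` interchangeable with the Hilbert norm as far as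
boundedness is concerned. -/
theorem sobNorm_le_norm_jet (Ω : SmoothlyBoundedDomain n) (s q : ℕ) (φ : SmoothForm n q)
    (J : FormIdx n q) : sobNorm Ω s (φ J) ≤ Fintype.card (MultiIdx n s) * ‖jet Ω s q φ‖ := by
  have h : ∀ α : MultiIdx n s, ‖toL2 Ω (smoothDMulti α.1 (φ J))‖ ≤ ‖jet Ω s q φ‖ := by
    intro α
    refine le_trans ?_ (PiLp.norm_apply_le (jet Ω s q φ) (J, α))
    rw [norm_jet_apply]
    exact le_mul_of_one_le_left (norm_nonneg _) (one_le_sqrt_gammaCoeff α.1)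
  calc sobNorm Ω s (φ J) ≤ ∑ _α : MultiIdx n s, ‖jet Ω s q φ‖ := Finset.sum_le_sum fun α _ => h α
    _ = _ := by simp

theorem norm_jet_single_le (Ω : SmoothlyBoundedDomain n) (s q : ℕ) (f : SmoothFn n)
    (J : FormIdx n q) :
    ‖jet Ω s q (Pi.single J f)‖ ≤
      (∑ α : MultiIdx n s, Real.sqrt (gammaCoeff α.1)) * sobNorm Ω s f := by
  have h1 : ‖jet Ω s q (Pi.single J f)‖ ≤ ∑ p, ‖jet Ω s q (Pi.single J f) p‖ := by
    rw [PiLp.norm_eq_of_L2]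
    refine Real.sqrt_le_iff.2 ⟨Finset.sum_nonneg fun _ _ => norm_nonneg _, ?_⟩
    exact Finset.sum_sq_le_sq_sum_of_nonneg fun _ _ => norm_nonneg _
  refine h1.trans ?_
  rw [Fintype.sum_prod_type, Finset.sum_eq_single J]
  · rw [Finset.sum_mul]
    refine Finset.sum_le_sum fun α _ => ?_
    rw [norm_jet_apply]
    simp only [Pi.single_eq_same]
    refine mul_le_mul_of_nonneg_left ?_ (Real.sqrt_nonneg _)
    have key := Finset.single_le_sum (s := Finset.univ)
      (f := fun α : MultiIdx n s => ‖toL2 Ω (smoothDMulti α.1 f)‖)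
      (fun _ _ => norm_nonneg _) (Finset.mem_univ α)
    exact key
  · intro J' _ hJ'
    refine Finset.sum_eq_zero fun α _ => ?_
    rw [norm_jet_apply]
    simp [Pi.single_eq_of_ne hJ']
  · simp

/-- The scalar Sobolev inner product as a linear functional of its first entry. -/
def sobInner (Ω : SmoothlyBoundedDomain n) (s : ℕ) (g : SmoothFn n) : SmoothFn n →ₗ[ℂ] ℂ :=
  ∑ α : MultiIdx n s, (gammaCoeff α.1 : ℂ) •
    ((innerₛₗ ℂ (toL2 Ω (smoothDMulti α.1 g))).comp (toL2 Ω ∘ₗ smoothDMulti α.1))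

theorem sobInner_apply (Ω : SmoothlyBoundedDomain n) (s : ℕ) (g f : SmoothFn n) :
    sobInner Ω s g f = ∑ α : MultiIdx n s, (gammaCoeff α.1 : ℂ) *
      ∫ x in Ω.carrier, (smoothDMulti α.1 f : Cn n → ℂ) x *
        (starRingEnd ℂ) ((smoothDMulti α.1 g : Cn n → ℂ) x) := by
  simp only [sobInner, LinearMap.sum_apply, LinearMap.smul_apply, LinearMap.comp_apply,
    smul_eq_mul]
  refine Finset.sum_congr rfl fun α _ => ?_
  congr 1
  rw [innerₛₗ_apply_apply, L2.inner_def]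
  refine integral_congr_ae ?_
  filter_upwards [(memLp_smooth Ω (smoothDMulti α.1 f)).coeFn_toLp,
    (memLp_smooth Ω (smoothDMulti α.1 g)).coeFn_toLp] with x h1 h2
  simp only [toL2, LinearMap.coe_mk, AddHom.coe_mk, h1, h2, RCLike.inner_apply]

/-- The part of `⟨∂̄φ, ψ⟩_s` that comes from the coefficient `φ_J`. -/
def dbarPairing (Ω : SmoothlyBoundedDomain n) (s : ℕ) {q : ℕ} (ψ : SmoothForm n (q + 1))
    (J : FormIdx n q) (f : SmoothFn n) : ℂ :=
  ∑ k : Fin n, ∑ K : FormIdx n (q + 1),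
    (epsSign K k J : ℂ) * sobInner Ω s (ψ K) (smoothWirtingerBar k f)

/-- Exchanging the sums over $K$ and $J$ isolates the contribution of each coefficient $\varphi_J$;
this decouples the problem for forms into scalar ones. -/
theorem inner_jet_smoothDbar (Ω : SmoothlyBoundedDomain n) (s : ℕ) {q : ℕ}
    (ψ : SmoothForm n (q + 1)) (φ : SmoothForm n q) :
    inner ℂ (jet Ω s (q + 1) ψ) (jet Ω s (q + 1) (smoothDbar n q φ)) =
      ∑ J, dbarPairing Ω s ψ J (φ J) := by
  rw [inner_jet]
  have h1 : ∀ K, ∑ α : MultiIdx n s, (gammaCoeff α.1 : ℂ) *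
      ∫ x in Ω.carrier, (smoothDMulti α.1 (smoothDbar n q φ K) : Cn n → ℂ) x *
        (starRingEnd ℂ) ((smoothDMulti α.1 (ψ K) : Cn n → ℂ) x) =
      ∑ k : Fin n, ∑ J : FormIdx n q,
        (epsSign K k J : ℂ) * sobInner Ω s (ψ K) (smoothWirtingerBar k (φ J)) := by
    intro K
    rw [← sobInner_apply]
    simp only [smoothDbar, LinearMap.pi_apply, LinearMap.sum_apply, LinearMap.smul_apply,
      LinearMap.comp_apply, LinearMap.proj_apply, map_sum, map_smul, smul_eq_mul]
  simp only [h1, dbarPairing]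
  rw [Finset.sum_comm' (t' := Finset.univ) (s' := fun _ => Finset.univ) (by simp)]
  conv_rhs => rw [Finset.sum_comm]
  refine Finset.sum_congr rfl fun k _ => ?_
  rw [Finset.sum_comm]

theorem dbarPairing_zero (Ω : SmoothlyBoundedDomain n) (s : ℕ) {q : ℕ}
    (ψ : SmoothForm n (q + 1)) (J : FormIdx n q) : dbarPairing Ω s ψ J 0 = 0 := by
  simp [dbarPairing]

/-- `∂̄*` is defined at `ψ` exactly if all parts of `⟨∂̄φ, ψ⟩_s` are bounded. -/
theorem toSobolev_mem_domain_iff (Ω : SmoothlyBoundedDomain n) (s : ℕ) {q : ℕ}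
    (ψ : SmoothForm n (q + 1)) :
    toSobolev Ω s (q + 1) ψ ∈ (dbarAdjoint Ω s q).domain ↔
      ∀ J, SobBounded Ω s (dbarPairing Ω s ψ J) := by
  have hin : ∀ φ : SmoothForm n q, inner ℂ (toSobolev Ω s (q + 1) ψ)
      (toSobolev Ω s (q + 1) (smoothDbar n q φ)) = ∑ J, dbarPairing Ω s ψ J (φ J) := fun φ =>
    inner_jet_smoothDbar Ω s ψ φ
  have hnorm : ∀ φ : SmoothForm n q, ‖toSobolev Ω s q φ‖ = ‖jet Ω s q φ‖ := fun φ => rfl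
  rw [mem_domain_dbarAdjoint_iff]
  simp only [hin, hnorm]
  constructor
  · rintro ⟨C, hC⟩ J
    refine ⟨|C| * ∑ α : MultiIdx n s, Real.sqrt (gammaCoeff α.1), fun f => ?_⟩
    have h1 : ∑ J', dbarPairing Ω s ψ J' ((Pi.single J f : SmoothForm n q) J') =
        dbarPairing Ω s ψ J f := by
      rw [Finset.sum_eq_single J]
      · simp
      · intro J' _ hJ'
        rw [Pi.single_eq_of_ne hJ', dbarPairing_zero]
      · simp
    -- Forms with a single non-zero coefficient test one $J$ at a time.
    have h2 := hC (Pi.single J f)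
    rw [h1] at h2
    calc _ ≤ C * ‖jet Ω s q (Pi.single J f)‖ := h2
      _ ≤ |C| * ‖jet Ω s q (Pi.single J f)‖ :=
        mul_le_mul_of_nonneg_right (le_abs_self C) (norm_nonneg _)
      _ ≤ |C| * ((∑ α : MultiIdx n s, Real.sqrt (gammaCoeff α.1)) * sobNorm Ω s f) :=
        mul_le_mul_of_nonneg_left (norm_jet_single_le Ω s q f J) (abs_nonneg C)
      _ = _ := by ring
  · intro h
    choose C hC using h
    refine ⟨∑ J, |C J| * Fintype.card (MultiIdx n s), fun φ => ?_⟩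
    rw [Finset.sum_mul]
    refine (norm_sum_le _ _).trans (Finset.sum_le_sum fun J _ => ?_)
    calc _ ≤ C J * sobNorm Ω s (φ J) := hC J (φ J)
      _ ≤ |C J| * sobNorm Ω s (φ J) :=
        mul_le_mul_of_nonneg_right (le_abs_self _) (sobNorm_nonneg _ _ _)
      _ ≤ |C J| * (Fintype.card (MultiIdx n s) * ‖jet Ω s q φ‖) :=
        mul_le_mul_of_nonneg_left (sobNorm_le_norm_jet Ω s q φ J) (abs_nonneg _)
      _ = _ := by ring

theorem SobBounded.iff_of_sub {Ω : SmoothlyBoundedDomain n} {s : ℕ} {ℓ ℓ' : SmoothFn n → ℂ}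
    (h : SobBounded Ω s fun φ => ℓ φ - ℓ' φ) : SobBounded Ω s ℓ ↔ SobBounded Ω s ℓ' := by
  constructor
  · intro h'
    exact (h'.add (h.const_mul (-1))).congr fun φ => by ring
  · intro h'
    exact (h.add h').congr fun φ => by ring

/-- Modulo bounded functionals, `⟨∂̄φ, ψ⟩_s` only involves the normal derivatives of order `s + 1`
of `φ` and the boundary contraction of `ψ`. -/
theorem DefiningFunction.sobBounded_dbarPairing_sub {Ω : SmoothlyBoundedDomain n}
    (r : DefiningFunction Ω) (s : ℕ) {q : ℕ} (ψ : SmoothForm n (q + 1)) (J : FormIdx n q) :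
    SobBounded Ω s fun φ => dbarPairing Ω s ψ J φ -
      ∫ x in Ω.carrier, (starRingEnd ℂ) (r.normalTrace s ψ J x) * r.normalPow (s + 1) φ x := by
  set P : RealIdx n → FormIdx n (q + 1) → SmoothFn n → ℂ := fun i K φ =>
    ∫ x in Ω.carrier, r.nu i x * (starRingEnd ℂ) (r.normalPow s (ψ K) x) *
      r.normalPow (s + 1) φ x with hP
  have hbd : ∀ i K, SobBounded Ω s fun φ => sobInner Ω s (ψ K) (smoothD i φ) - P i K φ := by
    intro i K
    simp only [sobInner_apply]
    exact r.sobBounded_sobolevInner_sub s i (ψ K)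
  have hPint : ∀ i K φ, IntegrableOn (fun x => r.nu i x *
      (starRingEnd ℂ) (r.normalPow s (ψ K) x) * r.normalPow (s + 1) φ x) Ω.carrier := by
    intro i K φ
    exact integrableOn_of_continuous Ω (((r.contDiff_nu i).mul
      (contDiff_conj (r.contDiff_normalPow s _))).mul (r.contDiff_normalPow _ _)).continuous
  -- The factors $\nu$ produced by $\partial/\partial\bar z_k$ combine to
  -- $\frac12(\nu_{x_k}+i\nu_{y_k})=\partial r/\partial\bar z_k$, next to the conjugate of
  -- $N^s\psi_K$. The contraction conjugates the former and not the latter, so the coefficient is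
  -- the conjugate of `normalTrace`.
  have hsum : ∀ φ, ∫ x in Ω.carrier, (starRingEnd ℂ) (r.normalTrace s ψ J x) *
      r.normalPow (s + 1) φ x = ∑ k : Fin n, ∑ K : FormIdx n (q + 1), (epsSign K k J : ℂ) *
        ((1 / 2 : ℂ) * (P (Sum.inl k) K φ + Complex.I * P (Sum.inr k) K φ)) := by
    intro φ
    have hterm : ∀ k K, (epsSign K k J : ℂ) *
        ((1 / 2 : ℂ) * (P (Sum.inl k) K φ + Complex.I * P (Sum.inr k) K φ)) =
        ∫ x in Ω.carrier, (epsSign K k J : ℂ) * (starRingEnd ℂ) (r.normalPow s (ψ K) x) *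
          r.dbarCoeff k x * r.normalPow (s + 1) φ x := by
      intro k K
      simp only [hP]
      rw [← integral_const_mul, ← integral_add (hPint _ _ _) ((hPint _ _ _).const_mul _),
        ← integral_const_mul, ← integral_const_mul]
      refine integral_congr_ae (ae_of_all _ fun x => ?_)
      simp only [r.dbarCoeff_apply]
      ring
    have hcont : ∀ k K, Continuous fun x => (epsSign K k J : ℂ) *
        (starRingEnd ℂ) (r.normalPow s (ψ K) x) * r.dbarCoeff k x * r.normalPow (s + 1) φ x := by
      intro k K
      have hd : Continuous (r.dbarCoeff k) := by
        have := (contDiff_conj (r.contDiff_conj_dbarCoeff k)).continuous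
        simpa using this
      exact ((continuous_const.mul (contDiff_conj (r.contDiff_normalPow s _)).continuous).mul
        hd).mul (r.contDiff_normalPow _ _).continuous
    simp only [hterm]
    rw [Finset.sum_congr rfl fun k _ => (integral_finsetSum _ fun K _ =>
      integrableOn_of_continuous Ω (hcont k K)).symm, ← integral_finsetSum]
    · refine integral_congr_ae (ae_of_all _ fun x => ?_)
      simp only [normalTrace, map_sum, map_mul, Complex.conj_conj, Finset.sum_mul, map_intCast]
    · intro k _
      exact integrableOn_of_continuous Ω (continuous_finsetSum _ fun K _ => hcont k K)
  have hall : SobBounded Ω s fun φ => ∑ k : Fin n, ∑ K : FormIdx n (q + 1),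
      (epsSign K k J : ℂ) * ((1 / 2 : ℂ) *
        ((sobInner Ω s (ψ K) (smoothD (Sum.inl k) φ) - P (Sum.inl k) K φ) +
          Complex.I * (sobInner Ω s (ψ K) (smoothD (Sum.inr k) φ) - P (Sum.inr k) K φ))) :=
    SobBounded.sum _ fun k _ => SobBounded.sum _ fun K _ =>
      (((hbd _ K).add ((hbd _ K).const_mul _)).const_mul _).const_mul _
  refine hall.congr fun φ => ?_
  rw [hsum, dbarPairing, ← Finset.sum_sub_distrib]
  refine Finset.sum_congr rfl fun k _ => ?_
  rw [← Finset.sum_sub_distrib]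
  refine Finset.sum_congr rfl fun K _ => ?_
  simp only [smoothWirtingerBar, LinearMap.smul_apply, LinearMap.add_apply, map_smul, map_add,
    smul_eq_mul]
  ring

theorem DefiningFunction.sobBounded_normalPow_iff {Ω : SmoothlyBoundedDomain n}
    (r : DefiningFunction Ω) (s : ℕ) {h : Cn n → ℂ} (hh : ContDiff ℝ ∞ h) :
    (SobBounded Ω s fun φ => ∫ x in Ω.carrier, h x * r.normalPow (s + 1) φ x) ↔
      ∀ x ∈ frontier Ω.carrier, h x = 0 := by
  constructor
  · intro hb x hx
    exact r.eq_zero_of_sobBounded hh hb hx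
  · intro h0
    exact r.sobBounded_normalPow_of_vanishing s hh h0 (L := []) (by simp)

end AdjointDomain

end DbarSobolev

end

/-! ### The characterisation of the domain. -/

theorem proposition3p1 (n s q : ℕ) (Ω : DbarSobolev.SmoothlyBoundedDomain n)
    (ψ : DbarSobolev.SmoothForm n (q + 1)) :
    DbarSobolev.toSobolev Ω s (q + 1) ψ ∈ (DbarSobolev.dbarAdjoint Ω s q).domain ↔
      ∀ I : DbarSobolev.FormIdx n q, ∀ x ∈ frontier Ω.carrier,
        (DbarSobolev.normalD Ω)^[s]
          (DbarSobolev.contraction (fun K => (ψ K : DbarSobolev.Cn n → ℂ))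
            (DbarSobolev.dbarSignedDist Ω) I) x = 0 := by
  obtain ⟨r⟩ := DbarSobolev.nonempty_definingFunction Ω
  rw [DbarSobolev.toSobolev_mem_domain_iff]
  refine forall_congr' fun I => ?_
  rw [(r.sobBounded_dbarPairing_sub s ψ I).iff_of_sub,
    r.sobBounded_normalPow_iff s (DbarSobolev.contDiff_conj (r.contDiff_normalTrace s ψ I))]
  refine forall₂_congr fun x hx => ?_
  rw [map_eq_zero, r.iterate_normalD_contraction s ψ I (r.frontier_subset hx)]
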